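/- A quandle is a set $Y$ with a binary operation $*$ such that $a*a=a$, every translation $\mathcal R_b\colon a\mapsto a*b$ is a bijection, and $(a*b)*c=(a*c)*(b*c)$. It is connected if the group $\mathrm{Inn}(Y)$ generated by the translations acts transitively on $Y$, and faithful if $b\mapsto\mathcal R_b$ is injective. It is an abelian extension if, for some quandle $X$, some non-trivial abelian group $A$ and some quandle $2$-cocycle $\phi\colon X\times X\to A$ (that is, $\phi(x,y)-\phi(x,z)+\phi(x*y,z)-\phi(x*z,y*z)=0$ and $\phi(x,x)=0$ for all $x,y,z\in X$), it is isomorphic to $E(X,A,\phi)=X\times A$ with the operation $(x,a)*(y,b)=(x*y,\,a+\phi(x,y))$. The Rig quandles $Q(n,i)$ of order $n<48$ are all the connected quandles of order less than $48$ up to isomorphism. Three of them are the following, each with the operation $(t,p)*(s,q)=(sts^{-1},\,s(p))$: * $Q(30,4)$: the pairs $(t,p)$ of a transposition $t\in S_5$ and a point $p\in\{1,\dots,5\}$ with $t(p)=p$; * $Q(36,58)$: the pairs $(t,p)$ of a map $t\colon\mathbb F_3^2\to\mathbb F_3^2$ of the form $t(x)=x+\det(d,x-r)\,d$ with $d,r\in\mathbb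 F_3^2$, $d\neq0$, and a point $p\in\mathbb F_3^2$ with $t(p)=p$; * $Q(45,29)$: the pairs $(t,p)$ of a transposition $t\in S_6$ and a perfect matching $p$ of $\{1,\dots,6\}$ with $t(p)=p$. Proposition. The quandles $Q(30,4)$, $Q(36,58)$ and $Q(45,29)$ are connected and non-faithful, of orders $30$, $36$ and $45$. A connected non-faithful quandle of order less than $48$ fails to be an abelian extension if and only if it is isomorphic to one of $Q(30,4)$, $Q(36,58)$, $Q(45,29)$. -/

import Mathlib

open scoped Quandles

namespace RigQuandle

/-! Conventions.  A quandle operation `a * b` written on the right (so that `x ↦ x * a` is the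
translation by `a`, and `(a * b) * c = (a * c) * (b * c)`) is, in Mathlib, `b ◃ a`. -/

/-- The inner automorphism group: the group of permutations of `Y` generated by the translations
`x ↦ x * a = a ◃ x`. -/
def Inn (Y : Type*) [Quandle Y] : Subgroup (Equiv.Perm Y) :=
  Subgroup.closure (Set.range fun a : Y => (Rack.act' a : Equiv.Perm Y))

/-- A quandle is connected if its inner automorphism group acts transitively on it. -/
def IsConnected (Y : Type*) [Quandle Y] : Prop :=
  MulAction.IsPretransitive (Inn Y) Y

/-- A quandle is faithful if distinct elements have distinct translations. -/
def IsFaithful (Y : Type*) [Quandle Y] : Prop :=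
  Function.Injective fun a : Y => (Rack.act' a : Equiv.Perm Y)

/-- Two quandles are isomorphic if there is a bijective homomorphism between them. -/
def Isomorphic (Y Z : Type*) [Quandle Y] [Quandle Z] : Prop :=
  ∃ f : Y →◃ Z, Function.Bijective f

/-- Quandle `2`-cocycles with coefficients in an abelian group:
`φ(x, y) - φ(x, z) + φ(x * y, z) - φ(x * z, y * z) = 0` and `φ(x, x) = 0`. -/
structure Cocycle (X A : Type*) [Quandle X] [AddCommGroup A] where
  toFun : X → X → A
  cocycle : ∀ x y z : X,
    toFun x y - toFun x z + toFun (y ◃ x) z - toFun (z ◃ x) (z ◃ y) = 0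
  diag : ∀ x : X, toFun x x = 0

/-- The underlying set `X × A` of the extension `E(X, A, φ)`. -/
def Extension {X A : Type*} [Quandle X] [AddCommGroup A] (_φ : Cocycle X A) : Type _ :=
  X × A

/-- The quandle `E(X, A, φ)`, with operation `(x, a) * (y, b) = (x * y, a + φ(x, y))`. -/
instance {X A : Type*} [Quandle X] [AddCommGroup A] (φ : Cocycle X A) :
    Quandle (Extension φ) where
  act q p := (q.1 ◃ p.1, p.2 + φ.toFun p.1 q.1)
  self_distrib := by
    rintro ⟨z, c⟩ ⟨y, b⟩ ⟨x, a⟩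
    refine Prod.ext Shelf.self_distrib ?_
    have h := φ.cocycle x y z
    have h' : φ.toFun x y + φ.toFun (y ◃ x) z = φ.toFun x z + φ.toFun (z ◃ x) (z ◃ y) := by
      rw [← sub_eq_zero, ← h]; abel
    change a + φ.toFun x y + φ.toFun (y ◃ x) z = a + φ.toFun x z + φ.toFun (z ◃ x) (z ◃ y)
    rw [add_assoc, h', add_assoc]
  invAct q p := (q.1 ◃⁻¹ p.1, p.2 - φ.toFun (q.1 ◃⁻¹ p.1) q.1)
  left_inv := by
    rintro ⟨y, b⟩ ⟨x, a⟩
    refine Prod.ext (Rack.invAct_act_eq y x) ?_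
    change a + φ.toFun x y - φ.toFun (y ◃⁻¹ (y ◃ x)) y = a
    rw [Rack.invAct_act_eq, add_sub_cancel_right]
  right_inv := by
    rintro ⟨y, b⟩ ⟨x, a⟩
    refine Prod.ext (Rack.act_invAct_eq y x) ?_
    change a - φ.toFun (y ◃⁻¹ x) y + φ.toFun (y ◃⁻¹ x) y = a
    rw [sub_add_cancel]
  fix := by
    rintro ⟨x, a⟩
    refine Prod.ext Quandle.fix ?_
    change a + φ.toFun x x = a
    rw [φ.diag, add_zero]

/-- `Y` is an abelian extension: it is isomorphic to `E(X, A, φ)` for some quandle `X`, some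
non-trivial abelian group `A` and some quandle `2`-cocycle `φ`.  (For trivial `A` one would have
`E(X, A, φ) ≅ X`, so every quandle would qualify.) -/
def IsAbelianExtension.{u} (Y : Type u) [Quandle Y] : Prop :=
  ∃ (X A : Type u) (_ : Quandle X) (_ : AddCommGroup A) (φ : Cocycle X A),
    Nontrivial A ∧ Isomorphic Y (Extension φ)

/-- A subset of a group that is stable under conjugation by its own elements and their inverses. -/
structure ConjStable (G : Type*) [Group G] where
  carrier : Set G
  conj_mem : ∀ g ∈ carrier, ∀ h ∈ carrier, g * h * g⁻¹ ∈ carrier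
  conj_inv_mem : ∀ g ∈ carrier, ∀ h ∈ carrier, g⁻¹ * h * g ∈ carrier

/-- Pairs `(t, p)` with `t ∈ C` and `p` a point fixed by `t`. -/
def FixedPairs {G : Type*} [Group G] (C : ConjStable G) (P : Type*) [MulAction G P] : Type _ :=
  {x : G × P // x.1 ∈ C.carrier ∧ x.1 • x.2 = x.2}

/-- The quandle of pairs `(t, p)` with `(t, p) * (s, q) = (s t s⁻¹, s • p)`. -/
instance {G : Type*} [Group G] (C : ConjStable G) (P : Type*) [MulAction G P] :
    Quandle (FixedPairs C P) where
  act y x := ⟨(y.1.1 * x.1.1 * y.1.1⁻¹, y.1.1 • x.1.2),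
    C.conj_mem _ y.2.1 _ x.2.1, by simp [mul_smul, x.2.2]⟩
  self_distrib := by
    intro z y x
    exact Subtype.ext (Prod.ext (by simp [mul_assoc]) (by simp [mul_smul]))
  invAct y x := ⟨(y.1.1⁻¹ * x.1.1 * y.1.1, y.1.1⁻¹ • x.1.2),
    C.conj_inv_mem _ y.2.1 _ x.2.1, by simp [mul_smul, x.2.2]⟩
  left_inv := by
    intro y x
    exact Subtype.ext (Prod.ext (by simp [mul_assoc]) (by simp))
  right_inv := by
    intro y x
    exact Subtype.ext (Prod.ext (by simp [mul_assoc]) (by simp))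
  fix := by
    intro x
    exact Subtype.ext (Prod.ext (by simp) x.2.2)

theorem isSwap_conj {n : ℕ} (g h : Equiv.Perm (Fin n)) (hh : h.IsSwap) :
    (g * h * g⁻¹).IsSwap := by
  obtain ⟨a, b, hab, rfl⟩ := hh
  exact ⟨g a, g b, fun e => hab (g.injective e), (Equiv.swap_apply_apply g a b).symm⟩

/-- The transpositions in the symmetric group on `n` letters. -/
def transpositions (n : ℕ) : ConjStable (Equiv.Perm (Fin n)) where
  carrier := {t | t.IsSwap}
  conj_mem g _ h hh := isSwap_conj g h hh
  conj_inv_mem g _ h hh := by simpa using isSwap_conj g⁻¹ h hh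

/-- The affine plane over the field with three elements. -/
abbrev Plane : Type := ZMod 3 × ZMod 3

/-- The standard area form on the plane over the field with three elements. -/
def area (u v : Plane) : ZMod 3 := u.1 * v.2 - u.2 * v.1

/-- `t` is the affine transvection `x ↦ x + ω(d, x - q) d`, for some direction `d ≠ 0` and some
point `q`, where `ω` is the area form; it fixes exactly the points of the line through `q` with
direction `d`, and it depends on this line only. -/
def IsTransvection (t : Equiv.Perm Plane) : Prop :=
  ∃ d q : Plane, d ≠ 0 ∧ ∀ x, t x = x + area d (x - q) • d

theorem isTransvection_conj (g h : Equiv.Perm Plane) (c : ZMod 3) (d q : Plane)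
    (hg : ∀ x, g x = x + (c * area d (x - q)) • d) (hh : IsTransvection h) :
    IsTransvection (g * h * g⁻¹) := by
  obtain ⟨e, r, he, hh⟩ := hh
  refine ⟨e + (c * area d e) • d, g r, ?_, fun x => ?_⟩
  · intro h0
    apply he
    have h1 : area d e = 0 := by
      have := congrArg (area d) h0
      simp only [area, Prod.fst_add, Prod.snd_add, Prod.smul_fst, Prod.smul_snd, smul_eq_mul,
        Prod.fst_zero, Prod.snd_zero] at this ⊢
      linear_combination this
    simpa [h1] using h0
  · obtain ⟨y, rfl⟩ := g.surjective x
    have hy : g⁻¹ (g y) = y := g.symm_apply_apply y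
    simp only [Equiv.Perm.mul_apply, hy]
    simp only [hg, hh]
    ext <;> simp only [area, Prod.fst_add, Prod.snd_add, Prod.fst_sub, Prod.snd_sub,
      Prod.smul_fst, Prod.smul_snd, smul_eq_mul] <;> ring

/-- The twelve affine transvections of the plane over the field with three elements, one for
each line. -/
def transvections : ConjStable (Equiv.Perm Plane) where
  carrier := {t | IsTransvection t}
  conj_mem := by
    rintro g ⟨d, q, -, hg⟩ h hh
    exact isTransvection_conj g h 1 d q (by simpa using hg) hh
  conj_inv_mem := by
    rintro g ⟨d, q, -, hg⟩ h hh
    have hg' : ∀ x, g⁻¹ x = x + ((-1) * area d (x - q)) • d := by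
      intro x
      obtain ⟨y, rfl⟩ := g.surjective x
      have hy : g⁻¹ (g y) = y := g.symm_apply_apply y
      rw [hy, hg]
      ext <;> simp only [area, Prod.fst_add, Prod.snd_add, Prod.fst_sub, Prod.snd_sub,
        Prod.smul_fst, Prod.smul_snd, smul_eq_mul] <;> ring
    simpa using isTransvection_conj g⁻¹ h (-1) d q hg' hh

/-- The perfect matchings of six points, as fixed-point-free involutions. -/
def PerfectMatching : Type :=
  {s : Equiv.Perm (Fin 6) // s * s = 1 ∧ ∀ x, s x ≠ x}

/-- The symmetric group acts on perfect matchings by relabelling the points. -/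
instance : MulAction (Equiv.Perm (Fin 6)) PerfectMatching where
  smul g s := ⟨g * s.1 * g⁻¹,
    by rw [show g * s.1 * g⁻¹ * (g * s.1 * g⁻¹) = g * (s.1 * s.1) * g⁻¹ by group, s.2.1]; simp,
    fun x hx => s.2.2 (g⁻¹ x) (g.injective (by simpa using hx))⟩
  one_smul s := Subtype.ext (show 1 * s.1 * 1⁻¹ = s.1 by simp)
  mul_smul g h s := Subtype.ext
    (show g * h * s.1 * (g * h)⁻¹ = g * (h * s.1 * h⁻¹) * g⁻¹ by group)

/-- `Q(30, 4)`: transpositions of five points together with a fixed point.  Its translations form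
the quandle `Q(10, 1)` of transpositions of five points. -/
abbrev Q30_4 : Type := FixedPairs (transpositions 5) (Fin 5)

/-- `Q(36, 58)`: flags of the affine plane over the field with three elements, a line being
represented by its transvection.  Its translations form the quandle `Q(12, 10)` of
transvections. -/
abbrev Q36_58 : Type := FixedPairs transvections Plane

/-- `Q(45, 29)`: transpositions of six points together with an invariant perfect matching (that
is, a matching having the transposed pair as an edge).  Its translations form the quandle
`Q(15, 7)` of transpositions of six points. -/
abbrev Q45_29 : Type := FixedPairs (transpositions 6) PerfectMatching

end RigQuandle

namespace RigQuandle.Search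

noncomputable section

/-- `force n g = g n`; reducing it evaluates `n` first. -/
def force {α : Type} (n : ℕ) (g : ℕ → α) : α := Nat.rec (g 0) (fun m _ => g (Nat.succ m)) n

/-- Position of the entry `(a, b)` in a table with sixteen columns of four bits. -/
def pos (a b : ℕ) : ℕ := Nat.add (Nat.mul (Nat.succ a) 64) (Nat.mul b 4)

/-- The entry `(a, b)` of a table. -/
def get (T a b : ℕ) : ℕ := Nat.land (Nat.shiftRight T (pos a b)) 15

/-- A checksum. The kernel hashes a literal by its lowest bits, so these must vary. -/
def mix (p v : ℕ) : ℕ :=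
  Nat.land (Nat.shiftRight (Nat.mul (Nat.add p v) 11400714819323198485) 20) 4294967295

/-- Fill in the empty entry `(a, b)` of a table. The lowest bits hold a checksum. -/
def put (T a b v : ℕ) : ℕ :=
  force (pos a b) fun p => Nat.xor (Nat.xor T (Nat.shiftLeft v p)) (mix p v)

/-- A partial multiplication table on the names `1, …, k`: `T` holds the known products `a * b`,
`I` the known quotients (`a` at the place `(a * b, b)`), `U` (row `0`) an automorphism. Entries are
`0` if unknown. The level tells which elements are known to have a name. -/
structure St where
  k : ℕ
  T : ℕ
  I : ℕ
  U : ℕ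
  lev : ℕ

def bindR (r : Option (ℕ × ℕ)) (f : ℕ → ℕ → Option (ℕ × ℕ)) : Option (ℕ × ℕ) :=
  match r with
  | none => none
  | some p => force p.1 fun T => force p.2 fun I => f T I

/-- Record `a * b = v`; `none` if this is inconsistent. -/
def record (a b v T I : ℕ) : Option (ℕ × ℕ) :=
  force (get T a b) fun g => cond (Nat.beq g 0)
    (force (get I v b) fun h => cond (Nat.beq h 0) (some (put T a b v, put I v b a))
      (cond (Nat.beq h a) (some (put T a b v, I)) none))
    (cond (Nat.beq g v) (some (T, I)) none)

/-- Record `a * b = v` and its immediate consequences. -/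
def recordSym (q a b v T I : ℕ) : Option (ℕ × ℕ) :=
  bindR (record a b v T I) fun T I =>
    bindR (cond (Nat.beq v a) (record b a b T I) (some (T, I))) fun T I =>
      cond (Nat.beq q 2) (record v b a T I) (some (T, I))

/-- Record the images of `a * b = v` under translation by the first element and under `U`. -/
def recordLoop (q U n : ℕ) : ℕ → ℕ → ℕ → ℕ → ℕ → Option (ℕ × ℕ) :=
  Nat.rec (fun _ _ _ T I => some (T, I))
    (fun m ih a b v T I => bindR (recordSym q a b v T I) fun T I =>
      force (get T a 1) fun a => force (get T b 1) fun b => force (get T v 1) fun v =>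
        cond (Nat.beq (Nat.mod m q) 0)
          (force (get U 0 a) fun a => force (get U 0 b) fun b => force (get U 0 v) fun v =>
            ih a b v T I)
          (ih a b v T I)) n

def recordAll (q : ℕ) (s : St) (a b v : ℕ) : Option (ℕ × ℕ) :=
  recordLoop q s.U (Nat.mul 3 q) a b v s.T s.I

/-- Push the updated state, unless there was a conflict. -/
def push (s : St) (r : Option (ℕ × ℕ)) (rest : List St) : List St :=
  match r with
  | none => rest
  | some p => force p.1 fun T => force p.2 fun I => ⟨s.k, T, I, s.U, s.lev⟩ :: rest

/-- Use `(a * b) * c = (a * c) * (b * c)`. -/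
def stepDistrib (q : ℕ) (s : St) (a b c : ℕ) (rest : List St) : List St :=
  force (get s.T b c) fun bc => cond (Nat.beq bc 0) (s :: rest) <|
  force (get s.T a b) fun ab => force (get s.T a c) fun ac =>
  force (get s.T ab c) fun x => force (get s.T ac bc) fun y =>
  cond (Nat.beq ab 0)
    (force (get s.I y c) fun w => cond (Nat.beq w 0) (s :: rest)
      (push s (recordAll q s a b w) rest))
    (cond (Nat.beq ac 0)
      (force (get s.I x bc) fun w => cond (Nat.beq w 0) (s :: rest)
        (push s (recordAll q s a c w) rest))
      (cond (Nat.beq x 0)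
        (cond (Nat.beq y 0) (s :: rest) (push s (recordAll q s ab c y) rest))
        (push s (recordAll q s ac bc x) rest)))

def walk (T c n : ℕ) : ℕ → ℕ :=
  Nat.rec (fun b => b) (fun _ ih b => force (get T b c) fun b => ih b) n

/-- Use that translations have order dividing `q`. -/
def stepPower (q : ℕ) (s : St) (b c : ℕ) (rest : List St) : List St :=
  force (walk s.T c (Nat.sub q 1) b) fun l => cond (Nat.beq l 0) (s :: rest)
    (push s (recordAll q s l c b) rest)

/-- Check a property of the numbers `1, …, n`. -/
def allUpTo (n : ℕ) (f : ℕ → Bool) : Bool :=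
  Nat.rec true (fun m ih => cond (f (Nat.succ m)) ih false) n

def agreeOnSupport (s : St) (a c : ℕ) : Bool :=
  allUpTo s.k fun z => cond (Nat.beq (get s.U 0 z) z) true
    (force (get s.T z a) fun g => cond (Nat.beq g 0) false
      (Nat.beq g (cond (Nat.beq c 16) z (get s.T z c))))

/-- Use that elements fixed by `U` are determined by their action on the support of `U`; the
column `16` stands for the identity. -/
def stepFaith (s : St) (a c : ℕ) (rest : List St) : List St :=
  cond (and (Nat.ble 2 s.lev) (and (Nat.ble 1 a) (and (Nat.ble a s.k)
      (and (Nat.beq (get s.U 0 a) a)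
        (or (Nat.beq c 16) (and (Nat.ble 1 c) (and (Nat.ble c s.k)
          (and (Nat.beq (get s.U 0 c) c) (not (Nat.beq a c))))))))))
    (cond (agreeOnSupport s a c) rest (s :: rest)) (s :: rest)

/-- A new name for an element commuting with the first one, with image `u` under `U`. -/
def addName (s : St) (u : ℕ) : St :=
  force (Nat.succ s.k) fun k =>
  force (put (put (put s.T k k k) k 1 k) 1 k 1) fun T =>
  force (put (put (put s.I k k k) k 1 k) 1 k 1) fun I =>
  force (put s.U 0 k u) fun U => ⟨k, T, I, U, s.lev⟩

def addTriple (s : St) : St :=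
  addName (addName (addName s (Nat.add s.k 2)) (Nat.add s.k 3)) (Nat.add s.k 1)

def pushNamed (q a b v : ℕ) (s : St) (rest : List St) : List St :=
  match s with
  | ⟨k, T, I, U, lev⟩ => push ⟨k, T, I, U, lev⟩ (recordAll q ⟨k, T, I, U, lev⟩ a b v) rest

def branchLoop (q : ℕ) (s : St) (a b : ℕ) (rest : List St) (n : ℕ) : List St :=
  Nat.rec rest (fun m ih => force (Nat.sub s.k m) fun v => force (get s.I v b) fun h =>
    cond (or (Nat.beq h 0) (Nat.beq h a)) (push s (recordAll q s a b v) ih) ih) n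

/-- Distinguish the possible values of `a * b`. -/
def stepBranch (q : ℕ) (s : St) (a b : ℕ) (rest : List St) : List St :=
  cond (and (Nat.ble 1 a) (and (Nat.ble a s.k) (and (Nat.ble 1 b) (Nat.ble b s.k))))
    (branchLoop q s a b
      (cond (and (Nat.ble s.lev 2) (Nat.ble s.k 14))
        (pushNamed q a b (Nat.succ s.k) (addName s (Nat.succ s.k))
          (cond (and (Nat.ble s.lev 1) (Nat.ble s.k 12))
            (pushNamed q a b (Nat.succ s.k) (addTriple s) rest) rest)) rest) s.k)
    (s :: rest)

/-- Either all elements moved by `U` have a name, or there are three new ones. -/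
def stepSupport (s : St) (rest : List St) : List St :=
  ⟨s.k, s.T, s.I, s.U, 2⟩ :: cond (Nat.ble s.k 12) (addTriple s :: rest) rest

/-- If all products of named elements are named, all elements are named. -/
def stepClosed (s : St) (rest : List St) : List St :=
  cond (allUpTo s.k fun a => allUpTo s.k fun b => not (Nat.beq (get s.T a b) 0))
    (⟨s.k, s.T, s.I, s.U, 3⟩ :: rest) (s :: rest)

/-- Compare with one of the expected tables. -/
def stepTarget (tgt : List ℕ) (s : St) (i : ℕ) (rest : List St) : List St :=
  cond (and (Nat.ble 3 s.lev) (Nat.beq (tgt.getD i 0) s.T)) rest (s :: rest)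

def orbitInner (T a c : ℕ) (n : ℕ) (cont : List ℕ → ℕ → ℕ) : List ℕ → ℕ → ℕ :=
  Nat.rec cont (fun m ih l S =>
    force (Nat.add (Nat.mul 16 (get T a (Nat.succ m))) (get T c (Nat.succ m))) fun p =>
      cond (Nat.beq (Nat.land (Nat.shiftRight S p) 1) 0)
        (force (Nat.lor S (Nat.shiftLeft 1 p)) fun S => ih (p :: l) S) (ih l S)) n

/-- The pairs reached from a list of pairs by translations, as a bit set. -/
def orbitLoop (k T n : ℕ) : List ℕ → ℕ → ℕ :=
  Nat.rec (fun _ S => S) (fun _ ih l S => match l with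
    | [] => S
    | p :: l => force (Nat.shiftRight p 4) fun a => force (Nat.land p 15) fun c =>
        orbitInner T a c k ih l S) n

def hasPair (S a c : ℕ) : Bool :=
  Nat.beq (Nat.land (Nat.shiftRight S (Nat.add (Nat.mul 16 a) c)) 1) 1

def orbitClosed (k T S : ℕ) : Bool :=
  allUpTo k fun a => allUpTo k fun c => cond (hasPair S a c)
    (allUpTo k fun b => force (get T a b) fun a' => force (get T c b) fun c' =>
      and (Nat.ble 1 a') (and (Nat.ble 1 c') (hasPair S a' c'))) true

/-- Use that an invariant relation which holds at `(1, y)` also holds at `(1, U y)` and, if `y = 1`,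
on the diagonal. -/
def stepOrbit (s : St) (y : ℕ) (rest : List St) : List St :=
  force (orbitLoop s.k s.T 256 [Nat.add 16 y] (Nat.shiftLeft 1 (Nat.add 16 y))) fun S =>
    cond (and (Nat.ble 3 s.lev) (and (Nat.ble 1 y) (and (Nat.ble y s.k)
        (and (hasPair S 1 y) (and (orbitClosed s.k s.T S)
          (not (cond (Nat.beq y 1) (allUpTo s.k fun c => hasPair S c c)
            (hasPair S 1 (get s.U 0 y)))))))))
      rest (s :: rest)

/-- Handle one token. -/
def step (q : ℕ) (tgt : List ℕ) (tok : ℕ) (s : St) (rest : List St) : List St :=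
  force (Nat.succ (Nat.shiftRight tok 8)) fun a =>
  force (Nat.succ (Nat.land (Nat.shiftRight tok 4) 15)) fun b =>
  force (Nat.succ (Nat.land tok 15)) fun c =>
  cond (Nat.beq a 16)
    (cond (Nat.beq b 16)
      (cond (Nat.beq c 2) (stepSupport s rest) <|
        cond (Nat.beq c 3) (stepClosed s rest) (stepTarget tgt s (Nat.sub c 4) rest))
      (cond (Nat.beq c 16) (stepOrbit s b rest) (stepPower q s b c rest)))
    (cond (Nat.beq b 16) (stepFaith s a c rest)
      (cond (Nat.beq c 16) (stepBranch q s a b rest) (stepDistrib q s a b c rest)))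

/-- Handle up to `n` tokens packed into a number, each on the first state of the list. -/
def runChunk (q : ℕ) (tgt : List ℕ) (n : ℕ) : ℕ → List St → List St :=
  Nat.rec (fun _ l => l) (fun _ ih N l => match l with
    | [] => []
    | ⟨k, T, I, U, lev⟩ :: rest =>
      force (Nat.shiftRight N 12) fun N' => force (Nat.land N 4095) fun tok =>
        ih N' (cond (Nat.beq tok 0) (⟨k, T, I, U, lev⟩ :: rest)
          (step q tgt tok ⟨k, T, I, U, lev⟩ rest))) n

def run (q : ℕ) (tgt : List ℕ) (cert : List ℕ) : List St → List St :=
  List.rec (fun l => l) (fun N _ ih l => match l with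
    | [] => []
    | s :: rest => ih (runChunk q tgt 30 N (s :: rest))) cert

/-- The translation by the first element and the automorphism `U`, as lists of images of
`1, …, k`. -/
structure Config where
  t : List ℕ
  u : List ℕ

def Config.tAt (c : Config) (a : ℕ) : ℕ := c.t.getD (Nat.sub a 1) 0

def Config.uAt (c : Config) (a : ℕ) : ℕ := c.u.getD (Nat.sub a 1) 0

/-- The products of the first `n` names with the first one and with themselves. -/
def Config.fillT (c : Config) (n : ℕ) : ℕ :=
  Nat.rec 0 (fun m ih => cond (Nat.beq m 0) (put ih 1 1 1)
    (force (c.tAt (Nat.succ m)) fun v =>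
      force (put (put ih (Nat.succ m) (Nat.succ m) (Nat.succ m)) (Nat.succ m) 1 v) fun T =>
        cond (Nat.beq v (Nat.succ m)) (put T 1 (Nat.succ m) 1) T)) n

def Config.fillI (c : Config) (n : ℕ) : ℕ :=
  Nat.rec 0 (fun m ih => cond (Nat.beq m 0) (put ih 1 1 1)
    (force (c.tAt (Nat.succ m)) fun v =>
      force (put (put ih (Nat.succ m) (Nat.succ m) (Nat.succ m)) v 1 (Nat.succ m)) fun T =>
        cond (Nat.beq v (Nat.succ m)) (put T 1 (Nat.succ m) 1) T)) n

def Config.fillU (c : Config) (n : ℕ) : ℕ :=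
  Nat.rec 0 (fun m ih => put ih 0 (Nat.succ m) (c.uAt (Nat.succ m))) n

def Config.toSt (c : Config) : St :=
  force c.t.length fun k => force (c.fillT k) fun T => force (c.fillI k) fun I =>
    force (c.fillU k) fun U => ⟨k, T, I, U, 1⟩

/-- Add one more cycle of the translation, on which `U` is the `r`-th power of the translation. -/
def Config.addCycle (q r : ℕ) (c : Config) : Config :=
  ⟨c.t ++ (List.range q).map fun i => c.t.length + 1 + (i + 1) % q,
    c.u ++ (List.range q).map fun i => c.t.length + 1 + (i + r) % q⟩

/-- Add three more cycles of the translation, permuted by `U`. -/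
def Config.addCycles (q : ℕ) (c : Config) : Config :=
  ⟨c.t ++ (List.range (3 * q)).map fun i => c.t.length + 1 + (q * (i / q) + (i % q + 1) % q),
    c.u ++ (List.range (3 * q)).map fun i => c.t.length + 1 + (q * ((i / q + 1) % 3) + i % q)⟩

/-- All ways to add cycles, up to a total of fifteen elements. -/
def Config.extend (q : ℕ) (rots : List ℕ) : ℕ → Config → List Config
  | 0, c => [c]
  | n + 1, c => c ::
      ((if c.t.length + q ≤ 15 then
          rots.flatMap fun r => Config.extend q rots n (c.addCycle q r) else []) ++
        (if c.t.length + 3 * q ≤ 15 then Config.extend q rots n (c.addCycles q) else []))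

/-- The first element alone. -/
def Config.base : Config := ⟨[1], [1]⟩

end

end RigQuandle.Search

namespace RigQuandle.Search

@[simp] theorem force_eq {α : Type} (n : ℕ) (g : ℕ → α) : force n g = g n := by
  cases n <;> rfl

theorem pos_eq (a b : ℕ) : pos a b = 64 * (a + 1) + 4 * b := by
  change (a + 1) * 64 + b * 4 = _
  omega

theorem testBit_get (T a b i : ℕ) :
    (get T a b).testBit i = (T.testBit (64 * (a + 1) + 4 * b + i) && decide (i < 4)) := by
  change ((T >>> pos a b) &&& (2 ^ 4 - 1)).testBit i = _
  rw [Nat.testBit_land, Nat.testBit_shiftRight, Nat.testBit_two_pow_sub_one, pos_eq]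

theorem get_lt (T a b : ℕ) : get T a b < 16 := by
  change (T >>> pos a b) &&& (2 ^ 4 - 1) < 16
  rw [Nat.and_two_pow_sub_one_eq_mod]
  exact Nat.mod_lt _ (by norm_num)

theorem mix_lt (p v : ℕ) : mix p v < 2 ^ 32 := by
  change (((p + v) * 11400714819323198485) >>> 20) &&& (2 ^ 32 - 1) < 2 ^ 32
  rw [Nat.and_two_pow_sub_one_eq_mod]
  exact Nat.mod_lt _ (by norm_num)

theorem get_put {T a b v a' b' : ℕ} (hb : b < 16) (hv : v < 16) (ha' : a' < 16)
    (hb' : b' < 16) : get (put T a b v) a' b' =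
      if a = a' ∧ b = b' then get T a b ^^^ v else get T a' b' := by
  have hput : put T a b v = (T ^^^ (v <<< pos a b)) ^^^ mix (pos a b) v := by
    simp only [put, force_eq]; rfl
  apply Nat.eq_of_testBit_eq
  intro i
  have hm : (mix (pos a b) v).testBit (64 * (a' + 1) + 4 * b' + i) = false :=
    Nat.testBit_lt_two_pow ((mix_lt _ _).trans_le (Nat.pow_le_pow_right (by norm_num) (by omega)))
  have hvb : ∀ j, 4 ≤ j → v.testBit j = false := fun j hj =>
    Nat.testBit_lt_two_pow (hv.trans_le (by
      calc 16 = 2 ^ 4 := rfl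
        _ ≤ 2 ^ j := Nat.pow_le_pow_right (by norm_num) hj))
  rw [testBit_get, hput, Nat.testBit_xor, Nat.testBit_xor, hm, Nat.testBit_shiftLeft, pos_eq,
    Bool.xor_false]
  by_cases hi : i < 4
  · split_ifs with h
    · obtain ⟨rfl, rfl⟩ := h
      rw [Nat.testBit_xor, testBit_get]
      simp [hi]
    · rw [testBit_get]
      by_cases hge : 64 * (a' + 1) + 4 * b' + i ≥ 64 * (a + 1) + 4 * b
      · rw [hvb _ (by omega)]; simp
      · simp [hge]
  · split_ifs with h
    · rw [Nat.testBit_xor, testBit_get]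
      simp [hi, hvb i (by omega)]
    · rw [testBit_get]; simp [hi]

theorem get_put_self {T a b v : ℕ} (ha : a < 16) (hb : b < 16) (hv : v < 16) (h : get T a b = 0) :
    get (put T a b v) a b = v := by
  rw [get_put hb hv ha hb]; simp [h]

theorem get_put_of_ne {T a b v a' b' : ℕ} (hb : b < 16) (hv : v < 16) (ha' : a' < 16)
    (hb' : b' < 16) (h : ¬ (a = a' ∧ b = b')) : get (put T a b v) a' b' = get T a' b' := by
  rw [get_put hb hv ha' hb', if_neg h]

theorem beq_true_iff {a b : ℕ} : Nat.beq a b = true ↔ a = b := Nat.beq_eq ▸ Iff.rfl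

theorem beq_eq_decide (a b : ℕ) : Nat.beq a b = decide (a = b) := by
  rw [Bool.eq_iff_iff, beq_true_iff, decide_eq_true_iff]

theorem ble_eq_decide (a b : ℕ) : Nat.ble a b = decide (a ≤ b) := by
  rw [Bool.eq_iff_iff, Nat.ble_eq, decide_eq_true_iff]

theorem allUpTo_iff (n : ℕ) (f : ℕ → Bool) :
    allUpTo n f = true ↔ ∀ i, 1 ≤ i → i ≤ n → f i = true := by
  induction n with
  | zero => exact ⟨fun _ i h1 h2 => by omega, fun _ => rfl⟩
  | succ n ih =>
    change cond (f (n + 1)) (allUpTo n f) false = true ↔ _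
    rw [cond_eq_ite]
    constructor
    · intro h i h1 h2
      split_ifs at h with hf
      rcases Nat.lt_or_ge n i with h3 | h3
      · obtain rfl : i = n + 1 := by omega
        exact hf
      · exact ih.1 h i h1 h3
    · intro h
      rw [if_pos (h _ (by omega) le_rfl)]
      exact ih.2 fun i h1 h2 => h i h1 (by omega)

/-- A finite quandle of at most fifteen elements with an automorphism `U` fixing a point `x`, with
the properties that the search relies on. -/
structure Model (X : Type*) (q : ℕ) where
  op : X → X → X
  U : X → X
  x : X
  idem : ∀ a, op a a = a
  inj : ∀ a a' b, op a b = op a' b → a = a'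
  dist : ∀ a b c, op (op a b) c = op (op a c) (op b c)
  comm : ∀ a b, op a b = a → op b a = b
  pow : ∀ a b, (fun z => op z b)^[q] a = a
  U_op : ∀ a b, U (op a b) = op (U a) (U b)
  U_inj : Function.Injective U
  U_x : U x = x
  card : ∀ f : Fin 16 → X, ¬ Function.Injective f
  gen : ∀ K : Set X, x ∈ K → (∀ z, op z x ≠ z → z ∈ K) → (∀ a ∈ K, ∀ b ∈ K, op a b ∈ K) →
    ∀ z, z ∈ K
  inv : ∀ ρ : X → X → Prop, (∀ a b c, ρ a b → ρ (op a c) (op b c)) → ∀ y, ρ x y → ρ x (U y)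
  conn : ∀ K : Set X, x ∈ K → (∀ a ∈ K, ∀ c, op a c ∈ K) → ∀ z, z ∈ K
  faith : ∀ y y', U y = y → U y' = y' → (∀ z, U z ≠ z → op z y = op z y') → y = y'
  faith_one : ∀ y, U y = y → ∃ z, U z ≠ z ∧ op z y ≠ z
  cube : ∀ a, op a x = a → U (U (U a)) = a

variable {X : Type*} {q : ℕ}

/-- `a` is one of the names `1, …, k`. -/
def IsName (k a : ℕ) : Prop := 1 ≤ a ∧ a ≤ k

/-- The entries of the tables are correct. -/
structure Facts (M : Model X q) (nm : ℕ → X) (k T I : ℕ) : Prop where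
  t : ∀ a b, a < 16 → b < 16 → get T a b ≠ 0 → IsName k a ∧ IsName k b ∧ IsName k (get T a b) ∧
    M.op (nm a) (nm b) = nm (get T a b)
  i : ∀ v b, v < 16 → b < 16 → get I v b ≠ 0 → IsName k v ∧ IsName k b ∧ IsName k (get I v b) ∧
    M.op (nm (get I v b)) (nm b) = nm v

/-- The state describes the model, with the naming `nm`. -/
structure Good (M : Model X q) (nm : ℕ → X) (s : St) : Prop extends
    Facts M nm s.k s.T s.I where
  k1 : 1 ≤ s.k
  k15 : s.k ≤ 15
  inj : ∀ a b, IsName s.k a → IsName s.k b → nm a = nm b → a = b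
  one : nm 1 = M.x
  u : ∀ a, IsName s.k a → IsName s.k (get s.U 0 a) ∧ M.U (nm a) = nm (get s.U 0 a)
  u0 : ∀ a, a < 16 → s.k < a → get s.U 0 a = 0
  col : ∀ a, IsName s.k a → get s.T a 1 ≠ 0
  l1 : ∀ e, (∀ a, IsName s.k a → nm a ≠ e) → M.op e M.x = e
  l2 : 2 ≤ s.lev → ∀ e, (∀ a, IsName s.k a → nm a ≠ e) → M.U e = e
  l3 : 3 ≤ s.lev → ∀ e, ∃ a, IsName s.k a ∧ nm a = e

/-- The model has the multiplication table `T`. -/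
def Realizes (M : Model X q) (T : ℕ) : Prop :=
  ∃ (nm : ℕ → X) (k : ℕ), 1 ≤ k ∧ k ≤ 15 ∧ (∀ a, IsName k a → get T a 1 ≠ 0) ∧
    (∀ a b, IsName k a → IsName k b → nm a = nm b → a = b) ∧ (∀ e, ∃ a, IsName k a ∧ nm a = e) ∧
    ∀ a b, a < 16 → b < 16 → get T a b ≠ 0 → IsName k a ∧ IsName k b ∧ IsName k (get T a b) ∧
      M.op (nm a) (nm b) = nm (get T a b)

/-- Known entries of `T` stay known. -/
def Grows (T T' : ℕ) : Prop := ∀ a b, a < 16 → b < 16 → get T a b ≠ 0 → get T' a b ≠ 0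

theorem Grows.refl (T : ℕ) : Grows T T := fun _ _ _ _ h => h

theorem Grows.trans {T T' T'' : ℕ} (h : Grows T T') (h' : Grows T' T'') : Grows T T'' :=
  fun a b ha hb hab => h' a b ha hb (h a b ha hb hab)

theorem IsName.lt {k a : ℕ} (hk : k ≤ 15) (h : IsName k a) : a < 16 := by
  have := h.2; omega

theorem grows_put {T a b v : ℕ} (hb : b < 16) (hv : v < 16) (h : get T a b = 0) :
    Grows T (put T a b v) := by
  intro a' b' ha' hb' h'
  rw [get_put_of_ne hb hv ha' hb']
  · exact h'
  · rintro ⟨rfl, rfl⟩; exact h' h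

section
variable {M : Model X q} {nm : ℕ → X} {k T I : ℕ}

theorem Facts.putT (hF : Facts M nm k T I) (hk : k ≤ 15) {a b v : ℕ} (ha : IsName k a)
    (hb : IsName k b) (hv : IsName k v) (h : M.op (nm a) (nm b) = nm v) (h0 : get T a b = 0) :
    Facts M nm k (put T a b v) I := by
  refine ⟨fun a' b' ha' hb' h' => ?_, hF.i⟩
  by_cases hab : a = a' ∧ b = b'
  · obtain ⟨rfl, rfl⟩ := hab
    rw [get_put_self (ha.lt hk) (hb.lt hk) (hv.lt hk) h0]
    exact ⟨ha, hb, hv, h⟩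
  · rw [get_put_of_ne (hb.lt hk) (hv.lt hk) ha' hb' hab] at h' ⊢
    exact hF.t a' b' ha' hb' h'

theorem Facts.putI (hF : Facts M nm k T I) (hk : k ≤ 15) {a b v : ℕ} (ha : IsName k a)
    (hb : IsName k b) (hv : IsName k v) (h : M.op (nm a) (nm b) = nm v) (h0 : get I v b = 0) :
    Facts M nm k T (put I v b a) := by
  refine ⟨hF.t, fun a' b' ha' hb' h' => ?_⟩
  by_cases hab : v = a' ∧ b = b'
  · obtain ⟨rfl, rfl⟩ := hab
    rw [get_put_self (hv.lt hk) (hb.lt hk) (ha.lt hk) h0]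
    exact ⟨hv, hb, ha, h⟩
  · rw [get_put_of_ne (hb.lt hk) (ha.lt hk) ha' hb' hab] at h' ⊢
    exact hF.i a' b' ha' hb' h'

variable (hk : k ≤ 15) (hinj : ∀ a b, IsName k a → IsName k b → nm a = nm b → a = b)
include hk hinj

theorem record_sound (hF : Facts M nm k T I) {a b v : ℕ} (ha : IsName k a) (hb : IsName k b)
    (hv : IsName k v) (h : M.op (nm a) (nm b) = nm v) :
    ∃ T' I', record a b v T I = some (T', I') ∧ Facts M nm k T' I' ∧ Grows T T' := by
  have ha' := ha.lt hk
  have hb' := hb.lt hk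
  have hv' := hv.lt hk
  simp only [record, force_eq, beq_eq_decide, Bool.cond_decide]
  by_cases hT : get T a b = 0
  · rw [if_pos hT]
    by_cases hI : get I v b = 0
    · rw [if_pos hI]
      exact ⟨_, _, rfl, (hF.putT hk ha hb hv h hT).putI hk ha hb hv h hI, grows_put hb' hv' hT⟩
    · obtain ⟨-, -, h2, h3⟩ := hF.i v b hv' hb' hI
      have h4 : get I v b = a := hinj _ _ h2 ha (M.inj _ _ (nm b) (h3.trans h.symm))
      rw [if_neg hI, if_pos h4]
      exact ⟨_, _, rfl, hF.putT hk ha hb hv h hT, grows_put hb' hv' hT⟩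
  · obtain ⟨-, -, h2, h3⟩ := hF.t a b ha' hb' hT
    have h4 : get T a b = v := hinj _ _ h2 hv (h3.symm.trans h)
    rw [if_neg hT, if_pos h4]
    exact ⟨_, _, rfl, hF, Grows.refl _⟩

theorem recordSym_sound (hF : Facts M nm k T I) {a b v : ℕ} (ha : IsName k a) (hb : IsName k b)
    (hv : IsName k v) (h : M.op (nm a) (nm b) = nm v) :
    ∃ T' I', recordSym q a b v T I = some (T', I') ∧ Facts M nm k T' I' ∧ Grows T T' := by
  obtain ⟨T₁, I₁, e₁, F₁, G₁⟩ := record_sound hk hinj hF ha hb hv h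
  have : ∃ T₂ I₂, cond (Nat.beq v a) (record b a b T₁ I₁) (some (T₁, I₁)) = some (T₂, I₂) ∧
      Facts M nm k T₂ I₂ ∧ Grows T₁ T₂ := by
    rw [beq_eq_decide, Bool.cond_decide]
    split_ifs with hva
    · subst hva
      exact record_sound hk hinj F₁ hb ha hb (M.comm _ _ h)
    · exact ⟨_, _, rfl, F₁, Grows.refl _⟩
  obtain ⟨T₂, I₂, e₂, F₂, G₂⟩ := this
  have : ∃ T₃ I₃, cond (Nat.beq q 2) (record v b a T₂ I₂) (some (T₂, I₂)) = some (T₃, I₃) ∧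
      Facts M nm k T₃ I₃ ∧ Grows T₂ T₃ := by
    rw [beq_eq_decide, Bool.cond_decide]
    split_ifs with hq
    · subst hq
      have := M.pow (nm a) (nm b)
      simp only [Function.iterate_succ, Function.iterate_zero, Function.comp, id] at this
      exact record_sound hk hinj F₂ hv hb ha (by rw [← h, this])
    · exact ⟨_, _, rfl, F₂, Grows.refl _⟩
  obtain ⟨T₃, I₃, e₃, F₃, G₃⟩ := this
  refine ⟨T₃, I₃, ?_, F₃, (G₁.trans G₂).trans G₃⟩
  simp only [recordSym, e₁, bindR, force_eq, e₂, e₃]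

theorem recordLoop_sound {U : ℕ} (h1 : nm 1 = M.x)
    (hU : ∀ a, IsName k a → IsName k (get U 0 a) ∧ M.U (nm a) = nm (get U 0 a)) (n : ℕ) :
    ∀ {T I a b v : ℕ}, Facts M nm k T I → (∀ a, IsName k a → get T a 1 ≠ 0) → IsName k a →
      IsName k b → IsName k v → M.op (nm a) (nm b) = nm v →
    ∃ T' I', recordLoop q U n a b v T I = some (T', I') ∧ Facts M nm k T' I' ∧ Grows T T' := by
  induction n with
  | zero => intro T I a b v hF _ _ _ _ _; exact ⟨_, _, rfl, hF, Grows.refl _⟩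
  | succ n ih =>
    intro T I a b v hF hcol ha hb hv h
    obtain ⟨T₁, I₁, e₁, F₁, G₁⟩ := recordSym_sound hk hinj hF ha hb hv h
    have hcol₁ : ∀ a, IsName k a → get T₁ a 1 ≠ 0 := fun a ha =>
      G₁ a 1 (ha.lt hk) (by norm_num) (hcol a ha)
    have ht : ∀ a, IsName k a → IsName k (get T₁ a 1) ∧ M.op (nm a) M.x = nm (get T₁ a 1) := by
      intro a ha
      obtain ⟨-, -, h2, h3⟩ := F₁.t a 1 (ha.lt hk) (by norm_num) (hcol₁ a ha)
      exact ⟨h2, h1 ▸ h3⟩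
    have hstep : recordLoop q U (n + 1) a b v T I =
        bindR (recordSym q a b v T I) fun T I =>
      force (get T a 1) fun a => force (get T b 1) fun b => force (get T v 1) fun v =>
        cond (Nat.beq (Nat.mod n q) 0)
          (force (get U 0 a) fun a => force (get U 0 b) fun b => force (get U 0 v) fun v =>
            recordLoop q U n a b v T I)
          (recordLoop q U n a b v T I) := rfl
    have hop : M.op (nm (get T₁ a 1)) (nm (get T₁ b 1)) = nm (get T₁ v 1) := by
      rw [← (ht a ha).2, ← (ht b hb).2, ← (ht v hv).2, ← h, ← M.dist]
    rw [hstep, e₁]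
    simp only [bindR, force_eq, beq_eq_decide, Bool.cond_decide]
    split_ifs
    · obtain ⟨T', I', e, F, G⟩ := ih F₁ hcol₁ (hU _ (ht a ha).1).1 (hU _ (ht b hb).1).1
        (hU _ (ht v hv).1).1 (by
          rw [← (hU _ (ht a ha).1).2, ← (hU _ (ht b hb).1).2, ← (hU _ (ht v hv).1).2, ← hop,
            M.U_op])
      exact ⟨T', I', e, F, G₁.trans G⟩
    · obtain ⟨T', I', e, F, G⟩ := ih F₁ hcol₁ (ht a ha).1 (ht b hb).1 (ht v hv).1 hop
      exact ⟨T', I', e, F, G₁.trans G⟩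

end

/-- The states of the list, or the expected tables, cover the model. -/
def Covers (M : Model X q) (tgt : List ℕ) (l : List St) : Prop :=
  (∃ s ∈ l, ∃ nm, Good M nm s) ∨ ∃ T ∈ tgt, Realizes M T

/-- Replacing `s :: rest` by `l` loses no model. -/
def Sound (M : Model X q) (tgt : List ℕ) (s : St) (rest l : List St) : Prop :=
  rest ⊆ l ∧ ∀ nm, Good M nm s → Covers M tgt l

section
variable {M : Model X q} {tgt : List ℕ} {s : St} {rest l : List St} {nm : ℕ → X}

theorem Sound.covers (h : Sound M tgt s rest l) (hc : Covers M tgt (s :: rest)) :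
    Covers M tgt l := by
  rcases hc with ⟨s', hs', nm, hg⟩ | ht
  · rcases List.mem_cons.1 hs' with rfl | hs'
    · exact h.2 nm hg
    · exact Or.inl ⟨s', h.1 hs', nm, hg⟩
  · exact Or.inr ht

theorem Sound.keep : Sound M tgt s rest (s :: rest) :=
  ⟨List.subset_cons_self _ _, fun nm h => Or.inl ⟨s, List.mem_cons_self, nm, h⟩⟩

theorem subset_push (r : Option (ℕ × ℕ)) : rest ⊆ push s r rest := by
  cases r with
  | none => exact List.Subset.refl _
  | some p => simp only [push, force_eq]; exact List.subset_cons_self _ _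

theorem Good.push_recordAll (hg : Good M nm s) {a b v : ℕ} (ha : IsName s.k a) (hb : IsName s.k b)
    (hv : IsName s.k v) (h : M.op (nm a) (nm b) = nm v) :
    Covers M tgt (push s (recordAll q s a b v) rest) := by
  obtain ⟨T', I', e, F, G⟩ := recordLoop_sound hg.k15 hg.inj hg.one hg.u (3 * q) hg.toFacts
    hg.col ha hb hv h
  have e' : recordAll q s a b v = some (T', I') := e
  rw [e']
  simp only [push, force_eq]
  refine Or.inl ⟨_, List.mem_cons_self, nm, ?_⟩
  exact ⟨F, hg.k1, hg.k15, hg.inj, hg.one, hg.u, hg.u0,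
    fun a ha => G a 1 (ha.lt hg.k15) (by norm_num) (hg.col a ha), hg.l1, hg.l2, hg.l3⟩

theorem Sound.push {a b v : ℕ} (h : ∀ nm, Good M nm s → IsName s.k a ∧ IsName s.k b ∧
    IsName s.k v ∧ M.op (nm a) (nm b) = nm v) :
    Sound M tgt s rest (push s (recordAll q s a b v) rest) :=
  ⟨subset_push _, fun nm hg => hg.push_recordAll (h nm hg).1 (h nm hg).2.1 (h nm hg).2.2.1
    (h nm hg).2.2.2⟩

theorem stepDistrib_sound {a b c : ℕ} (ha : a < 16) (hb : b < 16) (hc : c < 16) :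
    Sound M tgt s rest (stepDistrib q s a b c rest) := by
  simp only [stepDistrib, force_eq, beq_eq_decide, Bool.cond_decide]
  have hl := fun a b => get_lt s.T a b
  split_ifs with h1 h2 h3 h4 h5 h6 h7
  · exact Sound.keep
  · exact Sound.keep
  · apply Sound.push
    intro nm hg
    obtain ⟨n1, -, n3, e1⟩ := hg.i _ c (hl _ _) hc h3
    have hy : get s.T (get s.T a c) (get s.T b c) ≠ 0 := by have := n1.1; omega
    obtain ⟨m1, m2, -, e2⟩ := hg.t _ _ (hl _ _) (hl _ _) hy
    obtain ⟨ka, kc, -, e3⟩ := hg.t a c ha hc (by have := m1.1; omega)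
    obtain ⟨kb, -, -, e4⟩ := hg.t b c hb hc h1
    refine ⟨ka, kb, n3, M.inj _ _ (nm c) ?_⟩
    rw [M.dist, e3, e4, e2, e1]
  · exact Sound.keep
  · apply Sound.push
    intro nm hg
    obtain ⟨n1, -, n3, e1⟩ := hg.i _ _ (hl _ _) (hl _ _) h5
    have hx : get s.T (get s.T a b) c ≠ 0 := by have := n1.1; omega
    obtain ⟨-, -, -, e2⟩ := hg.t _ _ (hl _ _) hc hx
    obtain ⟨ka, kb, -, e3⟩ := hg.t a b ha hb h2
    obtain ⟨-, kc, -, e4⟩ := hg.t b c hb hc h1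
    refine ⟨ka, kc, n3, M.inj _ _ (nm (get s.T b c)) ?_⟩
    rw [e1, ← e4, ← M.dist, e3, e2]
  · exact Sound.keep
  · apply Sound.push
    intro nm hg
    obtain ⟨ka, kb, kab, e3⟩ := hg.t a b ha hb h2
    obtain ⟨-, kc, kbc, e4⟩ := hg.t b c hb hc h1
    obtain ⟨-, -, kac, e5⟩ := hg.t a c ha hc h4
    obtain ⟨-, -, ky, e6⟩ := hg.t _ _ (hl _ _) (hl _ _) h7
    exact ⟨kab, kc, ky, by rw [← e3, M.dist, e5, e4, e6]⟩
  · apply Sound.push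
    intro nm hg
    obtain ⟨ka, kb, kab, e3⟩ := hg.t a b ha hb h2
    obtain ⟨-, kc, kbc, e4⟩ := hg.t b c hb hc h1
    obtain ⟨-, -, kac, e5⟩ := hg.t a c ha hc h4
    obtain ⟨-, -, kx, e6⟩ := hg.t _ _ (hl _ _) hc h6
    exact ⟨kac, kbc, kx, by rw [← e5, ← e4, ← M.dist, e3, e6]⟩

theorem walk_sound (hg : Good M nm s) {c : ℕ} (hc : IsName s.k c) (n : ℕ) :
    ∀ b, b < 16 → walk s.T c n b ≠ 0 → (0 < n → IsName s.k b) ∧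
      (IsName s.k b → IsName s.k (walk s.T c n b)) ∧
      (fun z => M.op z (nm c))^[n] (nm b) = nm (walk s.T c n b) := by
  induction n with
  | zero => intro b _ _; exact ⟨fun h => absurd h (lt_irrefl _), id, rfl⟩
  | succ n ih =>
    intro b hb h
    have e : walk s.T c (n + 1) b = walk s.T c n (get s.T b c) := by
      change force (get s.T b c) (fun b => walk s.T c n b) = _
      rw [force_eq]
    rw [e] at h ⊢
    have hne : get s.T b c ≠ 0 := by
      intro h0
      rw [h0] at h
      cases n with
      | zero => exact h rfl
      | succ n =>
        have := (ih 0 (by norm_num) h).1 (by omega)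
        exact absurd this.1 (by norm_num)
    obtain ⟨kb, -, kv, e1⟩ := hg.t b c hb (hc.lt hg.k15) hne
    obtain ⟨-, i2, i3⟩ := ih _ (get_lt _ _ _) h
    refine ⟨fun _ => kb, fun _ => i2 kv, ?_⟩
    rw [Function.iterate_succ_apply, e1, i3]

theorem stepPower_sound (hq : 2 ≤ q) {b c : ℕ} (hb : b < 16) (hc : c < 16) :
    Sound M tgt s rest (stepPower q s b c rest) := by
  simp only [stepPower, force_eq, beq_eq_decide, Bool.cond_decide]
  split_ifs with h1
  · exact Sound.keep
  · apply Sound.push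
    intro nm hg
    have hsub : Nat.sub q 1 = q - 1 := rfl
    rw [hsub] at h1 ⊢
    have hcn : IsName s.k c := by
      obtain ⟨n, hn⟩ : ∃ n, q - 1 = n + 1 := ⟨q - 2, by omega⟩
      rw [hn] at h1
      have e : walk s.T c (n + 1) b = walk s.T c n (get s.T b c) := by
        change force (get s.T b c) (fun b => walk s.T c n b) = _
        rw [force_eq]
      rw [e] at h1
      by_contra hcn
      have h0 : ∀ b, b < 16 → get s.T b c = 0 := by
        intro b hb
        by_contra h
        exact hcn (hg.t b c hb hc h).2.1
      have : ∀ n, walk s.T c n 0 = 0 := by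
        intro n
        induction n with
        | zero => rfl
        | succ n ih =>
          change force (get s.T 0 c) (fun b => walk s.T c n b) = 0
          rw [force_eq, h0 0 (by norm_num), ih]
      rw [h0 b hb, this] at h1
      exact h1 rfl
    obtain ⟨w1, w2, w3⟩ := walk_sound hg hcn (q - 1) b hb h1
    have kb := w1 (by omega)
    refine ⟨w2 kb, hcn, kb, ?_⟩
    rw [← w3, ← Function.iterate_succ_apply' (fun z => M.op z (nm c)), Nat.succ_eq_add_one,
      Nat.sub_add_cancel (by omega), M.pow]

end

end RigQuandle.Search

namespace RigQuandle.Search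

variable {X : Type*} {q : ℕ} {M : Model X q} {tgt : List ℕ} {s : St} {rest l : List St} {nm : ℕ → X}

theorem agreeOnSupport_spec {a c : ℕ} (h : agreeOnSupport s a c = true) :
    ∀ z, IsName s.k z → get s.U 0 z ≠ z → get s.T z a ≠ 0 ∧
      get s.T z a = if c = 16 then z else get s.T z c := by
  simp only [agreeOnSupport, allUpTo_iff, force_eq, beq_eq_decide, Bool.cond_decide] at h
  intro z hz hu
  have := h z hz.1 hz.2
  rw [if_neg hu] at this
  by_cases h0 : get s.T z a = 0
  · simp [h0] at this
  · rw [if_neg h0] at this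
    exact ⟨h0, of_decide_eq_true this⟩

theorem stepFaith_sound {a c : ℕ} (ha : a < 16) (hc : c < 17) :
    Sound M tgt s rest (stepFaith s a c rest) := by
  simp only [stepFaith, beq_eq_decide, ble_eq_decide, cond_eq_ite, Bool.and_eq_true,
    Bool.or_eq_true, decide_eq_true_iff, Bool.not_eq_true', decide_eq_false_iff_not]
  split_ifs with h1 h2
  · refine ⟨List.Subset.refl _, fun nm hg => ?_⟩
    exfalso
    replace h2 := agreeOnSupport_spec h2
    obtain ⟨hlev, ha1, hak, hua, hcc⟩ := h1
    have kz : ∀ z, M.U z ≠ z → ∃ i, IsName s.k i ∧ nm i = z := by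
      intro z hz
      by_contra hcon
      push Not at hcon
      exact hz (hg.l2 hlev z hcon)
    have kmov : ∀ i, IsName s.k i → M.U (nm i) ≠ nm i → get s.U 0 i ≠ i := by
      intro i hi h h'
      apply h
      rw [(hg.u i hi).2, h']
    have hUa : M.U (nm a) = nm a := by rw [(hg.u a ⟨ha1, hak⟩).2, hua]
    rcases hcc with rfl | ⟨hc1, hck, huc, hac⟩
    · obtain ⟨z, hz, hz'⟩ := M.faith_one _ hUa
      obtain ⟨i, hi, rfl⟩ := kz z hz
      obtain ⟨h0, h3⟩ := h2 i hi (kmov i hi hz)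
      rw [if_pos rfl] at h3
      apply hz'
      rw [(hg.t i a (hi.lt hg.k15) ha h0).2.2.2, h3]
    · have hUc : M.U (nm c) = nm c := by rw [(hg.u c ⟨hc1, hck⟩).2, huc]
      refine hac (hg.inj a c ⟨ha1, hak⟩ ⟨hc1, hck⟩ (M.faith _ _ hUa hUc ?_))
      intro z hz
      obtain ⟨i, hi, rfl⟩ := kz z hz
      obtain ⟨h0, h3⟩ := h2 i hi (kmov i hi hz)
      have hk := hg.k15
      rw [if_neg (by omega)] at h3
      rw [(hg.t i a (hi.lt hg.k15) ha h0).2.2.2, (hg.t i c (hi.lt hg.k15) (by omega) (h3 ▸ h0)).2.2.2,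
        h3]
  · exact Sound.keep
  · exact Sound.keep

/-- A naming extended by one more element. -/
def extendName (nm : ℕ → X) (k : ℕ) (e : X) : ℕ → X := fun a => if a = k + 1 then e else nm a

theorem extendName_of_le {k a : ℕ} {e : X} (h : a ≤ k) : extendName nm k e a = nm a :=
  if_neg (by omega)

theorem extendName_self {k : ℕ} {e : X} : extendName nm k e (k + 1) = e := if_pos rfl

/-- What `addName` preserves; the images under `U` of new elements need not have a name yet. -/
structure Partial (M : Model X q) (nm : ℕ → X) (s : St) : Prop extends
    Facts M nm s.k s.T s.I where
  k1 : 1 ≤ s.k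
  k15 : s.k ≤ 15
  inj : ∀ a b, IsName s.k a → IsName s.k b → nm a = nm b → a = b
  one : nm 1 = M.x
  u0 : ∀ a, a < 16 → s.k < a → get s.U 0 a = 0
  col : ∀ a, IsName s.k a → get s.T a 1 ≠ 0

theorem Good.toPartial (h : Good M nm s) : Partial M nm s :=
  ⟨h.toFacts, h.k1, h.k15, h.inj, h.one, h.u0, h.col⟩

theorem addName_eq (s : St) (u : ℕ) : addName s u =
    ⟨s.k + 1, put (put (put s.T (s.k + 1) (s.k + 1) (s.k + 1)) (s.k + 1) 1 (s.k + 1)) 1 (s.k + 1) 1,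
      put (put (put s.I (s.k + 1) (s.k + 1) (s.k + 1)) (s.k + 1) 1 (s.k + 1)) 1 (s.k + 1) 1,
      put s.U 0 (s.k + 1) u, s.lev⟩ := by
  simp only [addName, force_eq, Nat.succ_eq_add_one]

theorem Partial.addName (h : Partial M nm s) (hk : s.k ≤ 14) {e : X}
    (he : ∀ a, IsName s.k a → nm a ≠ e) (hx : M.op e M.x = e) {u : ℕ} (hu : u < 16) :
    Partial M (extendName nm s.k e) (addName s u) ∧ get (addName s u).U 0 (s.k + 1) = u ∧
      ∀ a, IsName s.k a → get (addName s u).U 0 a = get s.U 0 a := by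
  rw [addName_eq]
  set nm' := extendName nm s.k e with hnm'
  have old : ∀ a, IsName s.k a → nm' a = nm a := fun a ha => extendName_of_le ha.2
  have new : nm' (s.k + 1) = e := extendName_self
  have lift : ∀ a, IsName s.k a → IsName (s.k + 1) a := fun a ha => ⟨ha.1, ha.2.trans (by omega)⟩
  have k1 := h.k1
  have kk : IsName (s.k + 1) (s.k + 1) := ⟨by omega, le_rfl⟩
  have k1' : IsName (s.k + 1) 1 := ⟨le_rfl, by omega⟩
  have hk' : s.k + 1 ≤ 15 := by omega
  have F0 : Facts M nm' (s.k + 1) s.T s.I := by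
    refine ⟨fun a b ha hb hab => ?_, fun a b ha hb hab => ?_⟩
    · obtain ⟨h1, h2, h3, h4⟩ := h.t a b ha hb hab
      exact ⟨lift _ h1, lift _ h2, lift _ h3, by rw [old _ h1, old _ h2, old _ h3, h4]⟩
    · obtain ⟨h1, h2, h3, h4⟩ := h.i a b ha hb hab
      exact ⟨lift _ h1, lift _ h2, lift _ h3, by rw [old _ h1, old _ h2, old _ h3, h4]⟩
  have zT : ∀ a b, a < 16 → b < 16 → (a = s.k + 1 ∨ b = s.k + 1) → get s.T a b = 0 := by
    intro a b ha hb hab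
    by_contra hne
    obtain ⟨h1, h2, -⟩ := h.t a b ha hb hne
    have := h1.2
    have := h2.2
    omega
  have zI : ∀ a b, a < 16 → b < 16 → (a = s.k + 1 ∨ b = s.k + 1) → get s.I a b = 0 := by
    intro a b ha hb hab
    by_contra hne
    obtain ⟨h1, h2, -⟩ := h.i a b ha hb hne
    have := h1.2
    have := h2.2
    omega
  have one' : nm' 1 = M.x := by rw [old 1 ⟨le_rfl, h.k1⟩, h.one]
  have f1 : M.op (nm' (s.k + 1)) (nm' (s.k + 1)) = nm' (s.k + 1) := M.idem _
  have f2 : M.op (nm' (s.k + 1)) (nm' 1) = nm' (s.k + 1) := by rw [new, one', hx]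
  have f3 : M.op (nm' 1) (nm' (s.k + 1)) = nm' 1 := M.comm _ _ f2
  have p1 : ∀ {T a b v}, b < 16 → v < 16 → ∀ {a' b'}, a' < 16 → b' < 16 →
      get T a' b' = 0 → ¬ (a = a' ∧ b = b') → get (put T a b v) a' b' = 0 := by
    intro T a b v hb hv a' b' ha' hb' h0 hne
    rw [get_put_of_ne hb hv ha' hb' hne, h0]
  have b1 : s.k + 1 < 16 := by omega
  have g1 := zT (s.k + 1) (s.k + 1) b1 b1 (Or.inl rfl)
  have g2 : get (put s.T (s.k + 1) (s.k + 1) (s.k + 1)) (s.k + 1) 1 = 0 :=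
    p1 b1 b1 b1 (by omega) (zT _ _ b1 (by omega) (Or.inl rfl)) (by omega)
  have g3 : get (put (put s.T (s.k + 1) (s.k + 1) (s.k + 1)) (s.k + 1) 1 (s.k + 1)) 1 (s.k + 1) = 0 :=
    p1 (by omega) b1 (by omega) b1 (p1 b1 b1 (by omega) b1
      (zT _ _ (by omega) b1 (Or.inr rfl)) (by omega)) (by omega)
  have i1 := zI (s.k + 1) (s.k + 1) b1 b1 (Or.inl rfl)
  have i2 : get (put s.I (s.k + 1) (s.k + 1) (s.k + 1)) (s.k + 1) 1 = 0 :=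
    p1 b1 b1 b1 (by omega) (zI _ _ b1 (by omega) (Or.inl rfl)) (by omega)
  have i3 : get (put (put s.I (s.k + 1) (s.k + 1) (s.k + 1)) (s.k + 1) 1 (s.k + 1)) 1 (s.k + 1) = 0 :=
    p1 (by omega) b1 (by omega) b1 (p1 b1 b1 (by omega) b1
      (zI _ _ (by omega) b1 (Or.inr rfl)) (by omega)) (by omega)
  refine ⟨⟨?_, by simp, hk', ?_, one', ?_, ?_⟩, ?_, ?_⟩
  · exact ((((((F0.putT hk' kk kk kk f1 g1).putT hk' kk k1' kk f2 g2).putT hk' k1' kk k1' f3 g3).putI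
      hk' kk kk kk f1 i1).putI hk' kk k1' kk f2 i2).putI hk' k1' kk k1' f3 i3)
  · intro a b ha hb hab
    simp only at ha hb
    have split : ∀ a, IsName (s.k + 1) a → IsName s.k a ∨ a = s.k + 1 := by
      intro a ha
      have h1 := ha.1
      have h2 := ha.2
      by_cases h3 : a = s.k + 1
      · exact Or.inr h3
      · exact Or.inl ⟨h1, by omega⟩
    rcases split a ha with ha | rfl <;> rcases split b hb with hb | rfl
    · rw [old a ha, old b hb] at hab
      exact h.inj a b ha hb hab
    · rw [old a ha, new] at hab
      exact absurd hab (he a ha)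
    · rw [old b hb, new] at hab
      exact absurd hab.symm (he b hb)
    · rfl
  · intro a ha hka
    simp only at hka ⊢
    rw [get_put_of_ne b1 hu (by omega) ha (by omega)]
    exact h.u0 a ha (by omega)
  · intro a ha
    simp only at ha ⊢
    have a16 : a < 16 := ha.lt hk'
    refine grows_put b1 (by omega) g3 a 1 a16 (by omega) ?_
    by_cases hak : a = s.k + 1
    · subst hak
      rw [get_put_self b1 (by omega) b1 g2]
      omega
    · refine grows_put (by omega) b1 g2 a 1 a16 (by omega) ?_
      refine grows_put b1 b1 g1 a 1 a16 (by omega) ?_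
      exact h.col a ⟨ha.1, by have := ha.2; omega⟩
  · simp only
    rw [get_put_self (by omega) b1 hu (h.u0 _ b1 (by omega))]
  · intro a ha
    simp only
    rw [get_put_of_ne b1 hu (by omega) (by have := ha.2; omega)
      (by have := ha.2; omega)]

theorem Partial.good (h : Partial M nm s)
    (u : ∀ a, IsName s.k a → IsName s.k (get s.U 0 a) ∧ M.U (nm a) = nm (get s.U 0 a))
    (l1 : ∀ e, (∀ a, IsName s.k a → nm a ≠ e) → M.op e M.x = e)
    (l2 : 2 ≤ s.lev → ∀ e, (∀ a, IsName s.k a → nm a ≠ e) → M.U e = e)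
    (l3 : 3 ≤ s.lev → ∀ e, ∃ a, IsName s.k a ∧ nm a = e) : Good M nm s :=
  ⟨h.toFacts, h.k1, h.k15, h.inj, h.one, u, h.u0, h.col, l1, l2, l3⟩

/-- There are at most fifteen elements. -/
theorem Partial.k_le (h : Partial M nm s) {e : X} (he : ∀ a, IsName s.k a → nm a ≠ e) :
    s.k ≤ 14 := by
  by_contra hk
  have hk15 : s.k = 15 := by have := h.k15; omega
  refine M.card (fun i => if i.1 = 0 then e else nm i.1) ?_
  intro i j hij
  simp only at hij
  have name : ∀ i : Fin 16, i.1 ≠ 0 → IsName s.k i.1 := fun i hi => ⟨by omega, by omega⟩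
  split_ifs at hij with hi hj hj
  · exact Fin.ext (by omega)
  · exact absurd hij.symm (he _ (name j hj))
  · exact absurd hij (he _ (name i hi))
  · exact Fin.ext (h.inj _ _ (name i hi) (name j hj) hij)

theorem extendName_ne {k : ℕ} {e e' : X} (he : ∀ a, IsName k a → nm a ≠ e') (hne : e ≠ e') :
    ∀ a, IsName (k + 1) a → extendName nm k e a ≠ e' := by
  intro a ha
  by_cases h : a = k + 1
  · subst h; rw [extendName_self]; exact hne
  · have h2 := ha.2
    rw [extendName_of_le (by omega)]
    exact he a ⟨ha.1, by omega⟩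

theorem of_extendName_ne {k : ℕ} {e e' : X} (h : ∀ a, IsName (k + 1) a → extendName nm k e a ≠ e') :
    ∀ a, IsName k a → nm a ≠ e' := by
  intro a ha h'
  exact h a ⟨ha.1, ha.2.trans (by omega)⟩ (by rw [extendName_of_le ha.2, h'])

theorem Good.addFixed (hg : Good M nm s) (hlev : s.lev ≤ 2) {e : X}
    (he : ∀ a, IsName s.k a → nm a ≠ e) (hU : M.U e = e) :
    s.k ≤ 14 ∧ Good M (extendName nm s.k e) (addName s (s.k + 1)) := by
  have hk := hg.toPartial.k_le he
  refine ⟨hk, ?_⟩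
  obtain ⟨P, u1, u2⟩ := hg.toPartial.addName hk he (hg.l1 e he) (u := s.k + 1) (by omega)
  have ek : (addName s (s.k + 1)).k = s.k + 1 := by rw [addName_eq]
  have el : (addName s (s.k + 1)).lev = s.lev := by rw [addName_eq]
  refine P.good ?_ ?_ ?_ ?_ <;> rw [ek]
  · intro a ha
    by_cases h : a = s.k + 1
    · subst h; rw [u1, extendName_self]; exact ⟨ha, hU⟩
    · have han : IsName s.k a := ⟨ha.1, by have := ha.2; omega⟩
      obtain ⟨v1, v2⟩ := hg.u a han
      rw [u2 a han, extendName_of_le han.2, extendName_of_le v1.2]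
      exact ⟨⟨v1.1, by have := v1.2; omega⟩, v2⟩
  · exact fun e' he' => hg.l1 e' (of_extendName_ne he')
  · rw [el]; exact fun hl e' he' => hg.l2 hl e' (of_extendName_ne he')
  · rw [el]; intro hl; omega

theorem Good.addTriple (hg : Good M nm s) (hlev : s.lev ≤ 1) {e : X}
    (he : ∀ a, IsName s.k a → nm a ≠ e) (hU : M.U e ≠ e) :
    s.k ≤ 12 ∧ ∃ nm', Good M nm' (addTriple s) ∧ nm' (s.k + 1) = e ∧
      ∀ a, IsName s.k a → nm' a = nm a := by
  have hx := hg.l1 e he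
  have cube := M.cube e hx
  have uc : ∀ e, (∀ a, IsName s.k a → nm a ≠ e) → ∀ a, IsName s.k a → nm a ≠ M.U e := by
    intro e he a ha h
    have hmaps : ∀ b : Fin s.k, ∃ c : Fin s.k, get s.U 0 (b.1 + 1) = c.1 + 1 := by
      intro b
      obtain ⟨⟨h1, h2⟩, -⟩ := hg.u (b.1 + 1) ⟨by omega, by omega⟩
      exact ⟨⟨get s.U 0 (b.1 + 1) - 1, by omega⟩, by simp only; omega⟩
    choose f hf using hmaps
    have finj : Function.Injective f := by
      intro b c hbc
      have hb := (hg.u (b.1 + 1) ⟨by omega, by omega⟩).2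
      have hc := (hg.u (c.1 + 1) ⟨by omega, by omega⟩).2
      rw [hf] at hb hc
      rw [hbc, ← hc] at hb
      have := hg.inj _ _ ⟨by omega, by omega⟩ ⟨by omega, by omega⟩ (M.U_inj hb)
      exact Fin.ext (by omega)
    obtain ⟨b, hb⟩ := (Finite.injective_iff_surjective.1 finj) ⟨a - 1, by have := ha.1; have := ha.2; omega⟩
    have hb' := (hg.u (b.1 + 1) ⟨by omega, by omega⟩).2
    rw [hf, hb] at hb'
    simp only [Nat.sub_add_cancel ha.1] at hb'
    rw [h] at hb'
    exact he _ ⟨by omega, by omega⟩ (M.U_inj hb')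
  have he1 := uc e he
  have he2 := uc _ he1
  have n1 : M.U (M.U e) ≠ e := fun h => hU (by rw [h] at cube; exact cube)
  have n2 : M.U e ≠ M.U (M.U e) := fun h => hU (M.U_inj h.symm)
  have hk := hg.toPartial.k_le he
  have hk12 : s.k ≤ 12 := by
    have Q1 := (hg.toPartial.addName hk he hx (u := 0) (by omega)).1
    have j1 : (addName s 0).k = s.k + 1 := by rw [addName_eq]
    have d1 : ∀ a, IsName (Search.addName s 0).k a → extendName nm s.k e a ≠ M.U e := by
      rw [j1]; exact extendName_ne he1 hU.symm
    have Q2 := (Q1.addName (Q1.k_le d1) d1 (hg.l1 _ he1) (u := 0) (by omega)).1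
    have j2 : (addName (addName s 0) 0).k = s.k + 2 := by rw [addName_eq, j1]
    have := Q2.k_le (e := M.U (M.U e)) (by
      rw [j2, j1]; exact extendName_ne (extendName_ne he2 n1.symm) n2)
    omega
  obtain ⟨P1, u1, u1'⟩ := hg.toPartial.addName hk he hx (u := s.k + 2) (by omega)
  have ek1 : (addName s (s.k + 2)).k = s.k + 1 := by rw [addName_eq]
  have el1 : (addName s (s.k + 2)).lev = s.lev := by rw [addName_eq]
  set s1 := Search.addName s (s.k + 2) with hs1
  set nm1 := extendName nm s.k e with hnm1
  have he1' : ∀ a, IsName s1.k a → nm1 a ≠ M.U e := by rw [ek1]; exact extendName_ne he1 hU.symm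
  have hk1 := P1.k_le he1'
  obtain ⟨P2, u2, u2'⟩ := P1.addName hk1 he1' (hg.l1 _ he1) (u := s.k + 3) (by omega)
  have ek2 : (addName s1 (s.k + 3)).k = s.k + 2 := by rw [addName_eq, ek1]
  have el2 : (addName s1 (s.k + 3)).lev = s.lev := by rw [addName_eq, el1]
  set s2 := Search.addName s1 (s.k + 3) with hs2
  set nm2 := extendName nm1 s1.k (M.U e) with hnm2
  have he2' : ∀ a, IsName s2.k a → nm2 a ≠ M.U (M.U e) := by
    rw [ek2, hnm2, ek1]
    exact extendName_ne (extendName_ne he2 n1.symm) n2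
  have hk2 := P2.k_le he2'
  obtain ⟨P3, u3, u3'⟩ := P2.addName hk2 he2' (hg.l1 _ he2) (u := s.k + 1) (by omega)
  have ek3 : (addName s2 (s.k + 1)).k = s.k + 3 := by rw [addName_eq, ek2]
  have el3 : (addName s2 (s.k + 1)).lev = s.lev := by rw [addName_eq, el2]
  have e3 : addName s2 (s.k + 1) = Search.addTriple s := rfl
  rw [e3] at P3 u3 u3' ek3 el3
  set nm3 := extendName nm2 s2.k (M.U (M.U e)) with hnm3
  have v3 : nm3 (s.k + 3) = M.U (M.U e) := by rw [hnm3, ek2]; exact extendName_self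
  have v2 : nm3 (s.k + 2) = M.U e := by
    rw [hnm3, ek2, extendName_of_le (by omega), hnm2, ek1]; exact extendName_self
  have v1 : nm3 (s.k + 1) = e := by
    rw [hnm3, ek2, extendName_of_le (by omega), hnm2, ek1, extendName_of_le (by omega)]
    exact extendName_self
  have v0 : ∀ a, IsName s.k a → nm3 a = nm a := by
    intro a ha
    have := ha.2
    rw [hnm3, ek2, extendName_of_le (by omega), hnm2, ek1, extendName_of_le (by omega), hnm1,
      extendName_of_le (by omega)]
  refine ⟨by omega, nm3, P3.good ?_ ?_ ?_ ?_, v1, v0⟩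
  · rw [ek3]
    rw [ek1] at u2 u2'
    rw [ek2] at u3 u3'
    intro a ha
    by_cases h3 : a = s.k + 3
    · subst h3
      rw [u3, v3, v1]
      exact ⟨⟨by omega, by omega⟩, cube⟩
    by_cases h2 : a = s.k + 2
    · subst h2
      rw [u3' _ ⟨by omega, by omega⟩, u2, v2, v3]
      exact ⟨⟨by omega, by omega⟩, rfl⟩
    by_cases h1 : a = s.k + 1
    · subst h1
      rw [u3' _ ⟨by omega, by omega⟩, u2' _ ⟨by omega, by omega⟩, u1, v1, v2]
      exact ⟨⟨by omega, by omega⟩, rfl⟩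
    · have hb := ha.2
      have han : IsName s.k a := ⟨ha.1, by omega⟩
      rw [u3' _ ⟨ha.1, by omega⟩, u2' _ ⟨ha.1, by omega⟩, u1' a han, v0 a han]
      obtain ⟨w1, w2⟩ := hg.u a han
      rw [v0 _ w1]
      exact ⟨⟨w1.1, by have := w1.2; omega⟩, w2⟩
  · rw [ek3]
    intro e' he'
    exact hg.l1 e' fun a ha h => he' a ⟨ha.1, by have := ha.2; omega⟩ (by rw [v0 a ha, h])
  · rw [el3]; intro hl; omega
  · rw [el3]; intro hl; omega

theorem branchLoop_sub {a b : ℕ} (n : ℕ) : rest ⊆ branchLoop q s a b rest n := by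
  induction n with
  | zero => exact List.Subset.refl _
  | succ n ih =>
    have e : branchLoop q s a b rest (n + 1) = force (Nat.sub s.k n) fun v =>
      force (get s.I v b) fun h => cond (or (Nat.beq h 0) (Nat.beq h a))
        (push s (recordAll q s a b v) (branchLoop q s a b rest n)) (branchLoop q s a b rest n) := rfl
    rw [e]
    simp only [force_eq, cond_eq_ite]
    split_ifs
    · exact List.Subset.trans ih (subset_push _)
    · exact ih

theorem branchLoop_covers (hg : Good M nm s) {a b v : ℕ} (ha : IsName s.k a) (hb : IsName s.k b)
    (h : M.op (nm a) (nm b) = nm v) (n : ℕ) (hn : n ≤ s.k) (hv : s.k < v + n) (hvk : IsName s.k v) :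
    Covers M tgt (branchLoop q s a b rest n) := by
  induction n with
  | zero => have := hvk.2; omega
  | succ n ih =>
    have e : branchLoop q s a b rest (n + 1) = force (Nat.sub s.k n) fun v =>
      force (get s.I v b) fun h => cond (or (Nat.beq h 0) (Nat.beq h a))
        (push s (recordAll q s a b v) (branchLoop q s a b rest n)) (branchLoop q s a b rest n) := rfl
    rw [e]
    have e2 : Nat.sub s.k n = s.k - n := rfl
    simp only [force_eq, cond_eq_ite, e2, beq_eq_decide, Bool.or_eq_true, decide_eq_true_iff]
    by_cases hvn : v = s.k - n
    · rw [← hvn]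
      rw [if_pos]
      · exact hg.push_recordAll ha hb hvk h
      · by_contra hcon
        push Not at hcon
        obtain ⟨-, -, h2, h3⟩ := hg.i v b (hvk.lt hg.k15) (hb.lt hg.k15) hcon.1
        exact hcon.2 (hg.inj _ _ h2 ha (M.inj _ _ (nm b) (h3.trans h.symm)))
    · have := ih (by omega) (by omega)
      split_ifs
      · rcases this with ⟨s', hs', h'⟩ | h'
        · exact Or.inl ⟨s', subset_push _ hs', h'⟩
        · exact Or.inr h'
      · exact this

theorem Covers.mono {l l' : List St} (h : Covers M tgt l) (hl : l ⊆ l') : Covers M tgt l' := by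
  rcases h with ⟨s', hs', h'⟩ | h'
  · exact Or.inl ⟨s', hl hs', h'⟩
  · exact Or.inr h'

theorem stepBranch_sound {a b : ℕ} : Sound M tgt s rest (stepBranch q s a b rest) := by
  simp only [stepBranch, ble_eq_decide, cond_eq_ite, Bool.and_eq_true,
    decide_eq_true_iff]
  have pn : ∀ v s' rest, pushNamed q a b v s' rest = push s' (recordAll q s' a b v) rest := by
    intro v s' rest; cases s'; rfl
  simp only [pn]
  split_ifs with h1 h2 h3
  · refine ⟨List.Subset.trans (List.Subset.trans (subset_push _) (subset_push _))
      (branchLoop_sub _), fun nm hg => ?_⟩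
    have ha : IsName s.k a := ⟨h1.1, h1.2.1⟩
    have hb : IsName s.k b := ⟨h1.2.2.1, h1.2.2.2⟩
    by_cases hv : ∃ v, IsName s.k v ∧ nm v = M.op (nm a) (nm b)
    · obtain ⟨v, hv, e⟩ := hv
      exact branchLoop_covers hg ha hb e.symm _ le_rfl (by have := hv.1; omega) hv
    · push Not at hv
      refine Covers.mono ?_ (branchLoop_sub _)
      by_cases hU : M.U (M.op (nm a) (nm b)) = M.op (nm a) (nm b)
      · obtain ⟨-, hg'⟩ := hg.addFixed h2.1 hv hU
        have ek1 : (addName s (s.k + 1)).k = s.k + 1 := by rw [addName_eq]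
        refine hg'.push_recordAll ?_ ?_ ?_ ?_
        · rw [ek1]; exact ⟨ha.1, by have := ha.2; omega⟩
        · rw [ek1]; exact ⟨hb.1, by have := hb.2; omega⟩
        · rw [ek1]; exact ⟨by simp, le_rfl⟩
        · rw [extendName_of_le ha.2, extendName_of_le hb.2]; exact extendName_self.symm
      · refine Covers.mono ?_ (subset_push _)
        obtain ⟨-, nm', hg', e1, e2⟩ := hg.addTriple h3.1 hv hU
        have ek1 : (addTriple s).k = s.k + 3 := by simp only [addTriple, addName_eq]
        refine hg'.push_recordAll ?_ ?_ ?_ ?_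
        · rw [ek1]; exact ⟨ha.1, by have := ha.2; omega⟩
        · rw [ek1]; exact ⟨hb.1, by have := hb.2; omega⟩
        · rw [ek1]; exact ⟨by simp, by simp⟩
        · rw [e2 a ha, e2 b hb]; exact e1.symm
  · refine ⟨List.Subset.trans (subset_push _) (branchLoop_sub _), fun nm hg => ?_⟩
    have ha : IsName s.k a := ⟨h1.1, h1.2.1⟩
    have hb : IsName s.k b := ⟨h1.2.2.1, h1.2.2.2⟩
    by_cases hv : ∃ v, IsName s.k v ∧ nm v = M.op (nm a) (nm b)
    · obtain ⟨v, hv, e⟩ := hv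
      exact branchLoop_covers hg ha hb e.symm _ le_rfl (by have := hv.1; omega) hv
    · push Not at hv
      refine Covers.mono ?_ (branchLoop_sub _)
      by_cases hU : M.U (M.op (nm a) (nm b)) = M.op (nm a) (nm b)
      · obtain ⟨-, hg'⟩ := hg.addFixed h2.1 hv hU
        have ek1 : (addName s (s.k + 1)).k = s.k + 1 := by rw [addName_eq]
        refine hg'.push_recordAll ?_ ?_ ?_ ?_
        · rw [ek1]; exact ⟨ha.1, by have := ha.2; omega⟩
        · rw [ek1]; exact ⟨hb.1, by have := hb.2; omega⟩
        · rw [ek1]; exact ⟨by simp, le_rfl⟩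
        · rw [extendName_of_le ha.2, extendName_of_le hb.2]; exact extendName_self.symm
      · exfalso
        by_cases hl : s.lev ≤ 1
        · obtain ⟨hk, -⟩ := hg.addTriple hl hv hU
          exact h3 ⟨hl, hk⟩
        · exact hU (hg.l2 (by omega) _ hv)
  · refine ⟨branchLoop_sub _, fun nm hg => ?_⟩
    have ha : IsName s.k a := ⟨h1.1, h1.2.1⟩
    have hb : IsName s.k b := ⟨h1.2.2.1, h1.2.2.2⟩
    by_cases hv : ∃ v, IsName s.k v ∧ nm v = M.op (nm a) (nm b)
    · obtain ⟨v, hv, e⟩ := hv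
      exact branchLoop_covers hg ha hb e.symm _ le_rfl (by have := hv.1; omega) hv
    · exfalso
      push Not at hv
      by_cases hl : s.lev ≤ 2
      · exact h2 ⟨hl, hg.toPartial.k_le hv⟩
      · obtain ⟨v, hv1, hv2⟩ := hg.l3 (by omega) (M.op (nm a) (nm b))
        exact hv v hv1 hv2
  · exact Sound.keep

theorem stepSupport_sound : Sound M tgt s rest (stepSupport s rest) := by
  simp only [stepSupport, ble_eq_decide, cond_eq_ite, decide_eq_true_iff]
  refine ⟨?_, fun nm hg => ?_⟩
  · split_ifs
    · exact List.Subset.trans (List.subset_cons_self _ _) (List.subset_cons_self _ _)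
    · exact List.subset_cons_self _ _
  · by_cases h : ∃ e, (∀ a, IsName s.k a → nm a ≠ e) ∧ M.U e ≠ e
    · obtain ⟨e, he, hU⟩ := h
      by_cases hl : s.lev ≤ 1
      · obtain ⟨hk, nm', hg', -⟩ := hg.addTriple hl he hU
        rw [if_pos hk]
        exact Or.inl ⟨_, List.mem_cons_of_mem _ List.mem_cons_self, nm', hg'⟩
      · exact absurd (hg.l2 (by omega) e he) hU
    · push Not at h
      exact Or.inl ⟨_, List.mem_cons_self, nm, hg.toFacts, hg.k1, hg.k15, hg.inj, hg.one, hg.u,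
        hg.u0, hg.col, hg.l1, fun _ => h, fun h3 => absurd h3 (by norm_num)⟩

theorem stepClosed_sound : Sound M tgt s rest (stepClosed s rest) := by
  simp only [stepClosed, cond_eq_ite, allUpTo_iff, beq_eq_decide, Bool.not_eq_true',
    decide_eq_false_iff_not]
  split_ifs with h
  · refine ⟨List.subset_cons_self _ _, fun nm hg => Or.inl ⟨_, List.mem_cons_self, nm, ?_⟩⟩
    have l3 : ∀ e, ∃ a, IsName s.k a ∧ nm a = e := by
      refine M.gen {e | ∃ a, IsName s.k a ∧ nm a = e} ⟨1, ⟨le_rfl, hg.k1⟩, hg.one⟩ ?_ ?_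
      · intro z hz
        by_contra hcon
        exact hz (hg.l1 z fun a ha e => hcon ⟨a, ha, e⟩)
      · rintro _ ⟨a, ha, rfl⟩ _ ⟨b, hb, rfl⟩
        obtain ⟨-, -, h2, h3⟩ := hg.t a b (ha.lt hg.k15) (hb.lt hg.k15) (h a ha.1 ha.2 b hb.1 hb.2)
        exact ⟨_, h2, h3.symm⟩
    refine ⟨hg.toFacts, hg.k1, hg.k15, hg.inj, hg.one, hg.u, hg.u0, hg.col, hg.l1, fun _ e he => ?_,
      fun _ => l3⟩
    obtain ⟨a, ha, h'⟩ := l3 e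
    exact absurd h' (he a ha)
  · exact Sound.keep

theorem stepTarget_sound {i : ℕ} : Sound M tgt s rest (stepTarget tgt s i rest) := by
  simp only [stepTarget, cond_eq_ite, beq_eq_decide, ble_eq_decide, Bool.and_eq_true,
    decide_eq_true_iff]
  split_ifs with h
  · refine ⟨List.Subset.refl _, fun nm hg => Or.inr ⟨s.T, ?_, nm, s.k, hg.k1, hg.k15, hg.col,
      hg.inj, hg.l3 h.1, hg.t⟩⟩
    rw [← h.2, List.getD_eq_getElem?_getD]
    by_cases hi : i < tgt.length
    · rw [List.getElem?_eq_getElem hi]; exact List.getElem_mem hi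
    · exfalso
      have h2 := h.2
      rw [List.getD_eq_getElem?_getD, List.getElem?_eq_none (by omega)] at h2
      refine hg.col 1 ⟨le_rfl, hg.k1⟩ ?_
      rw [← h2]
      decide
  · exact Sound.keep

theorem stepOrbit_sound {y : ℕ} : Sound M tgt s rest (stepOrbit s y rest) := by
  simp only [stepOrbit, force_eq]
  generalize orbitLoop _ _ _ _ _ = S
  rw [cond_eq_ite]
  split_ifs with h
  swap
  · exact Sound.keep
  refine ⟨List.Subset.refl _, fun nm hg => ?_⟩
  exfalso
  simp only [Bool.and_eq_true, ble_eq_decide, decide_eq_true_iff] at h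
  obtain ⟨hlev, hy1, hyk, hp, hcl, hn⟩ := h
  have hl := hg.l3 hlev
  have closed : ∀ a c b, IsName s.k a → IsName s.k c → IsName s.k b → hasPair S a c = true →
      get s.T a b ≠ 0 ∧ get s.T c b ≠ 0 ∧ hasPair S (get s.T a b) (get s.T c b) = true := by
    intro a c b ha hc hb hac
    rw [orbitClosed, allUpTo_iff] at hcl
    have := hcl a ha.1 ha.2
    rw [allUpTo_iff] at this
    have := this c hc.1 hc.2
    rw [hac, cond_true, allUpTo_iff] at this
    have := this b hb.1 hb.2
    simp only [force_eq, Bool.and_eq_true, ble_eq_decide, decide_eq_true_iff] at this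
    exact ⟨by omega, by omega, this.2.2⟩
  let ρ : X → X → Prop := fun e f => ∃ a c, IsName s.k a ∧ IsName s.k c ∧ nm a = e ∧ nm c = f ∧
    hasPair S a c = true
  have hρ : ∀ e f g, ρ e f → ρ (M.op e g) (M.op f g) := by
    rintro _ _ g ⟨a, c, ha, hc, rfl, rfl, hac⟩
    obtain ⟨b, hb, rfl⟩ := hl g
    obtain ⟨h1, h2, h3⟩ := closed a c b ha hc hb hac
    obtain ⟨-, -, n1, e1⟩ := hg.t a b (ha.lt hg.k15) (hb.lt hg.k15) h1
    obtain ⟨-, -, n2, e2⟩ := hg.t c b (hc.lt hg.k15) (hb.lt hg.k15) h2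
    exact ⟨_, _, n1, n2, e1.symm, e2.symm, h3⟩
  have ρ_name : ∀ a c, IsName s.k a → IsName s.k c → ρ (nm a) (nm c) → hasPair S a c = true := by
    rintro a c ha hc ⟨a', c', ha', hc', e1, e2, h⟩
    obtain rfl := hg.inj _ _ ha' ha e1
    obtain rfl := hg.inj _ _ hc' hc e2
    exact h
  have k1 : IsName s.k 1 := ⟨le_rfl, hg.k1⟩
  have h0 : ρ M.x (nm y) := ⟨1, y, k1, ⟨hy1, hyk⟩, hg.one, rfl, hp⟩
  rw [beq_eq_decide, Bool.cond_decide] at hn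
  split_ifs at hn with hy
  · subst hy
    have : allUpTo s.k (fun c => hasPair S c c) = true := by
      rw [allUpTo_iff]
      intro c h1 h2
      refine ρ_name c c ⟨h1, h2⟩ ⟨h1, h2⟩ ?_
      exact M.conn {e | ρ e e} (by rw [hg.one] at h0; exact h0) (fun a ha c => hρ a a c ha) (nm c)
    rw [this] at hn
    exact absurd hn (by decide)
  · have := M.inv ρ hρ (nm y) h0
    obtain ⟨u1, u2⟩ := hg.u y ⟨hy1, hyk⟩
    rw [u2, ← hg.one] at this
    rw [ρ_name _ _ k1 u1 this] at hn
    exact absurd hn (by decide)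

theorem step_sound (hq : 2 ≤ q) {tok : ℕ} (ht : tok < 4096) :
    Sound M tgt s rest (step q tgt tok s rest) := by
  have h1 : Nat.shiftRight tok 8 < 16 := by
    change tok >>> 8 < 16
    rw [Nat.shiftRight_eq_div_pow]; omega
  have h2 : ∀ n, Nat.land n 15 < 16 := by
    intro n
    change n &&& (2 ^ 4 - 1) < 16
    rw [Nat.and_two_pow_sub_one_eq_mod]; omega
  have h3 := h2 (Nat.shiftRight tok 4)
  have h4 := h2 tok
  simp only [step, force_eq, beq_eq_decide, Bool.cond_decide]
  generalize Nat.shiftRight tok 8 = a at *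
  generalize Nat.land (Nat.shiftRight tok 4) 15 = b at *
  generalize Nat.land tok 15 = c at *
  split_ifs with e1 e2 e3 e4 e5 e6 e7
  · exact stepSupport_sound
  · exact stepClosed_sound
  · exact stepTarget_sound
  · exact stepOrbit_sound
  · exact stepPower_sound hq (by omega) (by omega)
  · exact stepFaith_sound (by omega) (by omega)
  · exact stepBranch_sound
  · exact stepDistrib_sound (by omega) (by omega) (by omega)

theorem runChunk_covers (hq : 2 ≤ q) (n : ℕ) :
    ∀ N l, Covers M tgt l → Covers M tgt (runChunk q tgt n N l) := by
  induction n with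
  | zero => exact fun _ _ h => h
  | succ n ih =>
    rintro N (_ | ⟨⟨k, T, I, U, lev⟩, rest⟩) h
    · exact h
    · have e : runChunk q tgt (n + 1) N (⟨k, T, I, U, lev⟩ :: rest) =
          force (Nat.shiftRight N 12) fun N' => force (Nat.land N 4095) fun tok =>
            runChunk q tgt n N' (cond (Nat.beq tok 0) (⟨k, T, I, U, lev⟩ :: rest)
              (step q tgt tok ⟨k, T, I, U, lev⟩ rest)) := rfl
      rw [e]
      simp only [force_eq, cond_eq_ite]
      apply ih
      split_ifs
      · exact h
      · refine (step_sound hq ?_).covers h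
        change N &&& (2 ^ 12 - 1) < 4096
        rw [Nat.and_two_pow_sub_one_eq_mod]; omega

theorem run_covers (hq : 2 ≤ q) (cert : List ℕ) :
    ∀ l, Covers M tgt l → Covers M tgt (run q tgt cert l) := by
  induction cert with
  | nil => exact fun _ h => h
  | cons N cert ih =>
    rintro (_ | ⟨s, rest⟩) h
    · exact h
    · exact ih _ (runChunk_covers hq 30 N _ h)

/-- If the search ends with no state left, the model has one of the expected tables. -/
theorem exists_realizes (hq : 2 ≤ q) {cert : List ℕ} (hrun : (run q tgt cert l).isEmpty = true)
    (h : ∃ s ∈ l, ∃ nm, Good M nm s) : ∃ T ∈ tgt, Realizes M T := by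
  have := run_covers hq cert l (Or.inl h : Covers M tgt l)
  rw [List.isEmpty_iff.1 hrun] at this
  rcases this with ⟨s, hs, -⟩ | h
  · exact absurd hs (List.not_mem_nil)
  · exact h

end RigQuandle.Search

namespace RigQuandle.Search

variable {X : Type*} {q : ℕ} {M : Model X q} {nm : ℕ → X}

/-- The configuration describes the translation by `x` and `U` on the named elements. -/
structure Config.Good (M : Model X q) (nm : ℕ → X) (c : Config) : Prop where
  len : c.u.length = c.t.length
  k1 : 1 ≤ c.t.length
  inj : ∀ a b, IsName c.t.length a → IsName c.t.length b → nm a = nm b → a = b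
  one : nm 1 = M.x
  t : ∀ a, IsName c.t.length a → IsName c.t.length (c.tAt a) ∧ M.op (nm a) M.x = nm (c.tAt a)
  u : ∀ a, IsName c.t.length a → IsName c.t.length (c.uAt a) ∧ M.U (nm a) = nm (c.uAt a)

theorem card_names_le {k : ℕ} (h : ∀ a b, IsName k a → IsName k b → nm a = nm b → a = b) :
    (M : Model X q) → k ≤ 15 := by
  intro M
  by_contra hk
  refine M.card (fun i => nm (i.1 + 1)) fun i j hij => Fin.ext ?_
  have := h _ _ ⟨by omega, by omega⟩ ⟨by omega, by omega⟩ hij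
  omega

/-- There are not sixteen different elements. -/
theorem mem_names_of_fifteen (M : Model X q)
    (h : ∀ a b, IsName 15 a → IsName 15 b → nm a = nm b → a = b) (e : X) :
    ∃ a, IsName 15 a ∧ nm a = e := by
  by_contra hcon
  push Not at hcon
  have := card_names_le (nm := extendName nm 15 e) (k := 16) (fun a b ha hb hab => ?_) M
  · omega
  · have h1 := ha.2
    have h2 := hb.2
    by_cases ha' : a = 15 + 1 <;> by_cases hb' : b = 15 + 1
    · omega
    · rw [ha', extendName_self, extendName_of_le (by omega)] at hab
      exact absurd hab.symm (hcon b ⟨hb.1, by omega⟩)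
    · rw [hb', extendName_self, extendName_of_le (by omega)] at hab
      exact absurd hab (hcon a ⟨ha.1, by omega⟩)
    · rw [extendName_of_le (by omega), extendName_of_le (by omega)] at hab
      exact h a b ⟨ha.1, by omega⟩ ⟨hb.1, by omega⟩ hab

theorem get_zero (a b : ℕ) : get 0 a b = 0 := by
  change (0 >>> pos a b) &&& 15 = 0
  simp

namespace Config.Good
variable {c : Config}

theorem k15 (h : c.Good M nm) : c.t.length ≤ 15 := card_names_le h.inj M

theorem fillT_spec (h : c.Good M nm) (n : ℕ) (hn : n ≤ c.t.length) :
    Facts M nm c.t.length (c.fillT n) 0 ∧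
    (∀ a b, a < 16 → b < 16 → get (c.fillT n) a b ≠ 0 → a ≤ n ∧ b ≤ n) ∧
    ∀ a, IsName n a → get (c.fillT n) a 1 ≠ 0 := by
  have hk := h.k15
  induction n with
  | zero =>
    have e : c.fillT 0 = 0 := rfl
    rw [e]
    refine ⟨⟨fun a b _ _ hab => absurd (get_zero a b) hab,
      fun a b _ _ hab => absurd (get_zero a b) hab⟩, fun a b _ _ hab => absurd (get_zero a b) hab,
      fun a ha => ?_⟩
    have := ha.1; have := ha.2; omega
  | succ m ih =>
    obtain ⟨F, B, Cn⟩ := ih (by omega)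
    have e : c.fillT (m + 1) = cond (Nat.beq m 0) (put (c.fillT m) 1 1 1)
      (force (c.tAt (m + 1)) fun v =>
        force (put (put (c.fillT m) (m + 1) (m + 1) (m + 1)) (m + 1) 1 v) fun T =>
          cond (Nat.beq v (m + 1)) (put T 1 (m + 1) 1) T) := rfl
    rw [e]
    generalize c.fillT m = T at *
    simp only [force_eq, beq_eq_decide, Bool.cond_decide]
    have z : ∀ a b, a < 16 → b < 16 → m < a ∨ m < b → get T a b = 0 := by
      intro a b ha hb hab
      by_contra h0
      have := B a b ha hb h0
      omega
    have k1 : IsName c.t.length 1 := ⟨le_rfl, h.k1⟩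
    by_cases hm : m = 0
    · subst hm
      rw [if_pos rfl]
      have z1 := z 1 1 (by omega) (by omega) (by omega)
      refine ⟨F.putT hk k1 k1 k1 (M.idem _) z1, fun a b ha hb hab => ?_, fun a ha => ?_⟩
      · by_cases h1 : 1 = a ∧ 1 = b
        · omega
        · rw [get_put_of_ne (by omega) (by omega) ha hb h1] at hab
          have := B a b ha hb hab
          omega
      · obtain rfl : a = 1 := by have := ha.1; have := ha.2; omega
        rw [get_put_self (by omega) (by omega) (by omega) z1]
        omega
    · rw [if_neg hm]
      have km : IsName c.t.length (m + 1) := ⟨by omega, hn⟩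
      obtain ⟨kv, ev⟩ := h.t (m + 1) km
      generalize c.tAt (m + 1) = v at *
      have v16 := kv.lt hk
      have b1 : m + 1 < 16 := by omega
      have z1 := z (m + 1) (m + 1) b1 b1 (by omega)
      have z2 : get (put T (m + 1) (m + 1) (m + 1)) (m + 1) 1 = 0 := by
        rw [get_put_of_ne b1 b1 b1 (by omega) (by omega)]
        exact z _ _ b1 (by omega) (by omega)
      have F2 := (F.putT hk km km km (M.idem _) z1).putT hk km k1 kv (by rw [h.one, ev]) z2
      set T2 := put (put T (m + 1) (m + 1) (m + 1)) (m + 1) 1 v with hT2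
      have B2 : ∀ a b, a < 16 → b < 16 → get T2 a b ≠ 0 → a ≤ m + 1 ∧ b ≤ m + 1 := by
        intro a b ha hb hab
        by_cases h1 : m + 1 = a ∧ 1 = b
        · omega
        rw [hT2, get_put_of_ne (by omega) v16 ha hb h1] at hab
        by_cases h1 : m + 1 = a ∧ m + 1 = b
        · omega
        rw [get_put_of_ne b1 b1 ha hb h1] at hab
        have := B a b ha hb hab
        omega
      have C2 : ∀ a, IsName (m + 1) a → get T2 a 1 ≠ 0 := by
        intro a ha
        by_cases ham : a = m + 1
        · subst ham
          rw [hT2, get_put_self b1 (by omega) v16 z2]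
          have := kv.1; omega
        · have h2 := ha.2
          exact grows_put (by omega) v16 z2 a 1 (by omega) (by omega)
            (grows_put b1 b1 z1 a 1 (by omega) (by omega) (Cn a ⟨ha.1, by omega⟩))
      have z3 : get T2 1 (m + 1) = 0 := by
        rw [hT2, get_put_of_ne (by omega) v16 (by omega) b1 (by omega),
          get_put_of_ne b1 b1 (by omega) b1 (by omega)]
        exact z _ _ (by omega) b1 (by omega)
      split_ifs with hv
      · subst hv
        refine ⟨F2.putT hk k1 km k1 ?_ z3, fun a b ha hb hab => ?_, fun a ha => ?_⟩
        · rw [h.one]; exact M.comm _ _ ev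
        · by_cases h1 : 1 = a ∧ m + 1 = b
          · omega
          · rw [get_put_of_ne b1 (by omega) ha hb h1] at hab
            exact B2 a b ha hb hab
        · have h2 := ha.2
          exact grows_put b1 (by omega) z3 a 1 (by omega) (by omega) (C2 a ha)
      · exact ⟨F2, B2, C2⟩

theorem fillI_spec (h : c.Good M nm) (n : ℕ) (hn : n ≤ c.t.length) :
    Facts M nm c.t.length 0 (c.fillI n) ∧
    (∀ a b, a < 16 → b < 16 → get (c.fillI n) a b ≠ 0 → get (c.fillI n) a b ≤ n ∧ b ≤ n) := by
  have hk := h.k15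
  induction n with
  | zero =>
    have e : c.fillI 0 = 0 := rfl
    rw [e]
    exact ⟨⟨fun a b _ _ hab => absurd (get_zero a b) hab,
      fun a b _ _ hab => absurd (get_zero a b) hab⟩, fun a b _ _ hab => absurd (get_zero a b) hab⟩
  | succ m ih =>
    obtain ⟨F, B⟩ := ih (by omega)
    have e : c.fillI (m + 1) = cond (Nat.beq m 0) (put (c.fillI m) 1 1 1)
      (force (c.tAt (m + 1)) fun v =>
        force (put (put (c.fillI m) (m + 1) (m + 1) (m + 1)) v 1 (m + 1)) fun T =>
          cond (Nat.beq v (m + 1)) (put T 1 (m + 1) 1) T) := rfl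
    rw [e]
    generalize c.fillI m = I at *
    simp only [force_eq, beq_eq_decide, Bool.cond_decide]
    have k1 : IsName c.t.length 1 := ⟨le_rfl, h.k1⟩
    by_cases hm : m = 0
    · subst hm
      rw [if_pos rfl]
      have z1 : get I 1 1 = 0 := by
        by_contra h0
        have := B 1 1 (by omega) (by omega) h0
        omega
      refine ⟨F.putI hk k1 k1 k1 (M.idem _) z1, fun a b ha hb hab => ?_⟩
      by_cases h1 : 1 = a ∧ 1 = b
      · obtain ⟨rfl, rfl⟩ := h1
        rw [get_put_self (by omega) (by omega) (by omega) z1]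
        omega
      · rw [get_put_of_ne (by omega) (by omega) ha hb h1] at hab ⊢
        have := B a b ha hb hab
        omega
    · rw [if_neg hm]
      have km : IsName c.t.length (m + 1) := ⟨by omega, hn⟩
      obtain ⟨kv, ev⟩ := h.t (m + 1) km
      generalize c.tAt (m + 1) = v at *
      have v16 := kv.lt hk
      have b1 : m + 1 < 16 := by omega
      have z1 : get I (m + 1) (m + 1) = 0 := by
        by_contra h0
        have := B _ _ b1 b1 h0
        omega
      have z2 : get (put I (m + 1) (m + 1) (m + 1)) v 1 = 0 := by
        rw [get_put_of_ne b1 b1 v16 (by omega) (by omega)]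
        by_contra h0
        have h1 := B _ _ v16 (by omega) h0
        obtain ⟨-, -, h2, h3⟩ := F.i v 1 v16 (by omega) h0
        rw [h.one, ← ev] at h3
        have := h.inj _ _ h2 km (M.inj _ _ _ h3)
        omega
      have F2 := (F.putI hk km km km (M.idem _) z1).putI hk km k1 kv (by rw [h.one, ev]) z2
      have B2 : ∀ a b, a < 16 → b < 16 → get (put (put I (m + 1) (m + 1) (m + 1)) v 1 (m + 1)) a b ≠ 0 →
          get (put (put I (m + 1) (m + 1) (m + 1)) v 1 (m + 1)) a b ≤ m + 1 ∧ b ≤ m + 1 := by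
        intro a b ha hb hab
        by_cases h1 : v = a ∧ 1 = b
        · obtain ⟨rfl, rfl⟩ := h1
          rw [get_put_self v16 (by omega) b1 z2]; omega
        rw [get_put_of_ne (by omega) b1 ha hb h1] at hab ⊢
        by_cases h1 : m + 1 = a ∧ m + 1 = b
        · obtain ⟨rfl, rfl⟩ := h1
          rw [get_put_self b1 b1 b1 z1]; omega
        rw [get_put_of_ne b1 b1 ha hb h1] at hab ⊢
        have := B a b ha hb hab
        omega
      have z3 : get (put (put I (m + 1) (m + 1) (m + 1)) v 1 (m + 1)) 1 (m + 1) = 0 := by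
        rw [get_put_of_ne (by omega) b1 (by omega) b1 (by omega),
          get_put_of_ne b1 b1 (by omega) b1 (by omega)]
        by_contra h0
        have := B _ _ (by omega) b1 h0
        omega
      generalize put (put I (m + 1) (m + 1) (m + 1)) v 1 (m + 1) = I2 at *
      split_ifs with hv
      · subst hv
        refine ⟨F2.putI hk k1 km k1 ?_ z3, fun a b ha hb hab => ?_⟩
        · rw [h.one]; exact M.comm _ _ ev
        · by_cases h1 : 1 = a ∧ m + 1 = b
          · obtain ⟨rfl, rfl⟩ := h1
            rw [get_put_self (by omega) b1 (by omega) z3]; omega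
          · rw [get_put_of_ne b1 (by omega) ha hb h1] at hab ⊢
            exact B2 a b ha hb hab
      · exact ⟨F2, B2⟩

theorem fillU_spec (h : c.Good M nm) (n : ℕ) (hn : n ≤ c.t.length) :
    (∀ a, IsName n a → get (c.fillU n) 0 a = c.uAt a) ∧
    ∀ a, a < 16 → n < a → get (c.fillU n) 0 a = 0 := by
  have hk := h.k15
  induction n with
  | zero =>
    refine ⟨fun a ha => ?_, fun a _ _ => get_zero _ _⟩
    have := ha.1; have := ha.2; omega
  | succ m ih =>
    obtain ⟨A, B⟩ := ih (by omega)
    have e : c.fillU (m + 1) = put (c.fillU m) 0 (m + 1) (c.uAt (m + 1)) := rfl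
    rw [e]
    have v16 : c.uAt (m + 1) < 16 := (h.u (m + 1) ⟨by omega, hn⟩).1.lt hk
    refine ⟨fun a ha => ?_, fun a ha hma => ?_⟩
    · have h2 := ha.2
      by_cases ham : a = m + 1
      · subst ham
        rw [get_put_self (by omega) (by omega) v16 (B _ (by omega) (by omega))]
      · rw [get_put_of_ne (by omega) v16 (by omega) (by omega) (by omega)]
        exact A a ⟨ha.1, by omega⟩
    · rw [get_put_of_ne (by omega) v16 (by omega) (by omega) (by omega)]
      exact B a ha (by omega)

theorem toSt (h : c.Good M nm) (l1 : ∀ e, (∀ a, IsName c.t.length a → nm a ≠ e) → M.op e M.x = e) :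
    Search.Good M nm c.toSt := by
  obtain ⟨F, -, hC⟩ := h.fillT_spec _ le_rfl
  obtain ⟨F', -⟩ := h.fillI_spec _ le_rfl
  obtain ⟨hU, hU0⟩ := h.fillU_spec _ le_rfl
  simp only [Config.toSt, force_eq]
  refine ⟨⟨F.t, F'.i⟩, h.k1, h.k15, h.inj, h.one, fun a ha => ?_, hU0, hC, l1,
    fun h2 => absurd h2 (by norm_num), fun h3 => absurd h3 (by norm_num)⟩
  simp only
  rw [hU a ha]
  exact h.u a ha

/-- Add a block of new elements. -/
theorem append (h : c.Good M nm) {m : ℕ} {g : ℕ → X} {tb ub : ℕ → ℕ}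
    (hg : ∀ i < m, ∀ a, IsName c.t.length a → nm a ≠ g i)
    (ginj : ∀ i < m, ∀ j < m, g i = g j → i = j)
    (ht : ∀ i < m, tb i < m ∧ M.op (g i) M.x = g (tb i))
    (hu : ∀ i < m, ub i < m ∧ M.U (g i) = g (ub i)) :
    Config.Good M (fun a => if a ≤ c.t.length then nm a else g (a - c.t.length - 1))
      ⟨c.t ++ (List.range m).map fun i => c.t.length + 1 + tb i,
        c.u ++ (List.range m).map fun i => c.t.length + 1 + ub i⟩ := by
  set k := c.t.length with hk
  have L : (c.t ++ (List.range m).map fun i => k + 1 + tb i).length = k + m := by simp [hk]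
  have k1 := h.k1
  have split : ∀ a, IsName (k + m) a → IsName k a ∨ ∃ i < m, a = k + 1 + i := by
    rintro a ⟨h1, h2⟩
    by_cases h3 : a ≤ k
    · exact Or.inl ⟨h1, h3⟩
    · exact Or.inr ⟨a - k - 1, by omega, by omega⟩
  have get_old : ∀ (l l' : List ℕ) a, l.length = k → IsName k a →
      (l ++ l').getD (Nat.sub a 1) 0 = l.getD (Nat.sub a 1) 0 := by
    rintro l l' a hl ⟨h1, h2⟩
    exact List.getD_append _ _ _ _ (by change a - 1 < _; omega)
  have get_new : ∀ (l : List ℕ) (f : ℕ → ℕ) i, l.length = k → i < m →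
      (l ++ (List.range m).map f).getD (Nat.sub (k + 1 + i) 1) 0 = f i := by
    intro l f i hl hi
    rw [List.getD_append_right _ _ _ _ (by change _ ≤ k + 1 + i - 1; omega)]
    have : Nat.sub (k + 1 + i) 1 - l.length = i := by change k + 1 + i - 1 - _ = i; omega
    rw [this, List.getD_eq_getElem _ _ (by simpa using hi)]
    simp
  suffices H : ∀ nm' : ℕ → X, (∀ a, IsName k a → nm' a = nm a) → (∀ i, nm' (k + 1 + i) = g i) →
      Config.Good M nm' ⟨c.t ++ (List.range m).map fun i => k + 1 + tb i,
        c.u ++ (List.range m).map fun i => k + 1 + ub i⟩ by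
    refine H _ (fun a ha => if_pos ha.2) fun i => ?_
    rw [if_neg (by omega)]
    congr 1
    omega
  intro nm' old new
  refine ⟨?_, ?_, ?_, ?_, ?_, ?_⟩
  · simp [h.len]
  · simp only [L]; omega
  · simp only [L]
    intro a b ha hb hab
    rcases split a ha with ha | ⟨i, hi, rfl⟩ <;> rcases split b hb with hb | ⟨j, hj, rfl⟩
    · rw [old a ha, old b hb] at hab
      exact h.inj a b ha hb hab
    · rw [old a ha, new] at hab
      exact absurd hab (hg j hj a ha)
    · rw [old b hb, new] at hab
      exact absurd hab.symm (hg i hi b hb)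
    · rw [new, new] at hab
      rw [ginj i hi j hj hab]
  · rw [old 1 ⟨le_rfl, h.k1⟩, h.one]
  · simp only [L, Config.tAt]
    intro a ha
    rcases split a ha with ha | ⟨i, hi, rfl⟩
    · obtain ⟨h1, h2⟩ := h.t a ha
      rw [get_old _ _ a hk.symm ha, old a ha]
      refine ⟨⟨h1.1, h1.2.trans (by omega)⟩, h2.trans (old _ h1).symm⟩
    · obtain ⟨h1, h2⟩ := ht i hi
      rw [get_new _ _ i hk.symm hi, new, new]
      exact ⟨⟨by omega, by omega⟩, h2⟩
  · simp only [L, Config.uAt]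
    intro a ha
    rcases split a ha with ha | ⟨i, hi, rfl⟩
    · obtain ⟨h1, h2⟩ := h.u a ha
      rw [get_old _ _ a h.len ha, old a ha]
      exact ⟨⟨h1.1, h1.2.trans (by omega)⟩, h2.trans (old _ h1).symm⟩
    · obtain ⟨h1, h2⟩ := hu i hi
      rw [get_new _ _ i h.len hi, new, new]
      exact ⟨⟨by omega, by omega⟩, h2⟩

theorem base (M : Model X q) : Config.Good M (fun _ => M.x) Config.base where
  len := rfl
  k1 := le_rfl
  inj a b ha hb _ := by
    have h1 := ha.1; have h2 := ha.2; have h3 := hb.1; have h4 := hb.2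
    simp only [Config.base, List.length_singleton] at h2 h4
    omega
  one := rfl
  t a ha := by
    have h1 := ha.1; have h2 := ha.2
    simp only [Config.base, List.length_singleton] at h2
    obtain rfl : a = 1 := by omega
    exact ⟨⟨le_rfl, le_rfl⟩, M.idem _⟩
  u a ha := by
    have h1 := ha.1; have h2 := ha.2
    simp only [Config.base, List.length_singleton] at h2
    obtain rfl : a = 1 := by omega
    exact ⟨⟨le_rfl, le_rfl⟩, M.U_x⟩

end Config.Good

/-- An injective map preserving the set of named elements preserves its complement. -/
theorem unnamed_of_injective {k : ℕ} {f : X → X} (hf : Function.Injective f)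
    (hinj : ∀ a b, IsName k a → IsName k b → nm a = nm b → a = b)
    (h : ∀ a, IsName k a → ∃ b, IsName k b ∧ f (nm a) = nm b) {e : X}
    (he : ∀ a, IsName k a → nm a ≠ e) : ∀ a, IsName k a → nm a ≠ f e := by
  intro a ha hae
  have hmaps : ∀ b : Fin k, ∃ c : Fin k, f (nm (b.1 + 1)) = nm (c.1 + 1) := by
    intro b
    obtain ⟨c, hc, e⟩ := h (b.1 + 1) ⟨by omega, by omega⟩
    have := hc.1
    have := hc.2
    exact ⟨⟨c - 1, by omega⟩, by rw [e]; congr 1; simp only; omega⟩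
  choose g hg using hmaps
  have ginj : Function.Injective g := by
    intro b c hbc
    have hb := hg b
    rw [hbc, ← hg c] at hb
    have := hinj _ _ ⟨by omega, by omega⟩ ⟨by omega, by omega⟩ (hf hb)
    exact Fin.ext (by omega)
  obtain ⟨b, hb⟩ := (Finite.injective_iff_surjective.1 ginj)
    ⟨a - 1, by have := ha.1; have := ha.2; omega⟩
  have hb' := hg b
  rw [hb] at hb'
  simp only [Nat.sub_add_cancel ha.1] at hb'
  rw [hae] at hb'
  exact he _ ⟨by omega, by omega⟩ (hf hb')

namespace Model

/-- The translation by `x`. -/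
def tr (M : Model X q) : X → X := fun z => M.op z M.x

theorem tr_inj (M : Model X q) : Function.Injective M.tr := fun a b h => M.inj a b M.x h

theorem tr_pow (M : Model X q) (e : X) : M.tr^[q] e = e := M.pow e M.x

theorem U_tr (M : Model X q) (e : X) : M.U (M.tr e) = M.tr (M.U e) := by
  rw [tr, tr, M.U_op, M.U_x]

theorem U_tr_iterate (M : Model X q) (n : ℕ) (e : X) : M.U (M.tr^[n] e) = M.tr^[n] (M.U e) :=
  Function.Semiconj.iterate_right (fun e => M.U_tr e) n e

theorem tr_U_iterate (M : Model X q) (m : ℕ) (e : X) : M.tr (M.U^[m] e) = M.U^[m] (M.tr e) :=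
  Function.Semiconj.iterate_right (f := M.tr) (fun e => (M.U_tr e).symm) m e

theorem tr_iterate_mod (M : Model X q) (n : ℕ) (e : X) : M.tr^[n % q] e = M.tr^[n] e :=
  Function.IsPeriodicPt.iterate_mod_apply (M.tr_pow e) n

theorem iterate_injOn_of_moved (M : Model X q) (hq : q.Prime) {e : X} (he : M.op e M.x ≠ e) :
    ∀ i < q, ∀ j < q, M.tr^[i] e = M.tr^[j] e → i = j := by
  intro i hi j hj hij
  have hp : Function.minimalPeriod M.tr e = q := by
    rcases (Nat.dvd_prime hq).1 (Function.IsPeriodicPt.minimalPeriod_dvd (M.tr_pow e)) with h | h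
    · exact absurd (Function.minimalPeriod_eq_one_iff_isFixedPt.1 h) he
    · exact h
  exact Function.iterate_injOn_Iio_minimalPeriod (by rw [hp]; exact hi) (by rw [hp]; exact hj) hij

end Model

theorem Config.Good.addCycle {c : Config} (h : c.Good M nm) {e : X}
    (he : ∀ a, IsName c.t.length a → nm a ≠ e) (hq : 0 < q)
    (hper : ∀ i < q, ∀ j < q, M.tr^[i] e = M.tr^[j] e → i = j) {r : ℕ} (hr : M.U e = M.tr^[r] e) :
    (c.addCycle q r).Good M (fun a => if a ≤ c.t.length then nm a
      else M.tr^[a - c.t.length - 1] e) := by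
  have ht : ∀ n, ∀ a, IsName c.t.length a → nm a ≠ M.tr^[n] e := by
    intro n
    induction n with
    | zero => exact he
    | succ n ih =>
      rw [Function.iterate_succ_apply']
      exact unnamed_of_injective M.tr_inj h.inj (fun a ha => ⟨_, (h.t a ha).1, (h.t a ha).2⟩) ih
  refine h.append (g := fun i => M.tr^[i] e) (fun i _ => ht i) hper (fun i _ => ?_) (fun i _ => ?_)
  · refine ⟨Nat.mod_lt _ hq, ?_⟩
    rw [M.tr_iterate_mod]
    exact (Function.iterate_succ_apply' M.tr i e).symm
  · refine ⟨Nat.mod_lt _ hq, ?_⟩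
    rw [M.tr_iterate_mod, M.U_tr_iterate, hr, Function.iterate_add_apply]

theorem Config.Good.addCycles {c : Config} (h : c.Good M nm) {e : X}
    (he : ∀ a, IsName c.t.length a → nm a ≠ e) (hq : 0 < q)
    (hper : ∀ i < q, ∀ j < q, M.tr^[i] e = M.tr^[j] e → i = j) (hu : ∀ r, M.U e ≠ M.tr^[r] e)
    (hu3 : M.U (M.U (M.U e)) = e) :
    (c.addCycles q).Good M (fun a => if a ≤ c.t.length then nm a
      else M.U^[(a - c.t.length - 1) / q] (M.tr^[(a - c.t.length - 1) % q] e)) := by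
  have ht : ∀ n, ∀ a, IsName c.t.length a → nm a ≠ M.tr^[n] e := by
    intro n
    induction n with
    | zero => exact he
    | succ n ih =>
      rw [Function.iterate_succ_apply']
      exact unnamed_of_injective M.tr_inj h.inj (fun a ha => ⟨_, (h.t a ha).1, (h.t a ha).2⟩) ih
  have htu : ∀ m n, ∀ a, IsName c.t.length a → nm a ≠ M.U^[m] (M.tr^[n] e) := by
    intro m n
    induction m with
    | zero => exact ht n
    | succ m ih =>
      rw [Function.iterate_succ_apply']
      exact unnamed_of_injective M.U_inj h.inj (fun a ha => ⟨_, (h.u a ha).1, (h.u a ha).2⟩) ih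
  have cube : ∀ n, M.U (M.U (M.U (M.tr^[n] e))) = M.tr^[n] e := by
    intro n
    rw [M.U_tr_iterate, M.U_tr_iterate, M.U_tr_iterate, hu3]
  have back : ∀ i ≤ q, ∀ f, M.tr^[q - i] (M.tr^[i] f) = f := by
    intro i hi f
    rw [← Function.iterate_add_apply, Nat.sub_add_cancel hi, M.tr_pow]
  have no1 : ∀ i ≤ q, ∀ j, M.U (M.tr^[i] e) ≠ M.tr^[j] e := by
    intro i hi j hij
    rw [M.U_tr_iterate] at hij
    apply hu (q - i + j)
    rw [Function.iterate_add_apply, ← hij, back i hi]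
  have no2 : ∀ i, ∀ j ≤ q, M.U (M.U (M.tr^[i] e)) ≠ M.tr^[j] e := by
    intro i j hj hij
    apply no1 j hj i
    rw [← hij, cube]
  refine h.append (g := fun i => M.U^[i / q] (M.tr^[i % q] e)) (fun i _ => htu _ _) ?_
    (fun i hi => ?_) (fun i hi => ?_)
  · intro i hi j hj hij
    have d : ∀ i < 3 * q, i / q = 0 ∨ i / q = 1 ∨ i / q = 2 := by
      intro i hi
      have : i / q < 3 := Nat.div_lt_of_lt_mul (by rwa [mul_comm])
      generalize i / q = d at this
      omega
    have mi := Nat.mod_lt i hq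
    have mj := Nat.mod_lt j hq
    have key : i / q = j / q ∧ i % q = j % q := by
      rcases d i hi with h1 | h1 | h1 <;> rcases d j hj with h2 | h2 | h2 <;>
        rw [h1, h2] at hij ⊢ <;>
        simp only [Function.iterate_succ, Function.iterate_zero, Function.comp, id] at hij
      · exact ⟨rfl, hper _ mi _ mj hij⟩
      · exact absurd hij.symm (no1 _ mj.le _)
      · exact absurd hij.symm (no2 _ _ mi.le)
      · exact absurd hij (no1 _ mi.le _)
      · exact ⟨rfl, hper _ mi _ mj (M.U_inj hij)⟩
      · exact absurd (M.U_inj hij).symm (no1 _ mj.le _)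
      · exact absurd hij (no2 _ _ mj.le)
      · exact absurd (M.U_inj hij) (no1 _ mi.le _)
      · exact ⟨rfl, hper _ mi _ mj (M.U_inj (M.U_inj hij))⟩
    rw [← Nat.div_add_mod i q, ← Nat.div_add_mod j q, key.1, key.2]
  · have mi := Nat.mod_lt (i % q + 1) hq
    have h3 : i / q < 3 := Nat.div_lt_of_lt_mul (by rwa [mul_comm])
    refine ⟨?_, ?_⟩
    · have : q * (i / q) ≤ q * 2 := Nat.mul_le_mul_left _ (by omega)
      omega
    · rw [Nat.mul_add_div hq, Nat.div_eq_of_lt mi, Nat.add_zero, Nat.mul_add_mod, Nat.mod_mod,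
        M.tr_iterate_mod (i % q + 1), Function.iterate_succ_apply']
      exact M.tr_U_iterate _ _
  · have mi := Nat.mod_lt i hq
    have h3 : i / q < 3 := Nat.div_lt_of_lt_mul (by rwa [mul_comm])
    refine ⟨?_, ?_⟩
    · have : q * ((i / q + 1) % 3) ≤ q * 2 := Nat.mul_le_mul_left _ (by omega)
      omega
    · rw [Nat.mul_add_div hq, Nat.div_eq_of_lt mi, Nat.add_zero, Nat.mul_add_mod, Nat.mod_mod]
      have : ∀ d, d < 3 → d = 0 ∨ d = 1 ∨ d = 2 := by intro d hd; omega
      rcases this _ h3 with h | h | h <;> rw [h]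
      · rfl
      · rfl
      · exact cube _

/-- The list of extensions of a configuration is complete. -/
theorem Config.Good.exists_extend (hq : q.Prime) (hu3 : ∀ e, M.U (M.U (M.U e)) = e) {rots : List ℕ}
    (hrots : ∀ e, M.op e M.x ≠ e → ∀ r < q, M.U e = M.tr^[r] e → r ∈ rots) (n : ℕ) :
    ∀ (c : Config) (nm : ℕ → X), c.Good M nm → 15 < c.t.length + q * (n + 1) →
      ∃ c' ∈ Config.extend q rots n c, ∃ nm', Search.Good M nm' c'.toSt := by
  have moved : ∀ (c : Config) nm, c.Good M nm → (∀ e, (∀ a, IsName c.t.length a → nm a ≠ e) →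
      M.op e M.x = e) ∨ (∃ r ∈ rots, ∃ nm', (c.addCycle q r).Good M nm') ∨
      ∃ nm', (c.addCycles q).Good M nm' := by
    intro c nm h
    by_cases hl : ∀ e, (∀ a, IsName c.t.length a → nm a ≠ e) → M.op e M.x = e
    · exact Or.inl hl
    · push Not at hl
      obtain ⟨e, he, hx⟩ := hl
      refine Or.inr ?_
      by_cases hr : ∃ r, M.U e = M.tr^[r] e
      · obtain ⟨r, hr⟩ := hr
        rw [← M.tr_iterate_mod] at hr
        exact Or.inl ⟨r % q, hrots e hx _ (Nat.mod_lt _ hq.pos) hr, _,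
          h.addCycle he hq.pos (M.iterate_injOn_of_moved hq hx) hr⟩
      · push Not at hr
        exact Or.inr ⟨_, h.addCycles he hq.pos (M.iterate_injOn_of_moved hq hx) hr (hu3 e)⟩
  have len1 : ∀ (c : Config) r, (c.addCycle q r).t.length = c.t.length + q := by
    intro c r; simp [Config.addCycle]
  have len3 : ∀ c : Config, (c.addCycles q).t.length = c.t.length + 3 * q := by
    intro c; simp [Config.addCycles]
  induction n with
  | zero =>
    intro c nm h hlen
    refine ⟨c, List.mem_singleton_self _, nm, h.toSt ?_⟩
    rcases moved c nm h with hl | ⟨r, -, nm', h'⟩ | ⟨nm', h'⟩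
    · exact hl
    · have := h'.k15
      rw [len1] at this
      omega
    · have := h'.k15
      rw [len3] at this
      omega
  | succ n ih =>
    intro c nm h hlen
    have hlen' : 15 < c.t.length + q + q * (n + 1) := by rw [mul_add] at hlen; omega
    rcases moved c nm h with hl | ⟨r, hr, nm', h'⟩ | ⟨nm', h'⟩
    · exact ⟨c, List.mem_cons_self, nm, h.toSt hl⟩
    · have hk := h'.k15
      obtain ⟨c', hc', h''⟩ := ih _ nm' h' (by rw [len1]; omega)
      rw [len1] at hk
      refine ⟨c', ?_, h''⟩
      rw [Config.extend, if_pos hk]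
      exact List.mem_cons_of_mem _ (List.mem_append_left _ (List.mem_flatMap.2 ⟨r, hr, hc'⟩))
    · have hk := h'.k15
      obtain ⟨c', hc', h''⟩ := ih _ nm' h' (by rw [len3]; omega)
      rw [len3] at hk
      refine ⟨c', ?_, h''⟩
      rw [Config.extend, if_pos hk]
      exact List.mem_cons_of_mem _ (List.mem_append_right _ hc')

end RigQuandle.Search

namespace RigQuandle.Search

/-- Search certificate for translations of order two. -/
def certTwo : List ℕ := [
  173840300221471401238556406535846046610894704181173102661259556590842665611622217587426361475348973298708511,
  1165668738100725332088812352427334902367406741177504966454556500559380686401246839571185348243345655613886721,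
  13907862028012309751116164468161114414673241265147147565245600655572907109692839303111019605121662419284737,
  1322058835963186587374913691003032059911519838294484811454392646850885471286560823358254044430018286187704735,
  1629925192467984991952259551270197042713385189020789724144231744744671797132826752496981096554829760217609075,
  734779802876533446521609963636233354133861903293162716601249095529327375468339822465309322461045921046012325,
  394198435060834470943828551506937440954869236924687510123373851767858892198002017932638308583868538991679489,
  15484511134205005371615128156425520138527825539823004295460091773179520766149015960101726509972141570627096,
  13190837461244991020860584724534619739850876700856596570510890244154000622597967877152712660277924752109592,
  459491368782669299288780360188655078007196985120736078955737255884229168005094149799450863884226367822237719,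
  147399705120425510131043831241397431089712511403846209738660540097757762732381693761378892453198563495670051,
  1045336903888237039304630305999161565652865675119129728430296122819045396411496481557418168889019349580845591,
  2220104718785988637625242013978303942832975184518052365228003413498600865771432446893214073800220086513004801,
  747289337808326481689147237612044193914528958193379310804435314571378225638539566802264358735762924409721089,
  891707755060146326954238515892662903060822587707689301880685500375933194408079612990030303212138922509414815,
  735032709788192388148353488416545147422860055941519096487879263825590854619063972689918371113918545315051283,
  147608338764692387552424618614983339538789658230549633806149526830207776864607240870468724170508390399742721,
  229959220938249446107406046550921256815484739504902104533873829823174250791193910802442961285662891435888959,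
  440969825114228882176245409412170111496225349451478050360411831855145216402481155131465879983468529392292159,
  744923869958399848016959803584469574504635846440914076482422954273083761233793218029168541182823469953257458,
  12076905937548854692717825685273595955778630424642507913045488381202774808498784110393559440204485155173633,
  150834350614015760282092863664731182986382686585435202526054735136512846387072135903155639013514794133172246,
  91702000183991354341993798568965548925268479779388871627891196330078812141905633700196225464302728962406919,
  1618673473119332348443634485531830594291569172736724908711668488290091745764461846719760079877424194216040201,
  1110015385683581638759895589926110116655030834392936127961887052902472356268549098116310148578717025988276489,
  151981108172325351257779499660316710989740319070808918933803376239422030123946474225554345781669454019032839,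
  2201254717832336503764062516438395979201168431988280671211496220884146290523605672390801448900780411489680135,
  152339467262735297398899562797958586866947688106362576768756121692461438035517376147529156444511671335649008,
  2201254693224567961341026595204020875466367887579377615682941945484942004946147876327289340796620145060507911,
  151981168583308345593797086510051586446562470919092391015032617179353951039626689585274418735491501159677680,
  1173753783490812540721586195149656399498395901773717239156819373334477319955419230523030822540212715897524487,
  1463036068598614181255163841197569737471458695586254055943759511678635248011422382861437767996432678798358512,
  147359975898260550421205971702659418955037528273622433483237099510916794265753322681325085659607307397890033,
  306830349471081940168511437887295872664841195586683416940943856945263653894801749598498678715400564604235799,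
  147393270760653985558910051341245370299041331533766066712568413909597768480679670916972619432442905581679127,
  799538339504920073774403845851920581544387161943289839592039755881338179946283080665307875836207938311033089,
  1037810723263961832864657186869888314911109254553350267085529163865721349834609330403406408773782499768747379,
  1040678217834906546386834462387999582421809679794452617644589442804805883918038822784301852830382825475764993,
  11017506400074956780846777301847006763973058360554631758762327728571191183747844168274610200440650699206691,
  306830349642002631726708091005155863201536621868863761962439085092260783297219727177325262365160817761022209,
  1040678225423885375075114087033662843803462857710595632020660133433931518556250330208584762888862785710665759,
  17956629221114430158429439206286261559021967256733207825237036248505045811973345930706419227097578123769202,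
  1348257883384818546684764343414522547141931942597619230849578944261159478221732942319069194550120769465095937,
  893896047053009385133217259900065365694490140598472587671710789054169807880740609623228403555754510976624402,
  1040678217884034222884063219261856791516404923190199805380302847093527437266341839500633596333411485897289751,
  527024130365825176621816227201260752011870078604138331519731421033033077588629126510988648243008184495730724,
  1336933812225807196917743804985645879652763077695787604876029956694368724607929183017112108700355761865726330,
  233384627070774108762122910037411535801510811688100204803823927323084979608695964551126014879674890563711127,
  1778970832427072097378729255799801658838157648339778959262833831956730905133608439975927142121575159192711323,
  86903356478836113027135343294887857356665673406990620491064545039622490834999147164874864190544630585063689,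
  86975045876943186175437699064408314709984106456824247572694385642789425115377904264822673896892824492307607,
  89467588949436937130517685967295737851127823168968824354078902930744864494102314281904775379566580970746263,
  1321955546008224865585712066759961751274680471679740548826785461561031627535193987040056128397384600618889367,
  1331770535417723089663459994496951229925269225037069852636888161107776296635802208790555611482742509035067649,
  147399763272672562760403562404262001630150831842984291279636025413371191885240016579594724117785580380622871,
  1040678217439707677830331831636094824585241735466990168978087762570764839704176767510567023615574642093658647,
  1332848518175933682404883378037365769210322284486191556481123871758102822276215999811982026209046232975806767,
  1321957777001828124496966120874509975498770992774053498610627931366465411722072599327925716234305588650056468,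
  147432178161806847384368524321244416597943169673422041920676037846540779610753293014389402755711325554350337,
  10395635856400789565236063683466417223103263250397883873895368222660225356761304815161892520463606500824850,
  13192718496868313715662902201833339969204982670798235422059494890208756976743842630841275704041204532453633,
  1390773151159866860507192004581660230633329187864282467507753711314378433739697463151831096161477283480225559,
  233384701451187071189826172115022303680270793981462356012842903188638601326380020099826132939741438873211039,
  86601284191622839632103671002818952723415445451467793252059285083609817545482947638823115836128609088606363,
  1334566708986439191688853014932522164042461168631795690903570341309460156700381526213869407768255945614406295,
  238114967843317294536503426103768194825011730646905847302781524837339256672729046133610672748823852892666391,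
  247181454563926067089173608546147642649342391982262506668649908678498523937664851933870617943258639075676425,
  89467588951572924166438603638241113801594895277811976641921133388198820975445668220407468328672493206278409,
  1321951319486022404743838623226238881936453963520661434504011985780319481874346973189734182014715069716852887,
  13366937410786562795269235775269764525984375308792978951535805714257630562065823922841284675851110577158423,
  211650147575611197118706342819009520222654881849581949774282445504013558504928214325944867984039357233361431,
  147399763272672562896048468209857414520689484966594833549362832825616874069378472749501953229679573650711063,
  13584699992595802085437413705948721284814470543325873020681395577760970021127529523794438050393994328216087,
  1321951320517503372839527850437445863969354139194205371763722774184113924383716385308937389739142127437312769,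
  147646501904838411386283777360017065931832150114395210576779162014009249292592929875474116224278711791331585,
  1184628011678421349162203838661988358853857322439189468423907030790045555870009354471730373994790412701759250,
  150853466071494148699471088359415084434518583529801565781418776197509094330212110591597863074739153701773569,
  1185454809983035682271564250540592989247945064112099175534862283396084746631599809732426697417886292643967239,
  745067239797067107174917719566103682632898136213291883516550842856008589002087538143054869371921235224565011,
  1038635062643796260661102794164769538924971814415831853190617435091900166018564874615510419430077278966519571,
  1185347319743463433593652021533740778215754319255051752397216909881736845878000154910609240329329706783479059,
  441107027610098541071527460126226245068778751952467774171254245475946389790059863986014657688693008130642689,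
  11073464292078988140186862868737944160798895556701877286654961558923100166748702262929345839236543697466625,
  2046127364628540525641291618005421615076448324103444955429212044644710108333273767031196999241210184878604308,
  444975731276770209386906449580752663898696986362919579895718054787030081212657430396537593872788870083498013,
  1191189904575922541678294596338624728130474470498324977578559755714349028791113701851754633944815627570021639,
  1337937979745551898593815800974410205464791919586873234090000082419001280348516871446671233704054645576439599,
  22652420604607479797902107909774569973680195689924727280439976325338053368360247763738079464910753470992424,
  734528951452078861114803794325123239429127240497562224027857830506221160610042741792636770367865719790622493,
  1044370218112397603307056690932038675292140490090719973620424517471136858937398019937902939748310273416499457,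
  1908780156152408973082585259470915190570770956787478461293208433130869138459184888097877685789078451200726813,
  1338182610589841310357940076297798302540144857240118381366418576476590205562065925585925967792375351779272961,
  22724101185360590400558218043285521466158360444038820312775818385785144471412871201188635417074677713066269,
  1484471109737377293502746916233074368227794536027815594735271812194646573005387337788397983755134292099864367,
  150833606384064122653474471509399530031606939748706039522263045123781523447520665461499950787958962493968423,
  1031753070305438013362326856378594387850637207982732681136249977677975146428177383260074080454477739221655570,
  899842665479974557136026851077998384422488475607246456941109508160126534729016645397756298931845061724369153,
  734495705454665047506799484504306088236627813968383674687989158992724810250985914853674731315762340356428143,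
  1325104810086387105851242092952688851523971028662183719197953729142584301208219942087208515556016099059383559,
  147394110671207224891468098342040739839609573057542716552824238062896769274984856278906045746239890971958529,
  303891182628236005954330040240997167553800299083108541621953364835350406512317662851356405252524630309105921,
  14442862976317646297655802678344005896776754388032171635725730694262488213730960608524188462708189310230000,
  147752479608507454168817668894986776649046625244951820806425008807148870714378288471198671590453456649782653,
  891600264816836470294156286769622117381740156493389218228115679996863210741256387392427229191788499365339399,
  441032769211372479327733440548966513693382364307393949666863156835381523365747919892585493611102778841634067,
  151694420571870756544963205417864535801163162819242082793267480401783621110078718559257320505823274279637523,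
  1325104862785459255325312651622062355368679247466922431072229488890621788274759312854757824828183809035890945,
  658811405986877315004984107638541813992090737209920844516718694223185044980141993669251685995499974992859393,
  147393270967662682322384760924000961815324040255657105688345969917338685215734080609949588967718375516208624,
  891779435241319153263759689956756223913615795700420675492387339267649186154189855866935959910253233047608577,
  11073464499118500054989754973355525905253087033032664109869375404656436243678281048089207423962311676735507,
  737969182083112041496026555037622067641391783744763468576883570905337511960653784297169695083288306720519425,
  147609178912521214053782005378995550316687533585455120170086338621531350376803705593562526711025298080604178,
  1618679089906526216116174910656650867297003675141091072339971607974477200345762856823214607736717209869752583,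
  147393288465667425914087348142347935302999184062891956657905431850945728564309214974403635492762816026276097,
  174071360552998445533532105169089252409346981151071106915270738998322123192957964992103336822960367246253313,
  274898404354712657278798737733262217477959134757441634047534446261360267326296196836084494957105697447244033,
  451320202376453996193025963001189692769753965202726766186499125511736353703363641200264761483416923242888688,
  451320280508580351845346840819037988595280498657297781714127158672747505885976087541012432321674418968361729,
  737969182083112041496026630736049495216827318112033803605875278173307707779277652481174227415720079563715841,
  1031896186289806204768502332788328985274150769734177760347098169161850425696135795663639833273176908858728466,
  174070958098864599239680730890798118808775171411905422479956287462661684248275026719570858853368644620028679,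
  440961095209049246149041113735052859383218204067105048144601770148859837823126620269182483917540728459260161,
  1322094593140023722192485649274420454145276609533908364695886905218418829825806122110352699182371353410933505,
  2340589809827028429525637015640120087630553519936042512335717547864643069148834248016380779598964406619244807,
  311379349225839279074653958480432439963806734547517307924884780907294965851598057846670434719770038575857439,
  147537454334720174837315506920069344499071679924272699612668441347267856246394486018821357594661584060291847,
  892567983317062319436826979750940921586860885925693711290964965470177557789899796316265888156513977326668551,
  734959822346905378427046889039568732190899847120970793689578486704465247979332998637128624328785345843230241,
  1908800207843031854802606495850199934635824373762331727760355751436866861716957016694133990091888586772192519,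
  174071080589177647379847590472788157397048835362738943049772710850045705122413137077915969340687701786000129,
  2045867879331395493589053413073704596731948332347334704083791477605369546498087876066389160906443708106305793,
  305038168721211092149419967858133187211053037757185150844378229612721869401558748557443350761409462569802079,
  151191982854785149770507469192669630086780850882093131600130547487675395071525390090111261202876888591237106,
  150976879848149304842103810371399766801480215632622458861266010275236789117793132302338781718538397565350431,
  440976536703923078754863378167054374500071445424025591040253291349031178830328751708767343351520030392137235,
  147399783938219326823356601629777544750897376925715423225360372176197201019852121808815196620939701137707539,
  734600605785820762010944749665952965742088070695689942641979113061532282451803855064307042052519090833093383,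
  65616760842979663781264907727939239812266615748021131547748169507429071887200780447695991025738861253760257,
  2046051886980520326803902091573873112171598600741846408105771433962258182126341532882260550399485453314060687,
  734600711284235409464180725148242917070951016510583020614190804913398532557721585368151704513040683338043649,
  734600590408991351867244825786878218961427620977425674783598918837158884865397426863572412490253659624519937,
  2340838884739782392669404112019671568886114430246987341063385835888138993127209017487334054653283665519319297,
  1028240100472850789183042329478871326087829071476271030429313974376201216782120903742394119938615815938514703,
  735032709794508024414647375779295006505053774752857808258849703970838461464563790087781838634656354623628050,
  734603160503212206114346808361913886213119352931829148322160032373558227041576618079128563479020837062843905,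
  151120258516153123824903230705558082638887411739251974502126367954424441637807554497160251003732160924363521,
  1321807923939154867431134185361378769843990343658624416563437821930716916790828125806425457682450522248869127,
  891170102565612938277870006591379107876279358966072469916358696900252072876478731231435746223866338595578626,
  2339978061416181348483999733541370375306008287737087022334348545914600180195652955067479979532779331877021714,
  213657790976412650814683161093427998388251939120062211548735155740107931819881793997076063609845132472217823,
  310271437675370885534994370444192274880736020996983111303453285382087796747507440781103556618672130325745683,
  359832491829905349570091848510462353935438212794701931559059089809763493902861605758133508949167384215757341,
  360166925385852573836033559637566703642766543445835588180027612229637711599603013037401907495534301723185525,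
  441178480678429173423599958956861744845277386938225422472806802480359626532757532605551075047640193899172097,
  16632826641911849589623971283397530346033223743422068962324146889457424275676763990361896281000585959952413,
  16663841518298438421436076444482936137143778205352176746871227065445433009898202706497627295343878175985699,
  303962776656887941643141663261602961372900975696443577294871643418771873477513622623198650320597233062844189,
  147445348795345841842534944148226956867825426569943660906289133764764853093698503440837194732092500954132511,
  598639123461749705783366385512838254964175876992586641428171659551008566668450954528668644454244323971682333,
  1054690900647422465323503438128531923707319339681020150403800110748958065231122031582913480368654100727985428,
  1909230231261639047702607789459640903969452556460020174277725661910212750999011217600453426957792493564929810,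
  1190903217135712297989615178062188361516590193149584118224360339422565098485743797725501850020707165421032989,
  444402186295868319402240590711621080883457263652702329141977662359852332357724611610272242298597052755595300,
  444402185746919651679874818468328261247397500765833041451069434757103898997462475111272484992486141909299218,
  78677337624123264804150199280007680417829154222760216973877921946806921589433265722309096165377595749199890,
  512041144153109039536013502230994779590396704726092263532756407367079055567340818240365752103015581357740157,
  365257215265914457108968506299336916619493078725303603847479372690697134801490727924240117528126961805717642,
  1031518894519524881509605291254304747783065367852647304856670591416006921689523330921310990320049847857606794,
  72107690994659764560473406739491272173981697485176822425916943664981569466072488626347831855683732001380125,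
  1191154128593473736507946936565393679426833110622775370506616518641833789620633042140881241234526040417662727,
  310199791129438312914167767123004067162067444166597916444420842558192607608599880474798373029615980947519508,
  147433018066135226260086183538888424665309192784095521340258426196346058081129528968301306991048764545947439,
  10396475760729691959199276437656760619486518428000492631669556509054088007467898880626072388201145630202386,
  310199773650581308511876998235968585733013397382489401104124656021745210748352754779105884632508557003137281,
  1044368677345598912532385722516106586851954890156416173092432832899983582553631183276859095211790965486507807,
  147399763477777393144770388979868370116697112407670413928132396824073323690254840039395967887777775968327937,
  440961198599744631857490652957720231924323995793621791680940753078854878239541797805852249070468535919514141,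
  20932235399656667114748743773699650688253202689798510664211863921985427736988546840200344634594384425121025,
  658825036931349956137642044978739815892077862224012353220310906357014895740818075326256878079901779671126273,
  218473320163550685643019780335565666339545909311972885637373257732154632416608782774156326736864306393018751,
  71691031335167843802268497199123584288175131574562837674190867572650551019543226112004657343952886527193487,
  79286548212482180492770098280130210472013149863911722874631519611692293640043379662656423604633933321851017,
  1243379849283281991388265451181533412679426944846368766315158346258726834422874229975561398639543092442683143,
  1337973876142365371484291079894432986905725669602190519846528163939765330324686103562802989546358542386563192,
  603781117940207431622920308941197529943944725291920390029851252380853867626671543106325264866535732173502503,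
  16735592137263376439680327187229267345845033436664557297419864543573791393474795119841573528902546280797469,
  1038059176422837745907752672589852894489308518630160428628024329287542338625762311070820429091801756876272157,
  173987432101062753382999886681227962440957352379808677856517707626614380829454831195241883452001404008388371,
  440961103332490856348893629502693897251767622854949082354278076254982036129370253717731681071378434084688129,
  1028311808336795788483989325254264303144539446818110476094991973341126581059092409642163007511069361473328385,
  1028351563363586969053795352633861672008333286603767760856165254691672036540378842657753614794470307312772865,
  147359824279452116518446218909008123241252417379853269274526917846106022519763132998066435749845950356596993,
  283858118662552739148470724215991062807127465034829861920558964380353970223437197923462710220549318254909458,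
  465884259570545887452026813181488241732005385409467396843026534374270585006006866006285]

/-- The multiplication tables found for translations of order two. -/
def targetsTwo : List ℕ := [
  974966343335105357176740005808131840494271326684930758815685829910929646900058969364445320141760945172281068306928609339754894244393495971726188740190277113870017124182419352178497368234216847594944499335412621310971988242611,
  3289187824340134373822454186608556877286329499746637224214385142891566632462120814280446064285447334560274145570937384573857405403680195036004039825714904114570599056712248904472096460841212179172580862782230888778429375355109203260767321526190834187362928184761358175993949746870455266213760051683186777723943795929808942457465,
  3289187824340134373822454186608556877286329499746637224214385142893418887014123509921284570054763961682502514390695435820317030473970891908108247524421397392628032517410610227183659786191520720825550530880939247602999240565130139653170112256426123932630294093511195178075331008216404575753220251293499073158301401167816033608607]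

theorem run_certTwo : (run 2 targetsTwo certTwo
    ((Config.extend 2 [0] 7 (Config.base.addCycles 2)).map Config.toSt)).isEmpty = true := by
  decide +kernel

/-- Search certificate for translations of order three permuted by `U` of order three. -/
def certThree : List ℕ := [
  147393280096870740144898921506508499378876481940456009331375194738662149507644880508627597140826795623510047,
  14588429395033355156775428098740239471767982624870097182621289565232403422309893741378702829291920902067295,
  11718496475266352830677693404218156303439474062177976638022413656938699932453550806254989878846584478711794,
  228851099163863965401724313447238575439134815419630334344125877673960835162540852667266715360502656536758529,
  450816092965374854691434723512149135102827365967026721402530220816712953663381309312138385793814928880135958,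
  1028168419887818990190640716270207865237491318877978580008606973905492839131311711077524771400017967497351681,
  441032774228536905098337133295584919461435456841049157678379963343336933734577775987050315428478415340049153,
  294822246184679492702504969486926489525956763884277885789229399873187044115569735459834308936351774447511041,
  294248855611168511072422855292433863122355076081310426709826908830345421983596372497473609713101115765035777,
  588246734131861469224373597624063623299600577370860715101710027829267073961228702180145135582758678655144705,
  588249210580153654611874386358416670024360770906649946681505602840703431218052186227027819338940954864262913,
  2212130806840228669246424162188671013990823234736872609786433080069504867991847107703198044383280142493949714,
  734636428524794617084173850559352268767946599828694050774180166116201408147665039413552721882355479400753153,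
  2213656467355737416105616920822881845038897494172984180430756473656603250732509119299636155757646406279434226,
  210500476101729684643629951600625129948808552154542116434267791945451212335494335769369493169451677034487041,
  2213193058252592600375496654774947906805150519736364478788377738227954736059712820470068884923416066869174035,
  1175024020666732465226396928583644344006468466411388459677757576401470570400602503422635057139325517204299539,
  11718545752483658979628785955939185598263790802023100871832783861079713782242752286049762838176471413891489,
  1028598494648965461293517374963854931800657180660264270369624399999316401348790121423978650857101986992494751,
  1042756349848326616152739824570311401114684012805587752799478481654017731754538116464253227627175765321195265,
  2208031450508084281688715148068913823290051659990214674238467600599292310797212513630368332592278218582529793,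
  152554902812659252409939004787527811103604334335841505313480086822791432906994415772569730740128297040802223,
  152590861795563160687300184961786922973086872374198713344036946593755189397542496734414174743659614437417407,
  152915510465157506107678250411995599875836480798649589921711789896991672620562127932771647498216935481454363,
  152554902812659252409914978936743551497149055369204474730611628293237129514694733720526780888452987796693514,
  246624182003518308045027046825164752861123768384589651123241102031499722917749329275881418565499012753912303,
  152577860197634942753739232074899039775617717736135629561739663055009435901394629017445062842678170938810634,
  299338819842989799601206766642815892065753452663457471038142074016292373490108509264186757153893630308639242,
  588712662270578982213292935872490936351859300240823102254386189933377752692107408383256356785495677869269422,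
  148360919245244437132693250781114746917257900765752907438772398010830530586699234530254222812297990288452609,
  174202027541659904333459076411812350730923384739861356896415237461015367182014636422191027355718541518056449,
  15302128624187212459096896579833000625546920569060661578263219074219052430594537868902860247738451944808210,
  2321665924231682679188451316396470959620626174245581204887284387904468622677246425223080822629599981987888410,
  2212187290377307883486264663533310224882095939733604636057526406498929642796328713954894681443970894549291265,
  15194629602867063472250690941036604494851547695874552792453858006677667313169892329897105111367285880131841,
  1486083235904818343826073380769497332443150990941532147309632825415997609747419918969176795972225747866746138,
  147431495156273701086873198467752304673371925264982653644621498452135713935583481596674312028979137885510145,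
  10356728457207434260335879708183355000745598300932012814191133146382875065354454915812523317200314984043009,
  294183727292612634469596611231763388710311274852092168710413940433463925337359538675034331087026380478615570,
  1615763204531788610054744491780016968334107923320608308356708282194827863934005795695649439847880256052531713,
  14979561635101794298594741980364115416524852912249351092761949840948290766175786759560008320047972250296273,
  587780840950856405725524728228365889094251382543324312806133973390823888152412430952512794691319315687472410,
  2340909760204227043408846109654460660447145328403884343569871615205763901578453216898202475554719829977995009,
  2212366303714946047707603964031244604726180752471434066154579464828469741697539375309661536366455469691219727,
  1762374647878346780937903726160891001848304369547328335260079828813810625151542036309044108101092383272210689,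
  441928750849350961338810649284384932376557013744893112719121291486747076287276239455899091674876010717780757,
  147393393830026052064460750014481799190497819990908338304078950545484870029821608754879056896035016124930818,
  294183727292612634469596611231763388710311274852092168710413940433463925337359538675034331086991187800826113,
  1615763204531788610054744491780016968334107923320608308356708282194827863934005795695649439847880256052531713,
  14979561635101794298594741980364115416524852912249351092761949840948290766175786759560008320047972250296273,
  1923102299134042849952341350664642924929413452441418629773714470574503775899955524821032572667558925375307034,
  2340909760222367798419059544291718142546779950428030531719211424549460724233373124236593288039444363668494879,
  1028096748634921692213604887734205438395322595975598638323298871014187414475789860668215213045742355714023183,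
  10394952850866406786922649943490566010438527475906304314206075038214960603194369365358960735395147806680066,
  441032774192224696322007281329059087976651710244657005419152180424029325476998512250937148751007173791715346,
  1468520275020610790305397732101275719808876887924906477120410635434793380288084874704383457155302329361109761,
  2212121944914305242086664944387528325287378097273391128186679387396200793293840521119462440410490853375614929,
  304139575548181777313152284991910227192343975776037812488233361657418232862773232346411975448377937710030817,
  1042649743745562551020025055296531138278943500685696353112247911501893407692272059574729467166088026988220673,
  294177305255281468991126140470501790181544514404697785802722024283772288583118592924803423714663677870319386,
  1615626677014797624848243461597140616156225388915511954605367248444406573528545021959124905432598301938554625,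
  148934442676977966094768043091014464434108529896064886642552479669397043588780728526203078351222771349990401,
  147897354911569688434718684457833448507745810330100970067213290846035356845397433824339900755071622385245185,
  174202027564904880164173452372945113709834204201429365015231619445008298030538916063033960929560576801116417,
  2321630088317943819566597175387096179208313646474555246638457063782106925835753932140027167024092350209069569,
  294177305257285521917567635048654034318051256957025437563381288686764325276203037101620120912508058383227649,
  2202869813304098610917312069383545856460682988494208857046236542402073030183262657860079449196659874381013018,
  1615554988031266079608097324803766124074512309451345694728249160113885942064650654266796401956225746780299009,
  147429106680617703728368913245582260492504630831351423365355543377308268290768891574700815214262949862506482,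
  294177174017957023071248363369205916994720027189801755596562524278219227415701763769128065074271361259546369,
  440996938274603887931245392825850300465525051617113622940573908555376840652013156254031526238251219308061202,
  441492000634900465949302309333221228036725186209741403829784646926372341483423078621505644725692598320108289,
  174202027545678389363469798053768761717412743511999863910202603576030439411399622367420152932879129313614337,
  734636432952693169398014659703905652109109098478885543308452144400017347928285557248127884656362913171119890,
  1042934898995400674946901531576826621561704893286737401912459266199390249188205801087118448787056431694090770,
  147897362658589674917973457724526495778392554551792448234653661326041147657439622073862602640339558256977690,
  1631897346043498589042711288165626783319384645477539673936102163920166010830016277975582246287239750024696321,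
  152577448993135563228821201621103419749309995194691598247034659938063231052629321568534528027068284228264202,
  1485077604307721116986452266825307058565647195116994525687486512401341266086157097635976204483571189829775882,
  246624181985495917429737592318012364024414313315128561525937250148308177292098754390061614694279249043054858,
  1762124040411684591866842570036500287124468831078004830514101450612405203107881800335041571873334888306352394,
  1762016532661922547300172501754007275359470149095711112204820294901486272278194800965690769956100851883935234,
  2212121944914304261011218164426189957022977098894784649058990480172617343941153379212426051361944264840847874,
  1923102325385329063049509574554424690772192612006038862739099995276220745487488396867981911139584594949443841,
  147926338792020897277006771625313036799504062603817449333595444780160443681385842862621928405904279870640431,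
  2212151253274952198188358852075951951083013730995078049495864388650103523994098317425819617429860110253957089,
  1923102299134042849952341350664642926372688994283639976749440938612166427315252307172798326802014716169396481,
  1468775302177659110099801240663638091904679237974889824469893020243994948957094639557983962807462127493323295,
  294177234682124830387893137263060954521476739194976688058259900161710210675549449771100802364851672099793665,
  303960387217809466225671071962405036192579692855901075150462255744785542603206734468993792326107755791257857,
  441032782941228021714680807180745798623085898954658927620773179274224723031978227873895530578357684649595137,
  2331126493957812376678425867730925342518764205209506260936326125372190119979717549774481343991416169557922817,
  2322134042870157481554419640194795184287505264836384654527859432864666094509784160679852404899899848539580929,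
  147431538909833187980535800977699939634420349991934085506176018310719640750270371165901452268609781999931649,
  1042649674127581633509300720219314269264470170267580864574943172401625464127453716376118044074871970248790529,
  147897397641924584586815599487018747244076965316291699183594298419585198600655021864905539158103890096944922,
  1762948266476807067043414585463433233450412296826534539184593069492328929745117841238893121540911068718567937,
  1762374751817419981992560799314980109678424120932920257602098544450914040875754052207618487137502288490270979,
  10356728457207434260335879708183355000745598305754004667488540995967934141657170366491169011888156074584834,
  440996938274603887931245415591501380904503776808610781731817814381784764076619940259529648218234648814231570,
  441494240379776142951215095912492497397725193741846859853789772050328060349636494652113416579946985815020289,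
  174202027543549736030553442665034074674413533517039395589505717425393823706983525061081442651410992482621953,
  294177304701923156681999438749404240577427202758644880740077408278165524326655712589439918589153581375233810,
  239637008744878129086484771338430171459985829495368445309163566744016603281324859728149504890513097043742977,
  147432658773659285649253882206834686526848646968438975713615511017428494578252129572672163277149684760684314,
  1923102237878204060789868895257856772613971824620884982915920834352669710365728593121214609342362835235219201,
  441032992921570096668316088877601836977864247737113087109189743418822327201233396876479829776785424428702239,
  15447931326477337075228830221535524162892639369156010434462591598882341209567067840905357201528471848752129,
  2321630088315807834321082397319981864512176227917626627451301373085677810942548900779726166309998338000485658,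
  1028240109215438396185360528488233946002358548643904381376817801441836042018671065141366149755990093068046849,
  119838943345309394900820506442198690514533177556251384431477445634968604373869914917352185026276076296448001,
  147897388897194216528383752143682338190184782716280169510942650723309040079392708215213521137089318931468314,
  1762374743089765480759889814226383724968808318364880283045213419367648158801403848840686287621075671044957953,
  294177269697372829098905075353471351377308646415354620932410198295484056631391668794037544141833553910440706,
  2294434803934081203147185301168353858718137043363722244657838632579210651265644269864872808156483943158255873,
  1762123821669533081694805548999307002206375140014069810159933519329980086676052038051669250143423372979081985,
  174202027573595398441468363288554332885561782444787428718729795554761699587942050109381696573096247665103618,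
  2321665924231682677398045184381190252610594040687908296508728962916367188487174621071015613712084576165171713,
  1175095701223828057212758190765256180380653336931877327337386591297925569764472588186045717293747472948861697,
  14936998558463128251959793926037954326398385560461786021929525354623202793959682303627028162873613165371418,
  1042649674110580905568361246288882089493629633827435138822851464896276487802274981041402807990301141713920209,
  1468627731897565568041410853551837850614039237782799261927970170795151178847172422443447613531475941088339738,
  2212187290370899922378501910520474078993243853712351242206037750291551999690076562109890017504334888396921089,
  1028168428634686850272328433609145985952772472888893154605838304376406414628295625079140506872167750212522241,
  1468979371822089993949314970658009100669238085883994257698007399998509104055642859492291530755614678721768193,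
  2210930802332360708328214541056441884442334718238889852422365918543042637350104650142792605994451347423964946,
  147894971942489163800626056408709785391715057754526084566879327664507769355488684138796277995152173087855009,
  1042649674099900918686535715479083741676276919187503378954248545172557602426998005325615090132190666670542874,
  299338893662701759954127176459905947729914169981406533180055217322513557666428157475494194919111953159923482,
  246588351673086900714055832822817638998613837598452684427402984083501031889715543633101752683712509046202798,
  152577448993130643786938353837205081452972486559991198699102247754604351112282786497907349165448160534978826,
  1045613323406619770978664496433586835067105795854410250]

/-- The multiplication tables found for translations of order three permuted by `U` of order three. -/
def targetsThree : List ℕ := [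
  102979127155582983939485347909743296250578381586397341013493424343429781169742777030523029270498410451008512352714135882041704882549642423099203818899643576891111172203406678931281308804119426556427105362643190524716191703866180170267156134032462184476059284224475732,
  103012346117725926863718403738295708616914976377280785805280389352038668653769199770028302569839825102069153155673427770946334399289864813868228532519202746308438164668018018097078782918851849626399699611159412326009936314444763153948204374482810600008302097636762180,
  102951444687130531502625018298144277635517679744881072564771929066200032675534481622450470276008424563974405625617559602043845851346395943727233861548033823297940039637098649753987741962967633972648359245184599863603199325844627230644356159256001778704547268893679034]

theorem run_certThree : (run 3 targetsThree certThree
    ((Config.extend 3 [0] 7 (Config.base.addCycles 3)).map Config.toSt)).isEmpty = true := by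
  decide +kernel

/-- Search certificate for translations of order three whose cycles are preserved by `U`. -/
def certThreeFix : List ℕ := [
  687512196419586355299394179249672099977169277070959571543281142900583070826663876908130917508361330010226673,
  2239283348265929302645151509231374430637290522357982863316866723184683902037171494682692522583364042716353567,
  1040930258703324154039275631771690941049679487186511505380132992557268921980681845996727441708715663611404097,
  224242417048455954086562835543823811039439951939555483891849871977403609869568774229827570611998380065388567,
  225389165855803997327611420670441483223752048597195186273841521525819209375718001414415181325877673513742714,
  147897354883851836963095655504421732642105194322351579919978298614671539450956595004930141003015938027065722,
  147399815046679764227465748711853766488336111441633433269299709280178550754551766198865852331465987502240001,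
  1468912039510727151724656936113636675961183613614570094808523663615919095564463566529341760860996036058804689,
  1044366358279075793211211805368071127758087474341151623784330395975442240510516631935206004362139523331661296,
  605457501495000194637531928037469414696204360721505280156906057959635872554015003267021818622210140930055664,
  2340009311186215956977992315830528757274915885320205680282275438750258761687023944570373044517373633668060161,
  1513661954179674304330118670946934118292423128006686816782101241930034414709471675629457279307292652351779871,
  737002136527874361937569633731763695046575117132286188041602646688405341717608375649560618390089488996293124,
  641965165806032459520901550047368554116642053621883480695452763164894061147952670710930580612164923236959444,
  1510673482566674256270138624814888229216183231656208258317720087550768069483692711158653741696417873944134916,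
  1510673482566674256270138624814888229216183231656208258317720087549371358525280674972332850490764239118314314,
  37278453694823147363521716780451220195975745678517377136987058976930023196808391652708175249043716353338186,
  1657421566821031421595915298666637760460226847756359019263624346135195633863183597314153550720538893856292929,
  1657421566821031421595915298666637760460226847756359019167643282609398664688726569551938100954045090557635146,
  432113838862829199064150681847816280054974818077267880681410263512575075429552668722938597033077200035031626,
  745533229220896814502631662607914812227833677584256308895470343105124170550095660508574103657080712598590193,
  593014171085170702156517364625743755371245063304830366284676219463674087334847916977400669325788887932552212,
  1470501838428695739400257186555567934380918595965020860417255323037502376856957027661447635019733921660447236,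
  147399832516924508498347232320562482892985183960277842575895680817568219752520658463232671820413659082934861,
  147895096090368999089752138845656623267239979586551018473797914191943512007461320071378300485899112697426975,
  1577924974325271569789870361499426950248191012229449496127349069353984926329410883920121970256844598609452801,
  1028560279002025264542971215202471640611472475822206757470661502836810194410929077917679142399825227229098015,
  588208519420627001525186875353079766010500521893448044187941979186723028738924508456023113760061932499377648,
  1468802439418787437841979570397487322934436210691248882722257440129586652229055921282140372732420598018278429,
  2202838089015834732895654584435990782128538113876767153927443054826302515721137947844209140460683128468253213,
  245766439057209800378671986899751513476210071312123231618144727436151404009608300551929186799794941827489537,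
  245802274970949179564046264116955763842538834954842794324344267227055474417369431835015774635246341439857069,
  587852529733513408884568049891080611976268916732094148054469649338654290737727632720577065716506862963892653,
  1483144778299728225760078778991716513144380409060061387940996588660895115742926126513563341697495534464406529,
  1629892862554085391085855452845285045975301314537235344009133594800437507905115795587739782747907556336839450,
  1758395976463883166011132713141986565780946869412816397534587830588879389619152463461617573385859940711770650,
  431856584755813385074428448921548984519575747611484840269299107041567330060816204470194641413125571742875679,
  174274250695140007876573521098582658156141373204064015515023775990425858268289080346308206001137054881157873,
  587856712299738780260039926791990298284681590533707654776235913869940639440056569128349527464820901885047572,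
  2045948203723948219021605200818052442511766571398598489853662116294414580094231342034338463448361528459198541,
  2045948194402500183548482875283679859405841367867433202413990823251897636912884117548919448515365268670661652,
  441465176163869470111578038394459990106390846936231222191602381784157467842881594385126635420700175490810909,
  1758395976463883166019422453215446282862856615650120463164933285372338288014248899394535316947367538168172964,
  588208486065051944369735018485195057833587791336469181958841128457157675968935111469159587449377660406415663,
  1030319021167643268455432675501596090530379320497423017552084535295382408133223007452934764840044703904628813,
  2246083132455290405465046009332661139858441395701676873886079340357142629522434651246933529512393165713198852,
  2212151393235641440861585315029825910188308409159580788161215366379712147759556863921781258259975589443460941,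
  1468950255166066324475215006360119815120349573995551121989563118543714888826140249006897859534382927287763732,
  274754123438919080298922080082678869278012906569591665442972240608103776927078520492401092447549194222182145,
  587852505057254614598526116753283708781656238060216958300021363390158832151743670616254216244072059243716381,
  1028560279944141006011153270848626754534325814292300851031610190125959973910524035084094392431028054655104001,
  1028166188360470165939751797288161754555090667346734439845859581004005861182287798470954829177367528397014813,
  2239574795050500949177073286104623848051556455734520461749598207440541922583931757650076039054609963039000349,
  432304533706753133316544015687493237000607262824412086079322459057121746934255256365973152000112906560869105,
  432304497162851254009250977225348499654307752278503270005673595754367759184256997174832716861132545238966129,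
  605268881058192107788270634097303959797669423567751484750081091518150279783463623836718142574730669274892033,
  588208519420630616895932342563873184934203823838205253446841016889830281513286333377102842812238644084938527,
  1485719162250490048336122257933518770445895705858586262243313980096182097711601116188332959870048452904682525,
  1028560279944141006011153270848630001206365747379721895504056921938606987358028207753596173748827068851753713,
  1045367427973988356266627849721199240994889312074824182710591526246867144415207437139223770726806990461273885,
  11471849027825423122368420321573173329278713163971458284286659295353811803992478827296628780031941119251185,
  1044366358279075793211121904302790858606524484206403858997431877081345717484481738476774138855080577599664148,
  605161263976498699339812114024674276834394365807446463391373081957826668011638103697810422659254289682144752,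
  588208519420630616895932342563874541872749593383423884317218708308237408498608342207840048617166536550844959,
  432006331115206843326770691084399738364064266529308269398342042397925059003597111710483780317693242039534621,
  149113808621075115799375588970495573271013957819305655144138169351313070760044767902566809291435704045277937,
  1923102238185861792310310348475745851489755131153618612216949984508531641672705031978434869989257940258799876,
  1028560279944135271223835563395644780408826764385552452985171057545158269211828326020626045676156440681649183,
  588100230736994927869119882860834375165727725079375425040626179753830469819152994593113669389217978889733917,
  45154656534201101820403247053965499102644926694730508880837989324235536073033562834687407503203549457544221,
  2045948203723948219021417669071153337619715422303562620444731893477269778159740050236665299012598940794416138,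
  1150773928309548654137047383736464099776892720153610703579761483801324125001014521726268853537168432480506881,
  1160217952028104700346626001794915130163762482961243440568097984631479341907889974803474508487347927112487967,
  1028560279944141527976409483218845014167435438556341392759386312981471620750126355355719212147140262841778296,
  152542269694730684147735786082715591981184579247815858345597205164704553182024144927763939789955961613911837,
  1028451965007088658098397516707290687533274304191704283606766744969782091972916984133158491859420663247839498,
  587856772122219344455724479299805838393003775647287189868892457781759164146518820882761969995754436191782685,
  69088214813516304207419857249185451578682646358837452999000911753261053947978601956515252707953194342151377,
  1593194552102006584043760172168531409695116594833450054273929491903156960714953822400202388337751537939349624,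
  1593230629034573393825522975001630026572799708367071542294941006746531821831919735575684842800939885066720287,
  1028166188360470166067563869045481362054525679557013526457977982393738197726443413598309955705078963178154730,
  716317579167763570591453792007727613441453480487145362421678119311832204374241644080165316020848044879578909,
  1298046373948534438811555544223280725591329374218627803613052155996715721013493316374989817429610386222418655,
  587814454075044460488224155030276919541609511354750607844605297857786854374767413047763428572367455345641447,
  587789802117464997110134265270764108106973779271063713892641881045461998841230932387236499858464684225004573,
  2000866845738437491155000347348989664360550164684364627545120200092893249432025353843480819664569037439898625,
  152554902812659252290836058658026431575149396566082949251191227848996158746038113693766041956904228018067998,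
  1028315980579262733998161041763719795337933934781450057535650441399417983990798045255363031303732966487793930,
  587852625943017502246975962923603737091105059703855207318773456222327447885905241885190796664132184512142832,
  1045405513942626879516068380417884467804146405908706206532214128498584749994217926746783621777012628549399553,
  2239574795033133608388251452139365829521244125053816972932611789144939220165585740834759932215296656477717233,
  2340049625497139935347666454035647134837631857466225630353791147720265221082146950842488994972093253722314527,
  2202368153205661672475845879404902476115611056324724216652059248848157934053330529267952774367732241057053375,
  2239283348265929302645151509231374429967473590016857062986036119803478963180254209814797325623001913723195905,
  587852540060869495386996531813707818829013115041789814096027285661457364330946545167248140716091811906723649,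
  587856458587042171007608484430948882216555503240014383068465477943095436467575347980073690105611506586612737,
  2046051878812509517181199930208114193033654091881698078115236158598773669048600211199599403069300046045385757,
  1593197295048645957541569584617872581029328649498691960833832454017676182423682595885567110278022100884132895,
  587814445291864204473120644795733594722870303629762957666979866006113965897560021180142492571887096133851873,
  1629892862554085391085855452845285045867057073149592206627780105718767776651862094610394523926266648979313665,
  1483144778299728225760078778991716513144380347070883957086044145809540416708618305273176128685473678429891098,
  1045405513942626879516068380391469395001445634548356339301281946680769500983173735183071392000654766088760090,
  1629892862554085391085824992386691912076544080209688592604194564626972523491441940026620571467620065929528049,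
  1483144778299728225760078771537632715690107797923606356966887261326453081939240074013119571205503615287536154,
  589573181511643239580547609171176353718469907199222013067093536890380658267734584615938887273041928179002138,
  1155522983228389915074880219613119448281206658271268241136355576772432836011352677190701305112732025319715663,
  1030042910701472556771804797496624284977638794082746884942469548816001466723314347916263423864042760836741359,
  184056064300444040328592897471142990355614586699041482932745147445052744125599285342377955167828286158948173,
  1973237352952082699738422772056458261216150240553233705984356036408482235238717337101407597037531317365117505,
  1028114372876355475944735729161432600363545999642399535710206938224737882366131617701141986292485352597165854,
  1468912039510727151724656913342648513945452777639270064276683990084158282967695742614791706376648463479762967,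
  603907029345673861696391599079198694389151068973362307012278269173129115223857312282311091329652602540400112,
  173736999142109650861079712955154243921789016437465727690179433315467677865908779958566722425367858780315120,
  174198658325174708103193348893411499859746388059274849583883464054948242138617741538161822950985046063849234,
  1945607860165734499962442347695404884273523366628427320196766259986320246883335580511542382503790979432911105,
  2241501297126741811928747628724158712872409176875726658708809216834391190143717114732243685448892011540386846,
  1468771076594884203601775902217747282188441588068713948076919170104582289301992562595353038162361616471955743,
  603907030302596109561090491232104799931344493824299204429110307047729713191872023460756734054174898207595009,
  554686164914780886017]

theorem run_certThreeFix : (run 3 [] certThreeFix ((Config.extend 3 [0, 1, 2] 7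
    ((Config.base.addCycle 3 0).addCycle 3 1)).map Config.toSt)).isEmpty = true := by
  decide +kernel

/-- Search certificate for translations of order three with `U ^ 3` a translation. -/
def certNine : List ℕ := [
  147393280096870740144898921506508499378876481940456009331375194738662149507644880508627597140826795623510047,
  1321879630136814581226986126985047595965648238679271302832780989360232314458876305742703584702592752297185583,
  1321772193117969230244547221667382364784806444124353106100193969044287224285403644911235495013373392859820564,
  441211962518466780496469503385390592535301559495365777674944696812301759296771967494023362244628926996422401,
  440967602916632156251569882783336385227911846387941156247477453343811498442877876758030597851725514689044502,
  1028813693847646173717892085150419011540336370784289717334866892017584429070160943763107123045458776014459137,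
  294786410254145880936572175947970825389479674347758321293067928520336140568512299800434968179859231140231426,
  1028598494627605069453005084406492467124254693449371087238213691450210601140521621320778070792877726420177409,
  2202618934624763374235408050880384245039947402884704042693926634688340445373362318615716616095486217459605249,
  1028598477150959141548212038375776227738316683002846532968362676072673336741699658605521221032007981243308033,
  881456175866170547103478197138673612213347440747204210429849987653087489822763294925243528939532520650710785,
  1321915518578766963566204427606996745179467769707593675662944924885879395365983152013830691021891790680559602,
  294822246206045622372433847819766341570433686646947643768191802001209169608067154247189577770886589368582527,
  1028598494648965461293517374963854931800657180639267041708264607305120018382445116599637799811435413132808962,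
  1479629332693638456394258226097952341141196728157995259438335770144275023988081413569880893586665523508158209,
  15588764318766663125614262306052208020918329106068291953145738163267382948123453284762001572318934428817178,
  12904829697]

/-- Nine moved elements permuted cyclically by `U`. -/
def configNine : Config := ⟨[1, 3, 4, 2, 6, 7, 5, 9, 10, 8], [1, 5, 6, 7, 8, 9, 10, 3, 4, 2]⟩

theorem run_certNine : (run 3 [] certNine [configNine.toSt]).isEmpty = true := by
  decide +kernel

/-- Search certificate for translations of order four. -/
def certFour : List ℕ := [
  294177174024364984824783250626528767286266212842633393996461067164021130119121469341153891683092997010358257,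
  1486980192499613529642381192219860121974611270499562266310110704270557016239135507571051624512262864287934228,
  587745093627304040697549613300793801067691512677616633571851182648916253999002715469354354388387374546703141,
  147899303841736910333850680847730286476718429865277080477352212017044696679601443118002690686796092031444481,
  10571770199457865509680021846238537845796304086521327677734001938317175108294762899392559184972340724241409,
  747396661852352511422160330940592607973705560407906921889260909753803134382945575092893053512817173432719122,
  1321677782785963123995707488600150249421513671170987606112249055830397805256897958443892726272899299446627095,
  882172881792970434776661982849267689945909793647433455777707875454135705494013056868653624944527424663591425,
  294188092897608402571445698578188361736785467060897863408258702040805185272088342935222891879710141455542018,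
  1762374734336479173672973931934448396889762441214055638481665706431932427429789685238806388881679135756259631,
  12043912424061250790215767651487089391771208874701670835985437347991361994358932811079583064867728628135682,
  147393270762606871689250202654327049377351437167346726659416689456691611898308451804954682393069776917237781,
  1038596697651059540919938800960382432793552171468305393085772680062384593753102296696352101512442806122057985,
  1909194447301281829540145174124380199949335969202768477934486752568734981323154410383334897598060443895602177,
  147360471398083940552833373401121919144528702731208476501705896022801566142885089245730045814678127354769429,
  10464236202900927873987619398674452695835282560699132509585619029088732843139041013279915911290197532288001,
  2215627321154872419068155030145050027352968796693612854692593324409537435810484472930096880156686503586566463,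
  1469344371478316169617211035654986033629122140956473668108164910659780238239695056284096189138571630106121217,
  147679984336621691774812385182857464461934947362610649511689986647807060461886292403447114512193233225856003,
  147505556645147804496557441962170256684461250966635403735147013982612466597026042363594709418510963994398744,
  12043676221729058018288348704051145992809913207164973065413534323444739648183237691618767925539669679281153,
  588425896187611086113980688427221143309532959451024253959103237596778320375908557447575308121982799290831105,
  1615519124827950814003011019648881466087716763112486991034637424207275879766677367737301958766516665385488402,
  881456206556198631200914240253252771625619263998223552600738684814591496588308881084383295663396022060646386,
  1028601696784218488175836300432641581069600624376627014330828082844836567517394934417397023892065281234786049,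
  1625125949963336961175716227240726637562052053256322968322389003062653739752323731400809670792469464958969109,
  2218997689134867955802561656507240766613771573569387827237620214583870634055076600751585579253804064180277269,
  147360313898959018872368457808720036805916804993974815596037459228564598779204458985260389436666830153445150,
  587995882695109883590776913761652794750434497743802050094340092300334922462621259854815542965688439216804865,
  1924822774006665078754149423642234535215179321994140008901602511444296128342933033170531875760992742409246721,
  587816678466039974788689078081993605038314748900502643871138727879905828868602322105924778437355839393960145,
  587816913093937572670679933701731439407964301987338750779693248654809519730164698479219803701834844957840641,
  12401957261001733624689809657654721484818185882637909595653316400417825809874869244523364513303458790517761,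
  1174988175991024601104627058659394237705090127585329711443772241657591664423025815032990643071926424299376897,
  16631959542016552009675816788255341208186202767670496588095442211244382913159158861025539357736830068855809,
  440967653720678147752852114775353176862598865430961821210983575580024303321456795576419135021597549927406877,
  441928689589239072387396733221522754947168309111655718650300669585542072280950420592842618327604339581916161,
  804661157298384922609495810480031266327193250721519637505]

/-- Add two elements exchanged by the translation and fixed by `U`. -/
def Config.addPair (c : Config) : Config :=
  ⟨c.t ++ (List.range 2).map fun i => c.t.length + 1 + (i + 1) % 2,
    c.u ++ (List.range 2).map fun i => c.t.length + 1 + i⟩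

theorem run_certFour : (run 4 [] certFour
    [(Config.base.addCycles 4).toSt, ((Config.base.addCycles 4).addPair).toSt]).isEmpty = true := by
  decide +kernel

end RigQuandle.Search

namespace RigQuandle.Search

variable {X : Type*} {q : ℕ}

theorem unnamed_base (M : Model X q) {e : X} (he : M.op e M.x ≠ e) :
    ∀ a, IsName Config.base.t.length a → (fun _ : ℕ => M.x) a ≠ e := by
  rintro a - rfl
  exact he (M.idem _)

theorem exists_realizes_two (M : Model X 2) (hu3 : ∀ e, M.U (M.U (M.U e)) = e) {e : X}
    (he : M.op e M.x ≠ e) (hue : ∀ r, M.U e ≠ M.tr^[r] e) : ∃ T ∈ targetsTwo, Realizes M T := by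
  have h0 := (Config.Good.base M).addCycles (unnamed_base M he) (by norm_num)
    (M.iterate_injOn_of_moved Nat.prime_two he) hue (hu3 e)
  obtain ⟨c, hc, nm, hg⟩ := h0.exists_extend Nat.prime_two hu3 (rots := [0]) (by
    intro e he r hr h
    interval_cases r
    · exact List.mem_singleton_self 0
    · exfalso
      have h1 : M.U e = M.tr e := h
      have h3 := hu3 e
      have h4 : M.tr (M.tr e) = e := M.tr_pow e
      rw [h1, M.U_tr, h1, h4, h1] at h3
      exact he h3) 7 _ _ (by decide)
  exact exists_realizes le_rfl run_certTwo ⟨_, List.mem_map_of_mem hc, nm, hg⟩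

theorem exists_realizes_three (M : Model X 3) (hu3 : ∀ e, M.U (M.U (M.U e)) = e) {e : X}
    (he : M.op e M.x ≠ e) (hue : ∀ r, M.U e ≠ M.tr^[r] e)
    (hfix : ∀ e, M.op e M.x ≠ e → ∀ r, M.U e = M.tr^[r] e → M.U e = e) :
    ∃ T ∈ targetsThree, Realizes M T := by
  have h0 := (Config.Good.base M).addCycles (unnamed_base M he) (by norm_num)
    (M.iterate_injOn_of_moved Nat.prime_three he) hue (hu3 e)
  obtain ⟨c, hc, nm, hg⟩ := h0.exists_extend Nat.prime_three hu3 (rots := [0]) (by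
    intro e he r hr h
    have h1 := hfix e he r h
    rw [h1] at h
    rw [M.iterate_injOn_of_moved Nat.prime_three he r hr 0 (by norm_num) h.symm]
    exact List.mem_singleton_self 0) 7 _ _ (by decide)
  exact exists_realizes (by norm_num) run_certThree ⟨_, List.mem_map_of_mem hc, nm, hg⟩

theorem false_of_fixed_of_translated (M : Model X 3) (hu3 : ∀ e, M.U (M.U (M.U e)) = e) {e f : X}
    (he : M.op e M.x ≠ e) (hf : M.op f M.x ≠ f) (hue : M.U e = e) (huf : M.U f = M.tr f) :
    False := by
  have h0 := (Config.Good.base M).addCycle (r := 0) (unnamed_base M he) (by norm_num)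
    (M.iterate_injOn_of_moved Nat.prime_three he) hue
  have h1 := h0.addCycle (e := f) (r := 1) (by
    intro a ha h
    have hfne : ∀ n, M.tr^[n] e ≠ f := by
      rintro n rfl
      rw [M.U_tr_iterate, hue] at huf
      exact hf huf.symm
    by_cases h3 : a ≤ Config.base.t.length
    · rw [if_pos h3] at h
      exact hf (by rw [← h, M.idem])
    · rw [if_neg h3] at h
      exact hfne _ h) (by norm_num) (M.iterate_injOn_of_moved Nat.prime_three hf) huf
  obtain ⟨c, hc, nm, hg⟩ := h1.exists_extend Nat.prime_three hu3 (rots := [0, 1, 2]) (by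
    intro e he r hr h
    interval_cases r <;> simp) 7 _ _ (by decide)
  obtain ⟨T, hT, -⟩ := exists_realizes (by norm_num) run_certThreeFix
    ⟨_, List.mem_map_of_mem hc, nm, hg⟩
  exact absurd hT List.not_mem_nil

theorem false_of_cube_eq_translation (M : Model X 3) (hu3 : ∀ e, M.U (M.U (M.U e)) = M.tr e) {e : X}
    (he : M.op e M.x ≠ e) : False := by
  have h3 : ∀ f, M.U^[3] f = M.tr f := hu3
  have h9 : ∀ f, M.U^[9] f = f := by
    intro f
    have : M.U^[9] f = M.tr^[3] f := by
      rw [show 9 = 3 + (3 + 3) from rfl, Function.iterate_add_apply, Function.iterate_add_apply,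
        h3, h3, h3]
      rfl
    rw [this, M.tr_pow]
  have hi9 : ∀ {f}, M.op f M.x ≠ f → ∀ i < 9, ∀ j < 9, M.U^[i] f = M.U^[j] f → i = j := by
    intro f hf i hi j hj hij
    have hp : Function.minimalPeriod M.U f = 9 := by
      have hd := Function.IsPeriodicPt.minimalPeriod_dvd (f := M.U) (x := f) (n := 9) (h9 f)
      have h3' : ¬ Function.minimalPeriod M.U f ∣ 3 := by
        intro h
        have := (Function.isPeriodicPt_iff_minimalPeriod_dvd (f := M.U) (x := f)).2 h
        exact hf ((h3 f).symm.trans this)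
      obtain ⟨m, hm, h⟩ := (Nat.dvd_prime_pow Nat.prime_three (m := 2)).1 hd
      interval_cases m
      · rw [h] at h3'; exact absurd (by norm_num) h3'
      · rw [h] at h3'; exact absurd (by norm_num) h3'
      · exact h
    exact Function.iterate_injOn_Iio_minimalPeriod (by rw [hp]; exact hi) (by rw [hp]; exact hj) hij
  have hmod : ∀ n f, M.U^[n % 9] f = M.U^[n] f := fun n f =>
    Function.IsPeriodicPt.iterate_mod_apply (h9 f) n
  have block : ∀ {c : Config} {nm}, c.Good M nm → ∀ {f}, M.op f M.x ≠ f →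
      (∀ a, IsName c.t.length a → nm a ≠ f) → ∃ nm',
      Config.Good M nm'
        ⟨c.t ++ (List.range 9).map fun i => c.t.length + 1 + (3 * (i / 3) + (i % 3 + 1) % 3),
          c.u ++ (List.range 9).map fun i => c.t.length + 1 +
            (if i < 6 then i + 3 else (i - 6 + 1) % 3)⟩ := by
    intro c nm h f hf hu
    refine ⟨_, h.append (g := fun i => M.U^[i / 3 + 3 * (i % 3)] f) (fun i _ => ?_) ?_
      (fun i hi => ⟨by omega, ?_⟩) (fun i hi => ⟨by split_ifs <;> omega, ?_⟩)⟩
    · generalize i / 3 + 3 * (i % 3) = n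
      induction n with
      | zero => exact hu
      | succ n ih =>
        rw [Function.iterate_succ_apply']
        exact unnamed_of_injective M.U_inj h.inj (fun a ha => ⟨_, (h.u a ha).1, (h.u a ha).2⟩) ih
    · intro i hi j hj hij
      have := hi9 hf _ (by omega) _ (by omega) hij
      omega
    · change M.tr _ = _
      rw [← h3, ← Function.iterate_add_apply]
      rw [← hmod (3 + _)]
      congr 1
      interval_cases i <;> rfl
    · rw [← Function.iterate_succ_apply' M.U, ← hmod (Nat.succ _)]
      congr 1
      interval_cases i <;> rfl
  obtain ⟨nm, h⟩ := block (Config.Good.base M) he (unnamed_base M he)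
  have hg := h.toSt (fun f hf => by
    by_contra hne
    obtain ⟨nm', h'⟩ := block h hne hf
    exact absurd h'.k15 (by decide))
  obtain ⟨T, hT, -⟩ := exists_realizes (by norm_num) run_certNine
    ⟨_, List.mem_singleton_self _, nm, hg⟩
  exact absurd hT List.not_mem_nil

theorem false_of_order_four (M : Model X 4) (hu3 : ∀ e, M.U (M.U (M.U e)) = e) {e : X}
    (he : M.tr (M.tr e) ≠ e) (hue : ∀ r, M.U e ≠ M.tr^[r] e) : False := by
  have hex : M.op e M.x ≠ e := by
    intro h
    have h1 : M.tr e = e := h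
    exact he (by rw [h1, h1])
  have h0 := (Config.Good.base M).addCycles (unnamed_base M hex) (by norm_num) (by
    intro i hi j hj hij
    have hp : Function.minimalPeriod M.tr e = 4 := by
      have hd := Function.IsPeriodicPt.minimalPeriod_dvd (M.tr_pow e)
      have h2 : ¬ Function.minimalPeriod M.tr e ∣ 2 := fun h =>
        he ((Function.isPeriodicPt_iff_minimalPeriod_dvd (f := M.tr) (x := e)).2 h)
      obtain ⟨m, hm, h⟩ := (Nat.dvd_prime_pow Nat.prime_two (m := 2)).1 hd
      interval_cases m
      · rw [h] at h2; exact absurd (by norm_num) h2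
      · rw [h] at h2; exact absurd (by norm_num) h2
      · exact h
    exact Function.iterate_injOn_Iio_minimalPeriod (by rw [hp]; exact hi) (by rw [hp]; exact hj)
      hij) hue (hu3 e)
  have hk : (Config.base.addCycles 4).t.length = 13 := by decide
  generalize (fun a => if a ≤ Config.base.t.length then M.x else
    M.U^[(a - Config.base.t.length - 1) / 4] (M.tr^[(a - Config.base.t.length - 1) % 4] e)) = nm
    at h0
  have three : ∀ f g h, (∀ a, IsName 13 a → nm a ≠ f) → (∀ a, IsName 13 a → nm a ≠ g) →
      (∀ a, IsName 13 a → nm a ≠ h) → f ≠ g → f ≠ h → g ≠ h → False := by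
    intro f g h hf hg hh h1 h2 h3
    have ext : ∀ {k : ℕ} {nm : ℕ → X} {e : X},
        (∀ a b, IsName k a → IsName k b → nm a = nm b → a = b) → (∀ a, IsName k a → nm a ≠ e) →
        ∀ a b, IsName (k + 1) a → IsName (k + 1) b → extendName nm k e a = extendName nm k e b →
          a = b := by
      intro k nm e hi he a b ha hb hab
      have ha2 := ha.2
      have hb2 := hb.2
      by_cases ha' : a = k + 1 <;> by_cases hb' : b = k + 1
      · omega
      · rw [ha', extendName_self, extendName_of_le (by omega)] at hab
        exact absurd hab.symm (he b ⟨hb.1, by omega⟩)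
      · rw [hb', extendName_self, extendName_of_le (by omega)] at hab
        exact absurd hab (he a ⟨ha.1, by omega⟩)
      · rw [extendName_of_le (by omega), extendName_of_le (by omega)] at hab
        exact hi a b ⟨ha.1, by omega⟩ ⟨hb.1, by omega⟩ hab
    have := card_names_le (ext (ext (ext (hk ▸ h0.inj) hf) (extendName_ne hg h1))
      (extendName_ne (extendName_ne hh h2) h3)) M
    omega
  have ut : ∀ {f}, (∀ a, IsName 13 a → nm a ≠ f) → ∀ a, IsName 13 a → nm a ≠ M.tr f := by
    intro f hf
    rw [← hk] at hf ⊢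
    exact unnamed_of_injective M.tr_inj h0.inj (fun a ha => ⟨_, (h0.t a ha).1, (h0.t a ha).2⟩) hf
  have uu : ∀ {f}, (∀ a, IsName 13 a → nm a ≠ f) → ∀ a, IsName 13 a → nm a ≠ M.U f := by
    intro f hf
    rw [← hk] at hf ⊢
    exact unnamed_of_injective M.U_inj h0.inj (fun a ha => ⟨_, (h0.u a ha).1, (h0.u a ha).2⟩) hf
  have key : ∃ s ∈ [(Config.base.addCycles 4).toSt, ((Config.base.addCycles 4).addPair).toSt],
      ∃ nm, Good M nm s := by
    by_cases hl : ∀ f, (∀ a, IsName 13 a → nm a ≠ f) → M.op f M.x = f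
    · exact ⟨_, List.mem_cons_self, nm, h0.toSt (hk.symm ▸ hl)⟩
    · push Not at hl
      obtain ⟨f, hf, hfx⟩ := hl
      have hfx' : M.tr f ≠ f := hfx
      have htt : M.tr (M.tr f) = f := by
        by_contra hne
        exact three f _ _ hf (ut hf) (ut (ut hf)) hfx'.symm (Ne.symm hne)
          (fun h => hfx' (M.tr_inj h).symm)
      have hUf : M.U f = f := by
        by_contra hne
        by_cases h1 : M.U f = M.tr f
        · have := hu3 f
          rw [h1, M.U_tr, h1, htt, h1] at this
          exact hfx' this
        · exact three f _ _ hf (ut hf) (uu hf) hfx'.symm (Ne.symm hne) (Ne.symm h1)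
      have h1 := h0.append (m := 2) (g := fun i => M.tr^[i] f) (tb := fun i => (i + 1) % 2)
        (ub := fun i => i) (by
          intro i hi
          rw [hk]
          interval_cases i
          · exact hf
          · exact ut hf) (by
          intro i hi j hj hij
          interval_cases i <;> interval_cases j
          · rfl
          · exact absurd hij.symm hfx'
          · exact absurd hij hfx'
          · rfl) (by
          intro i hi
          refine ⟨by omega, ?_⟩
          interval_cases i
          · rfl
          · exact htt) (by
          intro i hi
          refine ⟨hi, ?_⟩
          rw [M.U_tr_iterate, hUf])
      refine ⟨_, List.mem_cons_of_mem _ (List.mem_singleton_self _), _, h1.toSt ?_⟩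
      intro g hg
      obtain ⟨a, ha, h⟩ := mem_names_of_fifteen M h1.inj g
      exact absurd h (hg a ha)
  obtain ⟨T, hT, -⟩ := exists_realizes (by norm_num) run_certFour key
  exact absurd hT List.not_mem_nil

end RigQuandle.Search

namespace RigQuandle.Search

variable {X : Type*} {q : ℕ}

/-- The operation of the model is that of conjugation on the subset `S` of a group. -/
def Represents (M : Model X q) {K : Type*} [Group K] (S : Set K) : Prop :=
  ∃ θ : X → K, Function.Injective θ ∧ Set.range θ = S ∧
    ∀ a b, θ (M.op a b) = θ b * θ a * (θ b)⁻¹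

theorem Realizes.represents {M : Model X q} {T : ℕ} (h : Realizes M T) {K : Type*} [Group K]
    [DecidableEq K] {S : Set K} {n : ℕ} (lab : List K) (hlen : lab.length = n + 1)
    (hend : n + 1 = 15 ∨ n + 1 < 15 ∧ get T (n + 2) 1 = 0) (hnodup : lab.Nodup)
    (hS : ∀ s, s ∈ S ↔ s ∈ lab)
    (hT : ∀ a < n + 1, ∀ b < n + 1, get T (a + 1) (b + 1) ≠ 0 ∧
      lab.getD (get T (a + 1) (b + 1) - 1) 1 = lab.getD b 1 * lab.getD a 1 * (lab.getD b 1)⁻¹) :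
    Represents M S := by
  obtain ⟨nm, k, hk1, hk15, hcol, hinj, hsurj, hfacts⟩ := h
  have hk : k = n + 1 := by
    have h1 : k ≤ n + 1 := by
      by_contra hlt
      rcases hend with h | ⟨h, h'⟩
      · omega
      · exact hcol (n + 2) ⟨by omega, by omega⟩ h'
    have h2 := (hfacts (n + 1) 1 (by omega) (by omega) (hT n (by omega) 0 (by omega)).1).1.2
    omega
  subst hk
  choose name hname hnm using hsurj
  have hlt : ∀ e, name e - 1 < lab.length := by
    intro e
    have := (hname e).1
    have := (hname e).2
    omega
  refine ⟨fun e => lab.getD (name e - 1) 1, fun e f hef => ?_, ?_, fun e f => ?_⟩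
  · simp only [List.getD_eq_getElem _ _ (hlt _)] at hef
    have h1 := (List.Nodup.getElem_inj_iff hnodup).1 hef
    have h2 := (hname e).1
    have h3 := (hname f).1
    rw [← hnm e, ← hnm f]
    congr 1
    omega
  · ext s
    rw [hS]
    constructor
    · rintro ⟨e, rfl⟩
      simp only
      rw [List.getD_eq_getElem _ _ (hlt _)]
      exact List.getElem_mem _
    · intro hs
      obtain ⟨i, hi, rfl⟩ := List.getElem_of_mem hs
      have hn : IsName (n + 1) (i + 1) := ⟨by omega, by omega⟩
      refine ⟨nm (i + 1), ?_⟩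
      have : name (nm (i + 1)) = i + 1 := hinj _ _ (hname _) hn (hnm _)
      simp only [this, Nat.add_sub_cancel]
      exact List.getD_eq_getElem _ _ hi
  · obtain ⟨e1, e2⟩ := hname e
    obtain ⟨f1, f2⟩ := hname f
    obtain ⟨h1, h2⟩ := hT (name e - 1) (by omega) (name f - 1) (by omega)
    rw [Nat.sub_add_cancel e1, Nat.sub_add_cancel f1] at h1 h2
    obtain ⟨-, -, h3, h4⟩ := hfacts _ _ (by omega) (by omega) h1
    rw [hnm, hnm] at h4
    have : name (M.op e f) = get T (name e) (name f) :=
      hinj _ _ (hname _) h3 ((hnm _).trans h4)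
    simp only
    rw [this, h2]

/-- Transpositions from pairs of letters. -/
def swaps {n : ℕ} (l : List (Fin n × Fin n)) : List (Equiv.Perm (Fin n)) :=
  l.map fun p => Equiv.swap p.1 p.2

theorem mem_swaps_iff {n : ℕ} {l : List (Fin n × Fin n)} (h1 : ∀ p ∈ l, p.1 ≠ p.2)
    (h2 : ∀ i j : Fin n, i ≠ j → (i, j) ∈ l ∨ (j, i) ∈ l) (s : Equiv.Perm (Fin n)) :
    s ∈ (transpositions n).carrier ↔ s ∈ swaps l := by
  constructor
  · rintro ⟨i, j, hij, rfl⟩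
    rcases h2 i j hij with h | h
    · exact List.mem_map.2 ⟨_, h, rfl⟩
    · exact List.mem_map.2 ⟨_, h, Equiv.swap_comm _ _⟩
  · intro h
    obtain ⟨p, hp, rfl⟩ := List.mem_map.1 h
    exact ⟨p.1, p.2, h1 p hp, rfl⟩

/-- The transvection with direction `d` through the point `r`. -/
def transvection (d r : Plane) : Equiv.Perm Plane where
  toFun x := x + area d (x - r) • d
  invFun x := x - area d (x - r) • d
  left_inv x := by
    ext <;> simp only [area, Prod.fst_add, Prod.snd_add, Prod.fst_sub, Prod.snd_sub,
      Prod.smul_fst, Prod.smul_snd, smul_eq_mul] <;> ring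
  right_inv x := by
    ext <;> simp only [area, Prod.fst_add, Prod.snd_add, Prod.fst_sub, Prod.snd_sub,
      Prod.smul_fst, Prod.smul_snd, smul_eq_mul] <;> ring

theorem mem_transvections_iff {l : List (Plane × Plane)} (h1 : ∀ p ∈ l, p.1 ≠ 0)
    (h2 : ∀ d r : Plane, d ≠ 0 → transvection d r ∈ l.map fun p => transvection p.1 p.2)
    (s : Equiv.Perm Plane) :
    s ∈ transvections.carrier ↔ s ∈ l.map fun p => transvection p.1 p.2 := by
  constructor
  · rintro ⟨d, r, hd, hs⟩
    rw [show s = transvection d r from Equiv.ext hs]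
    exact h2 d r hd
  · intro h
    obtain ⟨p, hp, rfl⟩ := List.mem_map.1 h
    exact ⟨p.1, p.2, h1 p hp, fun _ => rfl⟩

theorem represents_of_mem_targetsTwo {M : Model X q} {T : ℕ} (hT : T ∈ targetsTwo)
    (h : Realizes M T) :
    Represents M (transpositions 5).carrier ∨ Represents M (transpositions 6).carrier := by
  simp only [targetsTwo, List.mem_cons, List.not_mem_nil, or_false] at hT
  rcases hT with rfl | rfl | rfl
  · left
    refine h.represents (n := 9) (swaps [(0, 1), (0, 2), (1, 2), (0, 3), (1, 3), (0, 4), (1, 4),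
      (2, 3), (3, 4), (2, 4)]) rfl (by decide) (by decide +kernel)
      (mem_swaps_iff (by decide) (by decide)) (by decide +kernel)
  · right
    refine h.represents (n := 14) (swaps [(0, 1), (0, 2), (1, 2), (0, 3), (1, 3), (0, 4), (1, 4),
      (1, 5), (0, 5), (2, 5), (3, 5), (4, 5), (2, 3), (3, 4), (2, 4)]) rfl (by decide)
      (by decide +kernel) (mem_swaps_iff (by decide) (by decide)) (by decide +kernel)
  · right
    refine h.represents (n := 14) (swaps [(0, 1), (0, 2), (1, 2), (0, 3), (1, 3), (0, 4), (1, 4),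
      (0, 5), (1, 5), (2, 5), (3, 5), (4, 5), (2, 3), (3, 4), (2, 4)]) rfl (by decide)
      (by decide +kernel) (mem_swaps_iff (by decide) (by decide)) (by decide +kernel)

theorem represents_of_mem_targetsThree {M : Model X q} {T : ℕ} (hT : T ∈ targetsThree)
    (h : Realizes M T) : Represents M transvections.carrier := by
  simp only [targetsThree, List.mem_cons, List.not_mem_nil, or_false] at hT
  rcases hT with rfl | rfl | rfl
  · exact h.represents (n := 11) _ rfl (by decide) (by decide +kernel)
      (mem_transvections_iff (l := [((0, 1), (0, 0)), ((1, 0), (0, 0)), ((1, 2), (0, 0)),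
        ((1, 1), (0, 0)), ((1, 0), (0, 1)), ((1, 2), (0, 1)), ((1, 1), (0, 1)), ((1, 0), (0, 2)),
        ((1, 2), (0, 2)), ((1, 1), (0, 2)), ((0, 1), (2, 0)), ((0, 1), (1, 0))])
        (by decide +kernel) (by decide +kernel)) (by decide +kernel)
  · exact h.represents (n := 11) _ rfl (by decide) (by decide +kernel)
      (mem_transvections_iff (l := [((0, 1), (0, 0)), ((1, 0), (0, 0)), ((1, 2), (0, 0)),
        ((1, 1), (0, 0)), ((1, 2), (0, 1)), ((1, 1), (0, 1)), ((1, 0), (0, 1)), ((1, 1), (0, 2)),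
        ((1, 0), (0, 2)), ((1, 2), (0, 2)), ((0, 1), (2, 0)), ((0, 1), (1, 0))])
        (by decide +kernel) (by decide +kernel)) (by decide +kernel)
  · exact h.represents (n := 11) _ rfl (by decide) (by decide +kernel)
      (mem_transvections_iff (l := [((0, 1), (0, 0)), ((1, 0), (0, 0)), ((1, 2), (0, 0)),
        ((1, 1), (0, 0)), ((1, 1), (0, 1)), ((1, 0), (0, 1)), ((1, 2), (0, 1)), ((1, 2), (0, 2)),
        ((1, 1), (0, 2)), ((1, 0), (0, 2)), ((0, 1), (2, 0)), ((0, 1), (1, 0))])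
        (by decide +kernel) (by decide +kernel)) (by decide +kernel)

end RigQuandle.Search

namespace RigQuandle

section Orbits

variable {G X : Type*} [Group G] [MulAction G X] {t u : G} {a b c : X}

/-- `a` and `b` lie in the same orbit of the cyclic group generated by `t`. -/
def SameCycle (t : G) (a b : X) : Prop := ∃ i : ℤ, t ^ i • a = b

theorem SameCycle.symm (h : SameCycle t a b) : SameCycle t b a := by
  obtain ⟨i, rfl⟩ := h
  exact ⟨-i, by rw [← mul_smul, ← zpow_add]; simp⟩

theorem SameCycle.trans (h : SameCycle t a b) (h' : SameCycle t b c) : SameCycle t a c := by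
  obtain ⟨i, rfl⟩ := h
  obtain ⟨j, rfl⟩ := h'
  exact ⟨j + i, by rw [zpow_add, mul_smul]⟩

theorem SameCycle.smul (hu : Commute u t) (h : SameCycle t a b) :
    SameCycle t (u • a) (u • b) := by
  obtain ⟨i, rfl⟩ := h
  exact ⟨i, by rw [← mul_smul, ← mul_smul, (hu.zpow_right i).eq]⟩

theorem SameCycle.of_smul (hu : Commute u t) (h : SameCycle t (u • a) (u • b)) :
    SameCycle t a b := by
  have := h.smul hu.inv_left
  rwa [inv_smul_smul, inv_smul_smul] at this

theorem period_smul_of_commute (hu : Commute u t) (a : X) :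
    MulAction.period t (u • a) = MulAction.period t a := by
  have key : ∀ n : ℕ, t ^ n • u • a = u • a ↔ t ^ n • a = a := by
    intro n
    rw [← mul_smul, ← (hu.pow_right n).eq, mul_smul]
    exact (MulAction.injective u).eq_iff
  apply Nat.dvd_antisymm
  · rw [← MulAction.pow_smul_eq_iff_period_dvd, key]
    exact MulAction.pow_period_smul t a
  · rw [← MulAction.pow_smul_eq_iff_period_dvd, ← key]
    exact MulAction.pow_period_smul t _

theorem SameCycle.period_eq (h : SameCycle t a b) :
    MulAction.period t a = MulAction.period t b := by
  obtain ⟨i, rfl⟩ := h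
  exact (period_smul_of_commute ((Commute.refl t).zpow_left i) a).symm

theorem period_pos [Finite G] (t : G) (a : X) : 0 < MulAction.period t a :=
  MulAction.period_pos_of_orderOf_pos (orderOf_pos t) a

/-- Different cycles are disjoint. -/
theorem sum_period_le_card [Finite G] [Finite X] (t : G) (l : List X)
    (hl : l.Pairwise fun a b => ¬ SameCycle t a b) :
    (l.map (MulAction.period t)).sum ≤ Nat.card X := by
  classical
  have := Fintype.ofFinite X
  suffices ∃ s : Finset X, s.card = (l.map (MulAction.period t)).sum ∧
      ∀ b ∈ s, ∃ a ∈ l, SameCycle t a b by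
    obtain ⟨s, hs, -⟩ := this
    rw [← hs, Nat.card_eq_fintype_card]
    exact s.card_le_univ
  induction l with
  | nil => exact ⟨∅, rfl, by simp⟩
  | cons a l ih =>
    rw [List.pairwise_cons] at hl
    obtain ⟨s, hs, hs'⟩ := ih hl.2
    set o := (Finset.range (MulAction.period t a)).image fun i => t ^ i • a with ho
    have hoc : o.card = MulAction.period t a := by
      rw [ho, Finset.card_image_of_injOn, Finset.card_range]
      intro i hi j hj hij
      simp only [Finset.coe_range, Set.mem_Iio] at hi hj
      wlog hle : i ≤ j generalizing i j
      · exact (this hij.symm hj hi (by omega)).symm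
      obtain ⟨k, rfl⟩ := Nat.exists_eq_add_of_le hle
      simp only [pow_add, mul_smul] at hij
      have h1 : t ^ k • a = a := (MulAction.injective _ hij).symm
      have h2 := Nat.eq_zero_of_dvd_of_lt (MulAction.pow_smul_eq_iff_period_dvd.1 h1) (by omega)
      omega
    have hom : ∀ b ∈ o, SameCycle t a b := by
      intro b hb
      obtain ⟨i, -, rfl⟩ := Finset.mem_image.1 hb
      exact ⟨i, by rw [zpow_natCast]⟩
    refine ⟨o ∪ s, ?_, fun b hb => ?_⟩
    · rw [Finset.card_union_of_disjoint, hoc, hs, List.map_cons, List.sum_cons]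
      rw [Finset.disjoint_left]
      intro b hb hbs
      obtain ⟨c, hc, hcb⟩ := hs' b hbs
      exact hl.1 c hc ((hom b hb).trans hcb.symm)
    · rcases Finset.mem_union.1 hb with hb | hb
      · exact ⟨a, List.mem_cons_self, hom b hb⟩
      · obtain ⟨c, hc, hcb⟩ := hs' b hb
        exact ⟨c, List.mem_cons_of_mem _ hc, hcb⟩

theorem zpow_pow_smul_eq {i : ℤ} (hu : Commute u t) (hi : t ^ i • a = u • a) (n : ℕ) :
    (t ^ i) ^ n • a = u ^ n • a := by
  induction n with
  | zero => simp
  | succ n ih =>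
    rw [pow_succ, mul_smul, hi, ← mul_smul, ← ((hu.zpow_right i).pow_right n).eq, mul_smul, ih,
      ← mul_smul, ← pow_succ']

/-- A `p`-element commuting with `t` which moves a point inside its cycle. -/
theorem dvd_period_of_sameCycle {p b : ℕ} (hp : p.Prime) (hu : Commute u t) (hub : u ^ p ^ b = 1)
    (h : SameCycle t a (u • a)) (hne : u • a ≠ a) : p ∣ MulAction.period t a := by
  by_contra hnd
  obtain ⟨i, hi⟩ := h
  have hpow := zpow_pow_smul_eq hu hi
  have h1 : u ^ MulAction.period t a • a = a := by
    rw [← hpow, ← zpow_natCast, ← zpow_mul]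
    exact MulAction.zpow_smul_eq_iff_period_dvd.2 (Dvd.intro_left _ rfl)
  have h2 : MulAction.period u a ∣ MulAction.period t a :=
    MulAction.pow_smul_eq_iff_period_dvd.1 h1
  have h3 : MulAction.period u a ∣ p ^ b :=
    MulAction.pow_smul_eq_iff_period_dvd.1 (by rw [hub, one_smul])
  have h4 : MulAction.period u a = 1 := by
    have hc : Nat.Coprime (MulAction.period t a) (p ^ b) :=
      Nat.Coprime.pow_right _ ((Nat.Prime.coprime_iff_not_dvd hp).2 hnd).symm
    exact Nat.eq_one_of_dvd_coprimes hc h2 h3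
  exact hne (MulAction.period_eq_one_iff.1 h4)

end Orbits

section ConjClass

variable {G : Type*} [Group G]

/-- The conjugates of `t`. -/
def Conjugates (t : G) : Type _ := {g : G // IsConj t g}

instance (t : G) [Finite G] : Finite (Conjugates t) :=
  inferInstanceAs (Finite {g : G // IsConj t g})

instance (t : G) : MulAction G (Conjugates t) where
  smul g z := ⟨g * z.1 * g⁻¹, z.2.trans (isConj_iff.2 ⟨g, rfl⟩)⟩
  one_smul z := Subtype.ext (show 1 * z.1 * 1⁻¹ = z.1 by simp)
  mul_smul g h z := Subtype.ext (show g * h * z.1 * (g * h)⁻¹ = g * (h * z.1 * h⁻¹) * g⁻¹ by group)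

variable {t : G}

theorem Conjugates.smul_val (g : G) (z : Conjugates t) : (g • z).1 = g * z.1 * g⁻¹ := rfl

theorem Conjugates.smul_eq_iff {g : G} {z : Conjugates t} : g • z = z ↔ Commute g z.1 := by
  constructor
  · intro h
    have := congrArg Subtype.val h
    rw [Conjugates.smul_val, mul_inv_eq_iff_eq_mul] at this
    exact this
  · intro h
    exact Subtype.ext (by rw [Conjugates.smul_val, h.eq, mul_inv_cancel_right])

/-- The element `t` as one of its conjugates. -/
def Conjugates.base (t : G) : Conjugates t := ⟨t, IsConj.refl t⟩

theorem Conjugates.exists_smul (z : Conjugates t) : ∃ g : G, g • Conjugates.base t = z := by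
  obtain ⟨g, hg⟩ := isConj_iff.1 z.2
  exact ⟨g, Subtype.ext hg⟩

/-- A group without centre, generated by the conjugates of one element. -/
structure IsGenClass (t : G) : Prop where
  gen : Subgroup.closure {z | IsConj t z} = ⊤
  center : ∀ z : G, (∀ g, Commute z g) → z = 1

theorem eq_top_induction [Finite G] {S : Set G} (hS : Subgroup.closure S = ⊤) {P : G → Prop}
    (h1 : P 1) (hmul : ∀ g h, P g → P h → P (g * h)) (hP : ∀ g ∈ S, P g) (g : G) : P g := by
  have hg : g ∈ Submonoid.closure S := by
    rw [← Subgroup.closure_toSubmonoid_of_finite, hS]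
    exact Subgroup.mem_top g
  exact Submonoid.closure_induction (motive := fun g _ => P g) hP h1 (fun g h _ _ => hmul g h) hg

namespace IsGenClass

variable [Finite G] (h : IsGenClass t)
include h

omit [Finite G] in
theorem eq_one_of_commute {w : G} (hw : ∀ z : Conjugates t, w • z = z) : w = 1 := by
  refine h.center w fun g => ?_
  have hg : g ∈ Subgroup.closure {z | IsConj t z} := by rw [h.gen]; exact Subgroup.mem_top g
  have hle : Subgroup.closure {z | IsConj t z} ≤ Subgroup.centralizer {w} := by
    rw [Subgroup.closure_le]
    intro z hz
    exact Subgroup.mem_centralizer_singleton_iff.2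
      (Conjugates.smul_eq_iff.1 (hw ⟨z, hz⟩)).eq.symm
  exact (Subgroup.mem_centralizer_singleton_iff.1 (hle hg)).symm

/-- The conjugates that do not commute with a given non-trivial element generate the group. -/
theorem closure_moved {w : G} (hw : w ≠ 1) :
    Subgroup.closure {z | IsConj t z ∧ ¬ Commute w z} = ⊤ := by
  set Q := Subgroup.closure {z | IsConj t z ∧ ¬ Commute w z} with hQ
  have hn : ∀ y, IsConj t y → ∀ z ∈ Q, y * z * y⁻¹ ∈ Q := by
    intro y hy z hz
    by_cases hwy : Commute w y
    · have hle : Q ≤ Q.comap (MulAut.conj y).toMonoidHom := by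
        rw [hQ, Subgroup.closure_le, ← hQ]
        rintro z ⟨hz, hwz⟩
        refine Subgroup.subset_closure ⟨hz.trans (isConj_iff.2 ⟨y, rfl⟩), fun hc => hwz ?_⟩
        change Commute w (y * z * y⁻¹) at hc
        have := (hwy.inv_right.mul_right hc).mul_right hwy
        simpa [mul_assoc] using this
      exact hle hz
    · have hyQ : y ∈ Q := Subgroup.subset_closure ⟨hy, hwy⟩
      exact Q.mul_mem (Q.mul_mem hyQ hz) (Q.inv_mem hyQ)
  have hnormal : ∀ g, ∀ z ∈ Q, g * z * g⁻¹ ∈ Q := by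
    refine eq_top_induction h.gen (fun z hz => by simpa using hz) (fun g k hg hk z hz => ?_) hn
    have := hg _ (hk z hz)
    simpa [mul_assoc] using this
  rw [eq_top_iff, ← h.gen, Subgroup.closure_le]
  intro y hy
  by_contra hyQ
  refine hw (h.eq_one_of_commute fun z => Conjugates.smul_eq_iff.2 ?_)
  obtain ⟨g, hg⟩ := isConj_iff.1 ((IsConj.symm hy).trans z.2)
  by_contra hc
  have h1 : g * y * g⁻¹ ∈ Q := by rw [hg]; exact Subgroup.subset_closure ⟨z.2, hc⟩
  have h2 := hnormal g⁻¹ _ h1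
  apply hyQ
  simpa [mul_assoc] using h2

/-- An element which fixes all conjugates of `t` moved by a non-trivial element is trivial. -/
theorem eq_one_of_fix_moved {w g : G} (hw : w ≠ 1)
    (hg : ∀ z : Conjugates t, w • z ≠ z → g • z = z) : g = 1 := by
  refine h.center g fun k => ?_
  have hle : Subgroup.closure {z | IsConj t z ∧ ¬ Commute w z} ≤ Subgroup.centralizer {g} := by
    rw [Subgroup.closure_le]
    rintro z ⟨hz, hwz⟩
    exact Subgroup.mem_centralizer_singleton_iff.2 (Conjugates.smul_eq_iff.1 (hg ⟨z, hz⟩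
      fun he => hwz (Conjugates.smul_eq_iff.1 he))).eq.symm
  rw [h.closure_moved hw] at hle
  exact (Subgroup.mem_centralizer_singleton_iff.1 (hle (Subgroup.mem_top k))).symm

theorem exists_moved {w g : G} (hw : w ≠ 1) (hg : g ≠ 1) :
    ∃ z : Conjugates t, w • z ≠ z ∧ g • z ≠ z := by
  by_contra hcon
  push Not at hcon
  exact hg (h.eq_one_of_fix_moved hw hcon)

omit [Finite G] in
theorem ne_one [Nontrivial G] : t ≠ 1 := by
  rintro rfl
  obtain ⟨g, hg⟩ := exists_ne (1 : G)
  refine hg (h.eq_one_of_commute fun z => Conjugates.smul_eq_iff.2 ?_)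
  obtain ⟨k, hk⟩ := isConj_iff.1 z.2
  rw [← hk]
  simp

/-- The search applies to the conjugates of `t`, with an element `u` commuting with `t`. -/
def model (hcard : Nat.card (Conjugates t) ≤ 15) {u : G} (hu : Commute u t) (hu1 : u ≠ 1)
    (hu3 : u ^ 3 ∈ Subgroup.zpowers t) {q : ℕ} (hq : t ^ q = 1) :
    Search.Model (Conjugates t) q where
  op a b := b.1 • a
  U a := u • a
  x := Conjugates.base t
  idem a := Conjugates.smul_eq_iff.2 (Commute.refl _)
  inj a a' b hab := MulAction.injective b.1 hab
  dist a b c := by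
    rw [← mul_smul, ← mul_smul]
    congr 1
    rw [Conjugates.smul_val, inv_mul_cancel_right]
  comm a b hab := Conjugates.smul_eq_iff.2 (Conjugates.smul_eq_iff.1 hab).symm
  pow a b := by
    have h1 : ∀ n : ℕ, (fun z : Conjugates t => b.1 • z)^[n] a = b.1 ^ n • a := by
      intro n
      induction n with
      | zero => simp
      | succ n ih => rw [Function.iterate_succ_apply', ih, pow_succ', mul_smul]
    rw [h1]
    obtain ⟨g, hg⟩ := isConj_iff.1 b.2
    rw [← hg, conj_pow, hq]
    simp
  U_op a b := by
    rw [← mul_smul, ← mul_smul, Conjugates.smul_val, inv_mul_cancel_right]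
  U_inj := MulAction.injective u
  U_x := Conjugates.smul_eq_iff.2 hu
  card f hf := by
    have := Nat.card_le_card_of_injective f hf
    rw [Nat.card_fin] at this
    omega
  gen K hx hm hK z := by
    have : Nontrivial G := ⟨u, 1, hu1⟩
    obtain ⟨g, rfl⟩ := Conjugates.exists_smul z
    refine eq_top_induction (h.closure_moved h.ne_one) (P := fun g => ∀ a ∈ K, g • a ∈ K)
      (fun a ha => by rwa [one_smul]) (fun g k hg hk a ha => ?_) ?_ g _ hx
    · rw [mul_smul]; exact hg _ (hk a ha)
    · rintro y ⟨hy, hty⟩ a ha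
      refine hK a ha ⟨y, hy⟩ (hm _ fun he => hty ?_)
      exact Conjugates.smul_eq_iff.1 he
  inv ρ hρ y hy := by
    have := eq_top_induction h.gen (P := fun g => ∀ a b : Conjugates t, ρ a b → ρ (g • a) (g • b))
      (fun a b hab => by rwa [one_smul, one_smul]) (fun g k hg hk a b hab => by
        rw [mul_smul, mul_smul]; exact hg _ _ (hk a b hab))
      (fun g hg a b hab => hρ a b ⟨g, hg⟩ hab) u _ _ hy
    rwa [Conjugates.smul_eq_iff.2 hu] at this
  conn K hx hK z := by
    obtain ⟨g, rfl⟩ := Conjugates.exists_smul z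
    refine eq_top_induction h.gen (P := fun g => ∀ a ∈ K, g • a ∈ K)
      (fun a ha => by rwa [one_smul]) (fun g k hg hk a ha => ?_)
      (fun g hg a ha => hK a ha ⟨g, hg⟩) g _ hx
    rw [mul_smul]; exact hg _ (hk a ha)
  faith y y' _ _ hyy' := by
    have := h.eq_one_of_fix_moved hu1 (g := y'.1⁻¹ * y.1) (fun z hz => by
      rw [mul_smul, hyy' z hz, inv_smul_smul])
    exact Subtype.ext (inv_mul_eq_one.1 this).symm
  faith_one y _ := by
    have : Nontrivial G := ⟨u, 1, hu1⟩
    refine h.exists_moved hu1 fun hy => h.ne_one ?_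
    have h1 := y.2
    rw [hy] at h1
    exact isConj_one_left.1 h1
  cube a ha := by
    obtain ⟨m, hm⟩ := Subgroup.mem_zpowers_iff.1 hu3
    rw [← mul_smul, ← mul_smul, ← pow_three', ← hm]
    have h1 : t ∈ MulAction.stabilizer G a := ha
    exact Subgroup.zpow_mem _ h1 m

end IsGenClass

end ConjClass

end RigQuandle

namespace RigQuandle

section Cycles

variable {G X : Type*} [Group G] [MulAction G X] {t u : G} {y z : X}

theorem SameCycle.smul_mul_zpow (h : SameCycle t z (u • z)) (hu : Commute u t) (i : ℤ) :
    SameCycle t z ((u * t ^ i) • z) := by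
  rw [(hu.zpow_right i).eq, mul_smul]
  exact h.trans ⟨i, rfl⟩

theorem SameCycle.of_smul_mul_zpow {i : ℤ} (h : SameCycle t z ((u * t ^ i) • z))
    (hu : Commute u t) : SameCycle t z (u • z) := by
  rw [(hu.zpow_right i).eq, mul_smul] at h
  exact h.trans ⟨-i, by rw [← mul_smul, ← zpow_add]; simp⟩

/-- If a prime power of `u` preserves the cycle of `y` but `u` does not, then the powers of `u`
move it to different cycles. -/
theorem pairwise_not_sameCycle {p : ℕ} (hp : p.Prime) (hu : Commute u t)
    (hup : u ^ p ∈ Subgroup.zpowers t) (hy : ¬ SameCycle t y (u • y)) :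
    ((List.range p).map fun i => u ^ i • y).Pairwise fun a b => ¬ SameCycle t a b := by
  obtain ⟨m, hm⟩ := Subgroup.mem_zpowers_iff.1 hup
  have hone : SameCycle t y ((u ^ p) • y) := ⟨m, by rw [hm]⟩
  have hmul : ∀ (v : G) (_ : Commute v t) (_ : SameCycle t y (v • y)) (n : ℕ),
      SameCycle t y ((v ^ n) • y) := by
    intro v hv hvy n
    induction n with
    | zero => exact ⟨0, by simp⟩
    | succ n ih =>
      rw [pow_succ', mul_smul]
      exact hvy.trans (ih.smul hv)
  rw [List.pairwise_map]
  refine List.pairwise_lt_range.imp_of_mem fun {i j} hi hj hij hc => hy ?_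
  rw [List.mem_range] at hj
  obtain ⟨k, rfl⟩ := Nat.exists_eq_add_of_lt hij
  rw [show i + k + 1 = i + (k + 1) by ring, pow_add, mul_smul] at hc
  have hk : SameCycle t y (u ^ (k + 1) • y) := hc.of_smul (hu.pow_left i)
  have hcop : Nat.Coprime (k + 1) p :=
    ((Nat.Prime.coprime_iff_not_dvd hp).2 fun hd => by
      have := Nat.le_of_dvd (by omega) hd
      omega).symm
  obtain ⟨a, -, ha⟩ := Nat.exists_mul_mod_eq_one_of_coprime hcop hp.one_lt
  have h1 := hmul _ (hu.pow_left _) hk a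
  have h2 := hmul _ (hu.pow_left _) hone ((k + 1) * a / p)
  rw [← pow_mul] at h1 h2
  have h3 : u ^ ((k + 1) * a) • y = u ^ (p * ((k + 1) * a / p)) • u • y := by
    rw [← mul_smul, ← pow_succ]
    congr 2
    have := Nat.div_add_mod ((k + 1) * a) p
    omega
  rw [h3] at h1
  exact (h2.symm.trans h1).of_smul (hu.pow_left _)

theorem exists_zpow_fixing [Finite G] {p b : ℕ} (hp : p.Prime) (hu : Commute u t)
    (hub : u ^ p ^ b = 1) (h : SameCycle t z (u • z)) :
    ∃ (j : ℤ) (c : ℕ), (u * t ^ j) • z = z ∧ (u * t ^ j) ^ p ^ c = 1 := by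
  obtain ⟨i, hi⟩ := h
  have hcop : Nat.Coprime (p ^ b) (orderOf t / p ^ (orderOf t).factorization p) :=
    Nat.Coprime.pow_left _ (Nat.coprime_ordCompl hp (orderOf_pos t).ne')
  obtain ⟨K, hK1, hK2⟩ := Nat.chineseRemainder hcop 1 0
  have huK : u ^ K = u := by
    conv_rhs => rw [← pow_one u]
    rw [pow_eq_pow_iff_modEq]
    exact hK1.of_dvd (orderOf_dvd_of_pow_eq_one hub)
  have htK : (t ^ K) ^ p ^ (orderOf t).factorization p = 1 := by
    rw [← pow_mul]
    apply orderOf_dvd_iff_pow_eq_one.1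
    obtain ⟨e, he⟩ := (Nat.modEq_zero_iff_dvd.1 hK2)
    refine ⟨e, ?_⟩
    conv_rhs => rw [← Nat.ordProj_mul_ordCompl_eq_self (orderOf t) p]
    rw [he]; ring
  have hpow := zpow_pow_smul_eq hu hi
  have hz := hpow K
  rw [huK] at hz
  refine ⟨-(i * K), b + (orderOf t).factorization p, ?_, ?_⟩
  · rw [(hu.zpow_right _).eq, mul_smul, ← hz, ← mul_smul, zpow_neg, zpow_mul, zpow_natCast]
    simp
  · have ht : (t ^ (-(i * K))) ^ p ^ (orderOf t).factorization p = 1 := by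
      rw [show -(i * (K : ℤ)) = K * -i by ring, zpow_mul, zpow_natCast, ← zpow_natCast, ← zpow_mul,
        mul_comm, zpow_mul, zpow_natCast, htK, one_zpow]
    rw [(hu.zpow_right _).mul_pow, pow_add, pow_mul, hub, one_pow, one_mul, mul_comm (p ^ b),
      pow_mul, ht, one_pow]

end Cycles

namespace IsGenClass

variable {G : Type*} [Group G] [Finite G] {t u : G}

/-- The point `t` is fixed by `t`, so the cycles of moved points do not exhaust the class. -/
theorem sum_period_lt_card (t : G) (l : List (Conjugates t))
    (hl : l.Pairwise fun a b => ¬ SameCycle t a b) (hm : ∀ z ∈ l, t • z ≠ z) :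
    (l.map (MulAction.period t)).sum < Nat.card (Conjugates t) := by
  have hb : t • Conjugates.base t = Conjugates.base t :=
    Conjugates.smul_eq_iff.2 (Commute.refl t)
  have := sum_period_le_card t (Conjugates.base t :: l) (List.pairwise_cons.2 ⟨fun z hz hc => ?_, hl⟩)
  · rw [List.map_cons, List.sum_cons, MulAction.period_eq_one_iff.2 hb] at this
    omega
  · have := hc.period_eq
    rw [MulAction.period_eq_one_iff.2 hb, eq_comm, MulAction.period_eq_one_iff] at this
    exact hm z hz this

theorem one_lt_period {X : Type*} [MulAction G X] {z : X} (hz : t • z ≠ z) :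
    1 < MulAction.period t z := by
  have h1 := period_pos t z
  have h2 : MulAction.period t z ≠ 1 := fun h => hz (MulAction.period_eq_one_iff.1 h)
  omega

omit [Finite G] in
theorem smul_ne_of_pow_smul_ne {X : Type*} [MulAction G X] {z : X} {d : ℕ} (hz : t ^ d • z ≠ z) :
    t • z ≠ z :=
  fun h => hz (MulAction.pow_smul_eq_iff_period_dvd.2 (by
    rw [MulAction.period_eq_one_iff.2 h]; exact one_dvd _))

variable (h : IsGenClass t)
include h

theorem mem_zpowers_of_five_le (hcard : Nat.card (Conjugates t) ≤ 9) {p b : ℕ} (hp : p.Prime)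
    (hp5 : 5 ≤ p) (hu : Commute u t) (hub : u ^ p ^ b = 1) (hup : u ^ p ∈ Subgroup.zpowers t) :
    u ∈ Subgroup.zpowers t := by
  have hK : ∀ y : Conjugates t, t • y ≠ y → SameCycle t y (u • y) := by
    intro y hy
    by_contra hc
    have h1 := sum_period_lt_card t _ (pairwise_not_sameCycle hp hu hup hc) (by
      intro z hz
      obtain ⟨i, -, rfl⟩ := List.mem_map.1 hz
      rw [← mul_smul, ← (hu.pow_left i).eq, mul_smul]
      exact fun h => hy (MulAction.injective _ h))
    rw [List.map_map] at h1
    have h2 : ((MulAction.period t) ∘ fun i : ℕ => u ^ i • y) = fun _ => MulAction.period t y :=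
      funext fun i => period_smul_of_commute (hu.pow_left i) y
    rw [h2, List.map_const', List.sum_replicate, List.length_range, smul_eq_mul] at h1
    have h3 := one_lt_period hy
    nlinarith
  by_contra hut
  have hu1 : u ≠ 1 := fun h1 => hut (h1 ▸ Subgroup.one_mem _)
  have : Nontrivial G := ⟨u, 1, hu1⟩
  obtain ⟨z, hz, huz⟩ := h.exists_moved h.ne_one hu1
  have hpz := dvd_period_of_sameCycle hp hu hub (hK z hz) huz
  obtain ⟨j, c, hj, hc⟩ := exists_zpow_fixing hp hu hub (hK z hz)
  have hwt : Commute (u * t ^ j) t := hu.mul_left ((Commute.refl t).zpow_left j)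
  have hw1 : u * t ^ j ≠ 1 := fun h1 => hut (by
    rw [mul_eq_one_iff_eq_inv.1 h1]
    exact Subgroup.inv_mem _ (Subgroup.zpow_mem _ (Subgroup.mem_zpowers t) j))
  obtain ⟨z', hz', hwz'⟩ := h.exists_moved h.ne_one hw1
  have hpz' := dvd_period_of_sameCycle hp hwt hc ((hK z' hz').smul_mul_zpow hu j) hwz'
  have hzz' : ¬ SameCycle t z z' := by
    rintro ⟨i, rfl⟩
    apply hwz'
    rw [← mul_smul, (hwt.zpow_right i).eq, mul_smul, hj]
  have h1 := sum_period_lt_card t [z, z'] (by simp [hzz']) (by simp [hz, hz'])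
  simp only [List.map_cons, List.map_nil, List.sum_cons, List.sum_nil] at h1
  have h2 := Nat.le_of_dvd (period_pos t z) hpz
  have h3 := Nat.le_of_dvd (period_pos t z') hpz'
  omega

end IsGenClass

end RigQuandle

namespace RigQuandle.IsGenClass

variable {G : Type*} [Group G] [Finite G] {t u : G}

theorem pairwise_append_cycles {y : Conjugates t} (hu : Commute u t)
    (hu3 : u ^ 3 ∈ Subgroup.zpowers t) (hy : ¬ SameCycle t y (u • y)) (hty : t • y ≠ y)
    (hcard : Nat.card (Conjugates t) ≤ 15) (l : List (Conjugates t))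
    (hl : l.Pairwise fun a b => ¬ SameCycle t a b) (hm : ∀ z ∈ l, t • z ≠ z)
    (hyl : ∀ z ∈ l, ∀ i : ℕ, ¬ SameCycle t (u ^ i • y) z) :
    3 * MulAction.period t y + (l.map (MulAction.period t)).sum ≤ 14 := by
  have h1 := sum_period_lt_card t (((List.range 3).map fun i => u ^ i • y) ++ l) (by
    rw [List.pairwise_append]
    refine ⟨pairwise_not_sameCycle Nat.prime_three hu hu3 hy, hl, fun a ha z hz => ?_⟩
    obtain ⟨i, -, rfl⟩ := List.mem_map.1 ha
    exact hyl z hz i) (by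
    intro z hz
    rcases List.mem_append.1 hz with hz | hz
    · obtain ⟨i, -, rfl⟩ := List.mem_map.1 hz
      rw [← mul_smul, ← (hu.pow_left i).eq, mul_smul]
      exact fun h => hty (MulAction.injective _ h)
    · exact hm z hz)
  rw [List.map_append, List.sum_append, List.map_map] at h1
  have h2 : ((MulAction.period t) ∘ fun i : ℕ => u ^ i • y) = fun _ => MulAction.period t y :=
    funext fun i => period_smul_of_commute (hu.pow_left i) y
  rw [h2, List.map_const', List.sum_replicate, List.length_range, smul_eq_mul] at h1
  omega

omit [Finite G] in
theorem not_sameCycle_of_pow_smul_ne {y z : Conjugates t} (hu : Commute u t)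
    (hz : t ^ MulAction.period t y • z ≠ z) (i : ℕ) : ¬ SameCycle t (u ^ i • y) z := by
  intro hc
  apply hz
  rw [MulAction.pow_smul_eq_iff_period_dvd, ← hc.period_eq, period_smul_of_commute (hu.pow_left i)]

omit [Finite G] in
theorem pow_smul_of_sameCycle {y z : Conjugates t} (h : SameCycle t y z) {n : ℕ}
    (hn : MulAction.period t y ∣ n) : t ^ n • z = z := by
  rw [MulAction.pow_smul_eq_iff_period_dvd, ← h.period_eq]
  exact hn

omit [Finite G] in
theorem smul_eq_of_sameCycle {y z : Conjugates t} (h : SameCycle t y z) {w v : G}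
    (hw : Commute w t) (hv : Commute v t) (hy : w • y = v • y) : w • z = v • z := by
  obtain ⟨i, rfl⟩ := h
  rw [← mul_smul, ← mul_smul, (hw.zpow_right i).eq, (hv.zpow_right i).eq, mul_smul, mul_smul, hy]

omit [Finite G] in
theorem smul_eq_self_of_sameCycle {y z : Conjugates t} (h : SameCycle t y z) {w : G}
    (hw : Commute w t) (hy : w • y = y) : w • z = z := by
  obtain ⟨i, rfl⟩ := h
  rw [← mul_smul, (hw.zpow_right i).eq, mul_smul, hy]

variable (h : IsGenClass t)
include h

theorem pow_period_eq_one (hcard : Nat.card (Conjugates t) ≤ 15) (hu : Commute u t)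
    (hu3 : u ^ 3 ∈ Subgroup.zpowers t) {y : Conjugates t} (hty : t • y ≠ y)
    (hy : ¬ SameCycle t y (u • y)) : t ^ MulAction.period t y = 1 := by
  by_contra htd
  set d := MulAction.period t y with hd
  have hd2 : 1 < d := one_lt_period hty
  have hS : ∀ z : Conjugates t, t ^ d • z ≠ z → ¬ MulAction.period t z ∣ d := fun z hz hdvd =>
    hz (MulAction.pow_smul_eq_iff_period_dvd.2 hdvd)
  have bound := pairwise_append_cycles hu hu3 hy hty hcard
  rw [← hd] at bound
  have hK : ∀ z : Conjugates t, t ^ d • z ≠ z → SameCycle t z (u • z) := by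
    intro z hz
    by_contra hc
    have hp := hS z hz
    have h1 := bound ((List.range 3).map fun i => u ^ i • z)
      (pairwise_not_sameCycle Nat.prime_three hu hu3 hc) (by
        intro a ha
        obtain ⟨i, -, rfl⟩ := List.mem_map.1 ha
        rw [← mul_smul, ← (hu.pow_left i).eq, mul_smul]
        exact fun h => smul_ne_of_pow_smul_ne hz (MulAction.injective _ h)) (by
        intro a ha j hj
        obtain ⟨i, -, rfl⟩ := List.mem_map.1 ha
        refine not_sameCycle_of_pow_smul_ne hu ?_ j hj
        rw [← hd, ← mul_smul, ← ((hu.pow_left i).pow_right d).eq, mul_smul]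
        exact fun h => hz (MulAction.injective _ h))
    rw [List.map_map] at h1
    have h2 : ((MulAction.period t) ∘ fun i : ℕ => u ^ i • z) = fun _ => MulAction.period t z :=
      funext fun i => period_smul_of_commute (hu.pow_left i) z
    rw [h2, List.map_const', List.sum_replicate, List.length_range, smul_eq_mul] at h1
    have h3 := one_lt_period (smul_ne_of_pow_smul_ne hz)
    have h4 : MulAction.period t z = d := by omega
    exact hp (h4 ▸ dvd_rfl)
  have bound2 : ∀ z z' : Conjugates t, t ^ d • z ≠ z → t ^ d • z' ≠ z' → ¬ SameCycle t z z' →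
      3 * d + (MulAction.period t z + MulAction.period t z') ≤ 14 := by
    intro z z' hz hz' hzz'
    have := bound [z, z'] (by simp [hzz'])
      (by simp [smul_ne_of_pow_smul_ne hz, smul_ne_of_pow_smul_ne hz'])
      (by simp [not_sameCycle_of_pow_smul_ne hu hz, not_sameCycle_of_pow_smul_ne hu hz'])
    simpa using this
  have bound3 : ∀ z z' z'' : Conjugates t, t ^ d • z ≠ z → t ^ d • z' ≠ z' → t ^ d • z'' ≠ z'' →
      ¬ SameCycle t z z' → ¬ SameCycle t z z'' → ¬ SameCycle t z' z'' →
      3 * d + (MulAction.period t z + (MulAction.period t z' + MulAction.period t z'')) ≤ 14 := by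
    intro z z' z'' hz hz' hz'' h1 h2 h3
    have := bound [z, z', z''] (by simp [h1, h2, h3])
      (by simp [smul_ne_of_pow_smul_ne hz, smul_ne_of_pow_smul_ne hz',
        smul_ne_of_pow_smul_ne hz''])
      (by simp [not_sameCycle_of_pow_smul_ne hu hz, not_sameCycle_of_pow_smul_ne hu hz',
        not_sameCycle_of_pow_smul_ne hu hz''])
    simpa using this
  have twist : ∀ z : Conjugates t, t ^ d • z ≠ z → ∃ i : ℤ, u * t ^ i ≠ 1 ∧
      (u * t ^ i) • z = z := by
    intro z hz
    obtain ⟨i, hi⟩ := hK z hz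
    refine ⟨-i, fun h1 => hy ⟨i, ?_⟩, ?_⟩
    · rw [zpow_neg, mul_inv_eq_one] at h1
      rw [h1]
    · rw [(hu.zpow_right _).eq, mul_smul, ← hi, ← mul_smul, ← zpow_add]
      simp
  have hcomm : ∀ i : ℤ, Commute (u * t ^ i) t := fun i =>
    hu.mul_left ((Commute.refl t).zpow_left i)
  obtain ⟨z, hz, -⟩ := h.exists_moved htd htd
  obtain ⟨i, hi1, hiz⟩ := twist z hz
  obtain ⟨z', hz', hiz'⟩ := h.exists_moved htd hi1
  have hzz' : ¬ SameCycle t z z' := fun hc => hiz' (smul_eq_self_of_sameCycle hc (hcomm i) hiz)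
  obtain ⟨i', hi1', hiz''⟩ := twist z' hz'
  have hp := hS z hz
  have hp' := hS z' hz'
  have hb := bound2 z z' hz hz' hzz'
  have hpos := one_lt_period (smul_ne_of_pow_smul_ne hz)
  have hpos' := one_lt_period (smul_ne_of_pow_smul_ne hz')
  have hlt : ∀ z : Conjugates t, t ^ d • z ≠ z → 1 < MulAction.period t z := fun z hz =>
    one_lt_period (smul_ne_of_pow_smul_ne hz)
  have hdy : ∀ n : ℕ, t ^ n = 1 → d ∣ n := fun n hn =>
    MulAction.pow_smul_eq_iff_period_dvd.1 (by rw [hn, one_smul])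
  clear_value d
  have hd4 : d ≤ 3 := by omega
  interval_cases d
  · have hp3 : ∀ z : Conjugates t, t ^ 2 • z ≠ z → 3 ≤ MulAction.period t z := by
      intro z hz
      have h1 := hS z hz
      have h2 := hlt z hz
      by_contra h3
      exact h1 (by rw [show MulAction.period t z = 2 by omega])
    have hall : ∀ z'', t ^ 2 • z'' ≠ z'' → SameCycle t z z'' ∨ SameCycle t z' z'' := by
      intro z'' hz''
      by_contra! hc
      have := bound3 z z' z'' hz hz' hz'' hzz' hc.1 hc.2
      have := hp3 _ hz
      have := hp3 _ hz'
      have := hp3 _ hz''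
      omega
    have h2 : t ^ (2 * MulAction.period t z') = 1 := by
      by_contra hne
      obtain ⟨z'', h1, h2⟩ := h.exists_moved hne hi1
      have h3 : t ^ 2 • z'' ≠ z'' := fun h3 => h1 (by
        rw [MulAction.pow_smul_eq_iff_period_dvd] at h3 ⊢
        exact h3.mul_right _)
      rcases hall z'' h3 with hc | hc
      · exact h2 (smul_eq_self_of_sameCycle hc (hcomm i) hiz)
      · exact h1 (pow_smul_of_sameCycle hc (Dvd.intro_left _ rfl))
    have h2' : t ^ (2 * MulAction.period t z) = 1 := by
      by_contra hne
      obtain ⟨z'', h1, h2⟩ := h.exists_moved hne hi1'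
      have h3 : t ^ 2 • z'' ≠ z'' := fun h3 => h1 (by
        rw [MulAction.pow_smul_eq_iff_period_dvd] at h3 ⊢
        exact h3.mul_right _)
      rcases hall z'' h3 with hc | hc
      · exact h1 (pow_smul_of_sameCycle hc (Dvd.intro_left _ rfl))
      · exact h2 (smul_eq_self_of_sameCycle hc (hcomm i') hiz'')
    have h4 : MulAction.period t z ∣ 2 * MulAction.period t z' :=
      MulAction.pow_smul_eq_iff_period_dvd.1 (by rw [h2, one_smul])
    have h4' : MulAction.period t z' ∣ 2 * MulAction.period t z :=
      MulAction.pow_smul_eq_iff_period_dvd.1 (by rw [h2', one_smul])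
    have h5 := hp3 _ hz
    have h5' := hp3 _ hz'
    have h6 : (MulAction.period t z = 3 ∧ MulAction.period t z' = 3) ∨
        (MulAction.period t z = 4 ∧ MulAction.period t z' = 4) := by
      generalize MulAction.period t z = p at *
      generalize MulAction.period t z' = p' at *
      have : p ≤ 5 := by omega
      have : p' ≤ 5 := by omega
      interval_cases p <;> interval_cases p' <;> omega
    rcases h6 with ⟨h6, h6'⟩ | ⟨h6, h6'⟩
    · have : t ^ 3 = 1 := h.eq_one_of_fix_moved htd fun z'' hz'' => by
        rcases hall z'' hz'' with hc | hc
        · exact pow_smul_of_sameCycle hc h6.dvd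
        · exact pow_smul_of_sameCycle hc h6'.dvd
      have := hdy _ this
      omega
    · obtain ⟨e, he⟩ := (hK z' hz').smul_mul_zpow hu i
      obtain ⟨m, hm⟩ := Subgroup.mem_zpowers_iff.1 hu3
      have hw3 : (u * t ^ i) ^ 3 = t ^ (m + i * 3) := by
        rw [(hu.zpow_right i).mul_pow, ← hm, zpow_add, ← zpow_natCast (t ^ i), ← zpow_mul]
        rfl
      have h7 : t ^ (m + i * 3) • z = z := by
        rw [← hw3, pow_three, mul_smul (u * t ^ i), mul_smul (u * t ^ i), hiz, hiz, hiz]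
      rw [MulAction.zpow_smul_eq_iff_period_dvd, h6] at h7
      have h8 : t ^ (e * 3) • z' = t ^ (m + i * 3) • z' := by
        rw [← hw3, ← zpow_pow_smul_eq (hcomm i) he, zpow_mul, zpow_ofNat]
      have h9 : t ^ (m + i * 3) • z' = z' := by
        rw [MulAction.zpow_smul_eq_iff_period_dvd, h6']
        exact h7
      rw [h9, MulAction.zpow_smul_eq_iff_period_dvd, h6'] at h8
      refine hiz' (he.symm.trans ?_)
      rw [MulAction.zpow_smul_eq_iff_period_dvd, h6']
      omega
  · have hp2 : ∀ z : Conjugates t, t ^ 3 • z ≠ z → MulAction.period t z ≠ 3 := fun z hz h3 =>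
      hS z hz h3.dvd
    have h3 := hp2 z hz
    have h3' := hp2 z' hz'
    have h4 : MulAction.period t z = 2 := by omega
    have h4' : MulAction.period t z' = 2 := by omega
    have : t ^ 2 = 1 := h.eq_one_of_fix_moved htd fun z'' hz'' => by
      by_contra hne
      have := bound3 z z' z'' hz hz' hz'' hzz'
        (fun hc => hne (pow_smul_of_sameCycle hc h4.dvd))
        (fun hc => hne (pow_smul_of_sameCycle hc h4'.dvd))
      have := hlt _ hz''
      omega
    have := hdy _ this
    omega

end RigQuandle.IsGenClass

namespace RigQuandle

/-- The conjugates of `t`, with the operation of conjugation, are isomorphic to the subset `S` of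
a group. -/
def HasClass {G : Type*} [Group G] (t : G) {K : Type*} [Group K] (S : Set K) : Prop :=
  ∃ θ : Conjugates t → K, Function.Injective θ ∧ Set.range θ = S ∧
    ∀ a b, θ (b.1 • a) = θ b * θ a * (θ b)⁻¹

namespace IsGenClass

variable {G : Type*} [Group G] [Finite G] {t u : G} (h : IsGenClass t)
include h

theorem model_tr_iterate (hcard : Nat.card (Conjugates t) ≤ 15) (hu : Commute u t) (hu1 : u ≠ 1)
    (hu3 : u ^ 3 ∈ Subgroup.zpowers t) {q : ℕ} (hq : t ^ q = 1) (r : ℕ) (a : Conjugates t) :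
    (h.model hcard hu hu1 hu3 hq).tr^[r] a = t ^ r • a := by
  induction r with
  | zero => simp
  | succ r ih =>
    rw [Function.iterate_succ_apply', ih, pow_succ', mul_smul]
    rfl

theorem hasClass_of_not_sameCycle (hcard : Nat.card (Conjugates t) ≤ 15) (hu : Commute u t)
    (hu3 : u ^ 3 ∈ Subgroup.zpowers t) {y : Conjugates t} (hty : t • y ≠ y)
    (hy : ¬ SameCycle t y (u • y)) :
    HasClass t (transpositions 5).carrier ∨ HasClass t transvections.carrier ∨
      HasClass t (transpositions 6).carrier := by
  have hd := h.pow_period_eq_one hcard hu hu3 hty hy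
  have hlt := one_lt_period hty
  have hb := pairwise_append_cycles hu hu3 hy hty hcard [] (by simp) (by simp) (by simp)
  simp only [List.map_nil, List.sum_nil] at hb
  have hne : ∀ v : G, ¬ SameCycle t y (v • y) → v ≠ 1 := by
    rintro v hv rfl
    exact hv ⟨0, by simp⟩
  have hnr : ∀ v : G, ¬ SameCycle t y (v • y) → ∀ r : ℕ, v • y ≠ t ^ r • y := by
    intro v hv r hr
    exact hv ⟨r, by rw [zpow_natCast, hr]⟩
  obtain ⟨m, hm⟩ := Subgroup.mem_zpowers_iff.1 hu3
  have hpow_four : t ^ 4 = 1 → ∃ v : G, Commute v t ∧ v ^ 3 = 1 ∧ ¬ SameCycle t y (v • y) := by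
    intro ht
    refine ⟨u ^ 4, hu.pow_left 4, ?_, fun hc => hy ?_⟩
    · rw [← pow_mul, mul_comm, pow_mul, ← hm, ← zpow_natCast, ← zpow_mul, mul_comm, zpow_mul]
      rw [show t ^ ((4 : ℕ) : ℤ) = t ^ 4 from zpow_natCast t 4, ht, one_zpow]
    · rw [show u ^ 4 = u * t ^ m by rw [hm]; exact pow_succ' u 3] at hc
      exact hc.of_smul_mul_zpow hu
  have hcube : ∀ v : G, v ^ 3 = 1 → ∀ a : Conjugates t, v • v • v • a = a := by
    intro v hv a
    rw [← mul_smul, ← mul_smul, ← pow_three', hv, one_smul]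
  have hd24 : MulAction.period t y = 2 ∨ MulAction.period t y = 3 ∨ MulAction.period t y = 4 := by
    omega
  rcases hd24 with hp | hp | hp <;> rw [hp] at hd
  · obtain ⟨v, hv, hv3, hvy⟩ := hpow_four (by rw [show 4 = 2 * 2 from rfl, pow_mul, hd, one_pow])
    obtain ⟨T, hT, hR⟩ := Search.exists_realizes_two
      (h.model hcard hv (hne v hvy) (hv3 ▸ Subgroup.one_mem _) hd) (hcube v hv3) (e := y) hty
      (fun r => by rw [model_tr_iterate]; exact hnr v hvy r)
    rcases Search.represents_of_mem_targetsTwo hT hR with hR | hR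
    · exact Or.inl hR
    · exact Or.inr (Or.inr hR)
  · refine Or.inr (Or.inl ?_)
    have hperiod : ∀ z : Conjugates t, t • z ≠ z → MulAction.period t z = 3 := by
      intro z hz
      have h1 : MulAction.period t z ∣ 3 :=
        MulAction.pow_smul_eq_iff_period_dvd.1 (by rw [hd, one_smul])
      have h2 := one_lt_period hz
      rcases (Nat.dvd_prime Nat.prime_three).1 h1 with h3 | h3
      · omega
      · exact h3
    have hzpow : ∀ i : ℤ, (t ^ i) ^ 3 = 1 := by
      intro i
      rw [← zpow_natCast, ← zpow_mul, mul_comm, zpow_mul, zpow_natCast, hd, one_zpow]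
    have nine : ∀ v : G, Commute v t → ¬ SameCycle t y (v • y) → v ^ 3 ≠ t := by
      intro v hv hvy hv3
      exact Search.false_of_cube_eq_translation
        (h.model hcard hv (hne v hvy) (hv3 ▸ Subgroup.mem_zpowers t) hd) (fun e => by
          change v • v • v • e = t • e
          rw [← mul_smul, ← mul_smul, ← pow_three', hv3]) (e := y) hty
    have hu3' : u ^ 3 = 1 := by
      have hmod : t ^ m = t ^ (m % 3) := by
        conv_lhs => rw [← Int.emod_add_mul_ediv m 3, zpow_add, zpow_mul]
        rw [zpow_ofNat, hd, one_zpow, mul_one]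
      have hcases : m % 3 = 0 ∨ m % 3 = 1 ∨ m % 3 = 2 := by omega
      rcases hcases with hc | hc | hc <;> rw [hc] at hmod <;> rw [hmod] at hm
      · simpa using hm.symm
      · exact absurd (by simpa using hm.symm) (nine u hu hy)
      · refine absurd ?_ (nine u⁻¹ hu.inv_left fun hc' => hy ?_)
        · rw [inv_pow, ← hm, inv_eq_iff_mul_eq_one, zpow_ofNat, ← pow_succ, hd]
        · have := hc'.smul hu
          rw [smul_inv_smul] at this
          exact this.symm
    have key : ∃ v : G, Commute v t ∧ v ^ 3 = 1 ∧ ¬ SameCycle t y (v • y) ∧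
        ∀ e : Conjugates t, t • e ≠ e → SameCycle t e (v • e) → v • e = e := by
      by_cases hf : ∃ f : Conjugates t, t • f ≠ f ∧ SameCycle t f (u • f)
      · obtain ⟨f, hf, i, hi⟩ := hf
        have hv : Commute (u * t ^ (-i)) t := hu.mul_left ((Commute.refl t).zpow_left _)
        have hvf : (u * t ^ (-i)) • f = f := by
          rw [(hu.zpow_right _).eq, mul_smul, ← hi, ← mul_smul, ← zpow_add]
          simp
        have hv3 : (u * t ^ (-i)) ^ 3 = 1 := by
          rw [(hu.zpow_right _).mul_pow, hu3', hzpow, one_mul]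
        have hvy : ¬ SameCycle t y ((u * t ^ (-i)) • y) := fun hc => hy (hc.of_smul_mul_zpow hu)
        refine ⟨_, hv, hv3, hvy, fun e he hec => ?_⟩
        have hother : ∀ e : Conjugates t, SameCycle t e ((u * t ^ (-i)) • e) →
            ∀ j : ℕ, ¬ SameCycle t ((u * t ^ (-i)) ^ j • y) e := by
          intro e he j hj
          refine hvy (SameCycle.of_smul (u := (u * t ^ (-i)) ^ j) (hv.pow_left j) ?_)
          have := hj.trans (he.trans (hj.symm.smul hv))
          rwa [← mul_smul, ← pow_succ', pow_succ, mul_smul] at this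
        by_cases hfe : SameCycle t f e
        · exact smul_eq_self_of_sameCycle hfe hv hvf
        · have := pairwise_append_cycles hv (hv3 ▸ Subgroup.one_mem _) hvy hty hcard [f, e]
            (by simp [hfe]) (by simp [hf, he]) (by
              intro z hz
              rcases List.mem_cons.1 hz with rfl | hz
              · exact hother _ ⟨0, by rw [hvf]; simp⟩
              · rw [List.mem_singleton.1 hz]
                exact hother _ hec)
          simp only [List.map_cons, List.map_nil, List.sum_cons, List.sum_nil, hperiod _ hf,
            hperiod _ he, hp] at this
          omega
      · push Not at hf
        exact ⟨u, hu, hu3', hy, fun e he hec => absurd hec (hf e he)⟩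
    obtain ⟨v, hv, hv3, hvy, hvfix⟩ := key
    obtain ⟨T, hT, hR⟩ := Search.exists_realizes_three
      (h.model hcard hv (hne v hvy) (hv3 ▸ Subgroup.one_mem _) hd) (hcube v hv3) (e := y) hty
      (fun r => by rw [model_tr_iterate]; exact hnr v hvy r)
      (fun e he r hr => hvfix e he ⟨r, by
        rw [model_tr_iterate] at hr
        rw [zpow_natCast]
        exact hr.symm⟩)
    exact Search.represents_of_mem_targetsThree hT hR
  · obtain ⟨v, hv, hv3, hvy⟩ := hpow_four hd
    exact (Search.false_of_order_four
      (h.model hcard hv (hne v hvy) (hv3 ▸ Subgroup.one_mem _) hd) (hcube v hv3) (e := y)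
      (fun hc => by
        have h1 : t ^ 2 • y = y := by rw [pow_two, mul_smul]; exact hc
        rw [MulAction.pow_smul_eq_iff_period_dvd, hp] at h1
        omega)
      (fun r => by rw [model_tr_iterate]; exact hnr v hvy r)).elim

theorem false_of_forall_sameCycle (hcard : Nat.card (Conjugates t) ≤ 15) (hu : Commute u t)
    (hu3 : u ^ 3 ∈ Subgroup.zpowers t) {b : ℕ} (hub : u ^ 3 ^ b = 1)
    (hut : u ∉ Subgroup.zpowers t)
    (hK : ∀ y : Conjugates t, t • y ≠ y → SameCycle t y (u • y)) : False := by
  have hu1 : u ≠ 1 := fun h1 => hut (h1 ▸ Subgroup.one_mem _)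
  have : Nontrivial G := ⟨u, 1, hu1⟩
  have hcomm : ∀ i : ℤ, Commute (u * t ^ i) t := fun i =>
    hu.mul_left ((Commute.refl t).zpow_left i)
  have hnt : ∀ i : ℤ, u * t ^ i ∉ Subgroup.zpowers t := fun i hi => hut
    ((Subgroup.mul_mem_cancel_right _ (Subgroup.zpow_mem _ (Subgroup.mem_zpowers t) i)).1 hi)
  have hn1 : ∀ i : ℤ, u * t ^ i ≠ 1 := fun i h1 => hnt i (h1 ▸ Subgroup.one_mem _)
  have hcyc : ∀ i : ℤ, ∀ z z' : Conjugates t, (u * t ^ i) • z = z → (u * t ^ i) • z' ≠ z' →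
      ¬ SameCycle t z z' := fun i z z' hz hz' hc =>
    hz' (smul_eq_self_of_sameCycle hc (hcomm i) hz)
  by_cases ht3 : t ^ 3 = 1
  · have htz : ∀ (z : Conjugates t) (m : ℤ), t • z ≠ z → t ^ m • z = z → (3 : ℤ) ∣ m := by
      intro z m hz hm
      rw [MulAction.zpow_smul_eq_iff_period_dvd] at hm
      have h1 : MulAction.period t z ∣ 3 :=
        MulAction.pow_smul_eq_iff_period_dvd.1 (by rw [ht3, one_smul])
      have h2 := one_lt_period hz
      rcases (Nat.dvd_prime Nat.prime_three).1 h1 with h3 | h3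
      · omega
      · rw [h3] at hm
        exact hm
    have hzpow : ∀ i : ℤ, t ^ (3 * i) = 1 := by
      intro i
      rw [zpow_mul, zpow_ofNat, ht3, one_zpow]
    obtain ⟨z, hz, -⟩ := h.exists_moved h.ne_one h.ne_one
    obtain ⟨i, hi⟩ := hK z hz
    obtain ⟨m, hm⟩ := Subgroup.mem_zpowers_iff.1 hu3
    set w := u * t ^ (-i) with hw
    have hwt : Commute w t := hcomm (-i)
    have hwz : w • z = z := by
      rw [hw, (hu.zpow_right _).eq, mul_smul, ← hi, ← mul_smul, ← zpow_add]
      simp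
    have hw3' : w ^ 3 = t ^ m := by
      rw [hw, (hu.zpow_right _).mul_pow, hm, ← zpow_natCast (t ^ (-i)), ← zpow_mul, mul_comm (-i)]
      rw [Nat.cast_ofNat, hzpow, mul_one]
    have hw3 : w ^ 3 = 1 := by
      have h1 : t ^ m • z = z := by
        rw [← hw3', pow_three, mul_smul w, mul_smul w, hwz, hwz, hwz]
      obtain ⟨n, rfl⟩ := htz z m hz h1
      rw [hw3', hzpow]
    have hwone : w ≠ 1 := hn1 _
    obtain ⟨z', hz', hwz'⟩ := h.exists_moved h.ne_one hwone
    obtain ⟨e, he⟩ := (hK z' hz').smul_mul_zpow hu (-i)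
    rw [← hw] at he
    have hmod : t ^ e = t ^ (e % 3) := by
      conv_lhs => rw [← Int.emod_add_mul_ediv e 3, zpow_add, hzpow, mul_one]
    have done : ∀ v : G, Commute v t → v ≠ 1 → v ^ 3 = 1 → v • z = z → v • z' = t • z' →
        False := fun v hv hv1 hv3 hvz hvz' =>
      Search.false_of_fixed_of_translated
        (h.model hcard hv hv1 (hv3 ▸ Subgroup.one_mem _) ht3) (fun a => by
          change v • v • v • a = a
          rw [← mul_smul, ← mul_smul, ← pow_three', hv3, one_smul]) (e := z) (f := z') hz hz' hvz
        hvz'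
    have hcases : e % 3 = 0 ∨ e % 3 = 1 ∨ e % 3 = 2 := by omega
    rcases hcases with hc | hc | hc <;> rw [hc] at hmod <;> rw [hmod] at he
    · rw [zpow_zero, one_smul] at he
      exact hwz' he.symm
    · rw [zpow_one] at he
      exact done w hwt hwone hw3 hwz he.symm
    · refine done w⁻¹ hwt.inv_left (inv_ne_one.2 hwone) (by rw [inv_pow, hw3, inv_one])
        (inv_smul_eq_iff.2 hwz.symm) (inv_smul_eq_iff.2 ?_)
      rw [← mul_smul, hwt.eq, mul_smul, ← he, ← mul_smul, zpow_ofNat, ← pow_succ', ht3, one_smul]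
  · have hsix : ∀ z : Conjugates t, t ^ 3 • z ≠ z → 3 ∣ MulAction.period t z →
        6 ≤ MulAction.period t z := by
      intro z hz hd
      have h1 : MulAction.period t z ≠ 3 := fun h3 =>
        hz (MulAction.pow_smul_eq_iff_period_dvd.2 h3.dvd)
      have h2 := period_pos t z
      omega
    obtain ⟨z, hz, huz⟩ := h.exists_moved ht3 hu1
    have hz1 := smul_ne_of_pow_smul_ne hz
    have hp := hsix z hz (dvd_period_of_sameCycle Nat.prime_three hu hub (hK z hz1) huz)
    obtain ⟨i, c, hwz, hwc⟩ := exists_zpow_fixing Nat.prime_three hu hub (hK z hz1)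
    obtain ⟨z', hz', hwz'⟩ := h.exists_moved ht3 (hn1 i)
    have hz1' := smul_ne_of_pow_smul_ne hz'
    have hdvd : ∀ y : Conjugates t, t • y ≠ y → (u * t ^ i) • y ≠ y →
        3 ∣ MulAction.period t y := fun y hy hwy =>
      dvd_period_of_sameCycle Nat.prime_three (hcomm i) hwc ((hK y hy).smul_mul_zpow hu i) hwy
    have hp' := hsix z' hz' (hdvd z' hz1' hwz')
    have hzz' := hcyc i z z' hwz hwz'
    obtain ⟨e, he⟩ := (hK z' hz1').smul_mul_zpow hu i
    refine hnt i ⟨e, ?_⟩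
    have hcomm' : Commute (t ^ e) t := (Commute.refl t).zpow_left e
    refine inv_mul_eq_one.1 (h.eq_one_of_fix_moved (hn1 i) fun y hy => ?_)
    rw [mul_smul, inv_smul_eq_iff]
    refine smul_eq_of_sameCycle (y := z') ?_ (hcomm i) hcomm' he.symm
    by_contra hz'y
    have hzy := hcyc i z y hwz hy
    by_cases hty : t • y = y
    · set w := u * t ^ i with hw
      have hfix : ∀ j : ℕ, t • w ^ j • y = w ^ j • y := by
        intro j
        rw [← mul_smul, ← ((hcomm i).pow_left j).eq, mul_smul, hty]
      have hbase : t • Conjugates.base t = Conjugates.base t :=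
        Conjugates.smul_eq_iff.2 (Commute.refl t)
      have hwbase : ∀ j : ℕ, w ^ j • Conjugates.base t = Conjugates.base t := fun j =>
        Conjugates.smul_eq_iff.2 ((hcomm i).pow_left j)
      have hsc : ∀ a b : Conjugates t, t • b = b → SameCycle t a b → b = a := by
        rintro a b hb hab
        obtain ⟨k, hk⟩ := hab.symm
        rw [← hk]
        exact ((MulAction.zpow_smul_eq_iff_period_dvd).2 (by
          rw [MulAction.period_eq_one_iff.2 hb]; simp)).symm
      have hw2 : w ^ 2 • y ≠ y := by
        intro h2
        have h3 : MulAction.period w y ∣ 2 := MulAction.pow_smul_eq_iff_period_dvd.1 h2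
        have h4 : MulAction.period w y ∣ 3 ^ c :=
          MulAction.pow_smul_eq_iff_period_dvd.1 (by rw [hwc, one_smul])
        exact hy (MulAction.period_eq_one_iff.1 (Nat.eq_one_of_dvd_coprimes
          (Nat.Coprime.pow_right c (by norm_num)) h3 h4))
      have hyb : ∀ j : ℕ, w ^ j • y ≠ Conjugates.base t := by
        intro j hj
        rw [← hwbase j] at hj
        apply hy
        rw [MulAction.injective _ hj]
        simpa using hwbase 1
      have hmoved : ∀ a b : Conjugates t, t • a ≠ a → t • b = b → ¬ SameCycle t a b := by
        intro a b ha hb hab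
        exact ha (hsc a b hb hab ▸ hb)
      have h0 := hfix 0
      have h1 := hfix 1
      have h2 := hfix 2
      have h0b := hyb 0
      have h1b := hyb 1
      have h2b := hyb 2
      have hsum := sum_period_le_card t
        [z, z', w ^ 0 • y, w ^ 1 • y, w ^ 2 • y, Conjugates.base t] (by
          simp only [List.pairwise_cons, List.mem_cons, forall_eq_or_imp, List.not_mem_nil,
            IsEmpty.forall_iff, implies_true, List.Pairwise.nil, and_true]
          refine ⟨⟨hzz', hmoved _ _ hz1 h0, hmoved _ _ hz1 h1, hmoved _ _ hz1 h2,
            hmoved _ _ hz1 hbase⟩, ⟨hmoved _ _ hz1' h0, hmoved _ _ hz1' h1, hmoved _ _ hz1' h2,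
            hmoved _ _ hz1' hbase⟩, ⟨fun hc => ?_, fun hc => ?_, fun hc => ?_⟩,
            ⟨fun hc => ?_, fun hc => ?_⟩, fun hc => ?_⟩
          · have := hsc _ _ h1 hc
            simp only [pow_one, pow_zero, one_smul] at this
            exact hy this
          · have := hsc _ _ h2 hc
            simp only [pow_zero, one_smul] at this
            exact hw2 this
          · exact h0b (hsc _ _ hbase hc).symm
          · have := hsc _ _ h2 hc
            rw [pow_succ, mul_smul] at this
            exact hy (MulAction.injective _ this)
          · exact h1b (hsc _ _ hbase hc).symm
          · exact h2b (hsc _ _ hbase hc).symm)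
      simp only [List.map_cons, List.map_nil, List.sum_cons, List.sum_nil,
        MulAction.period_eq_one_iff.2 h0, MulAction.period_eq_one_iff.2 h1,
        MulAction.period_eq_one_iff.2 h2, MulAction.period_eq_one_iff.2 hbase] at hsum
      omega
    · have h1 := sum_period_lt_card t [z, z', y] (by simp [hzz', hzy, hz'y])
        (by simp [hz1, hz1', hty])
      simp only [List.map_cons, List.map_nil, List.sum_cons, List.sum_nil] at h1
      have h2 := Nat.le_of_dvd (period_pos t y) (hdvd y hty hy)
      omega

/-- The classes of at most fifteen elements with a centralizer that contains an element of
order `3` modulo the cyclic group generated by the chosen element. -/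
theorem hasClass (hcard : Nat.card (Conjugates t) ≤ 15) (hu : Commute u t)
    (hu3 : u ^ 3 ∈ Subgroup.zpowers t) {b : ℕ} (hub : u ^ 3 ^ b = 1)
    (hut : u ∉ Subgroup.zpowers t) :
    HasClass t (transpositions 5).carrier ∨ HasClass t transvections.carrier ∨
      HasClass t (transpositions 6).carrier := by
  by_cases hK : ∀ y : Conjugates t, t • y ≠ y → SameCycle t y (u • y)
  · exact (h.false_of_forall_sameCycle hcard hu hu3 hub hut hK).elim
  · push Not at hK
    obtain ⟨y, hty, hy⟩ := hK
    exact h.hasClass_of_not_sameCycle hcard hu hu3 hty hy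

end IsGenClass

end RigQuandle

open scoped Quandles

namespace RigQuandle

section Deck

universe u

variable {Y : Type u} [Quandle Y]

theorem smul_act (g : Inn Y) (a b : Y) : g • (a ◃ b) = (g • a) ◃ (g • b) := by
  obtain ⟨g, hg⟩ := g
  change g (a ◃ b) = g a ◃ g b
  induction hg using Subgroup.closure_induction generalizing a b with
  | mem x hx =>
    obtain ⟨c, rfl⟩ := hx
    exact Shelf.self_distrib
  | one => rfl
  | mul x y _ _ hx hy => rw [Equiv.Perm.mul_apply, hy, hx]; rfl
  | inv x _ hx =>
    apply x.injective
    rw [hx]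
    simp

/-- The translation by `y`, as an element of the inner automorphism group. -/
def translation (y : Y) : Inn Y := ⟨Rack.act' y, Subgroup.subset_closure ⟨y, rfl⟩⟩

theorem translation_smul (y z : Y) : translation y • z = y ◃ z := rfl

theorem translation_eq_iff {y z : Y} :
    translation y = translation z ↔ (Rack.act' y : Equiv.Perm Y) = Rack.act' z :=
  Subtype.ext_iff

theorem translation_smul_eq (g : Inn Y) (y : Y) :
    translation (g • y) = g * translation y * g⁻¹ := by
  rw [eq_mul_inv_iff_mul_eq]
  refine Subtype.ext (Equiv.ext fun z => ?_)
  exact (smul_act g y z).symm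

theorem closure_translations : Subgroup.closure (Set.range (translation (Y := Y))) = ⊤ := by
  rw [eq_top_iff]
  rintro ⟨g, hg⟩ -
  induction hg using Subgroup.closure_induction with
  | mem x hx =>
    obtain ⟨c, rfl⟩ := hx
    exact Subgroup.subset_closure ⟨c, rfl⟩
  | one => exact Subgroup.one_mem _
  | mul x y hx hy hx' hy' => exact Subgroup.mul_mem _ hx' hy'
  | inv x hx hx' => exact Subgroup.inv_mem _ hx'

/-- A permutation which commutes with all translations and does not change them. -/
structure IsDeck (a : Equiv.Perm Y) : Prop where
  map_act : ∀ b y, a (b ◃ y) = b ◃ a y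
  act_eq : ∀ b y, a b ◃ y = b ◃ y

theorem IsDeck.one : IsDeck (1 : Equiv.Perm Y) := ⟨fun _ _ => rfl, fun _ _ => rfl⟩

theorem IsDeck.mul {a b : Equiv.Perm Y} (ha : IsDeck a) (hb : IsDeck b) : IsDeck (a * b) :=
  ⟨fun c y => by rw [Equiv.Perm.mul_apply, hb.map_act, ha.map_act]; rfl,
    fun c y => by rw [Equiv.Perm.mul_apply, ha.act_eq, hb.act_eq]⟩

theorem IsDeck.inv {a : Equiv.Perm Y} (ha : IsDeck a) : IsDeck a⁻¹ :=
  ⟨fun c y => a.injective (by rw [ha.map_act]; simp),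
    fun c y => by rw [← ha.act_eq]; simp⟩

theorem IsDeck.of_mem_zpowers {a b : Equiv.Perm Y} (ha : IsDeck a)
    (hb : b ∈ Subgroup.zpowers a) : IsDeck b := by
  rw [Subgroup.zpowers_eq_closure] at hb
  induction hb using Subgroup.closure_induction with
  | mem x hx => rwa [Set.mem_singleton_iff.1 hx]
  | one => exact IsDeck.one
  | mul x y _ _ hx hy => exact hx.mul hy
  | inv x _ hx => exact hx.inv

theorem IsDeck.eq_one_of_fixed (hY : IsConnected Y) {a : Equiv.Perm Y} (ha : IsDeck a) {y : Y}
    (hy : a y = y) : a = 1 := by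
  have : MulAction.IsPretransitive (Inn Y) Y := hY
  have key : ∀ (g : Inn Y) (z : Y), a (g • z) = g • a z := by
    rintro ⟨g, hg⟩
    change ∀ z, a (g z) = g (a z)
    induction hg using Subgroup.closure_induction with
    | mem x hx =>
      obtain ⟨c, rfl⟩ := hx
      exact ha.map_act c
    | one => exact fun z => rfl
    | mul x y _ _ hx hy => intro z; rw [Equiv.Perm.mul_apply, hx, hy]; rfl
    | inv x _ hx => intro z; apply x.injective; rw [← hx]; simp
  ext z
  obtain ⟨g, rfl⟩ := MulAction.exists_smul_eq (Inn Y) y z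
  rw [key, hy]
  rfl

theorem IsAbelianExtension.exists_isDeck (h : IsAbelianExtension Y) :
    ∃ a : Equiv.Perm Y, IsDeck a ∧ ∀ y, a y ≠ y := by
  obtain ⟨X, A, hX, hA, φ, hnt, f, hf⟩ := h
  obtain ⟨c, hc⟩ := exists_ne (0 : A)
  let e : Y ≃ Extension φ := Equiv.ofBijective f hf
  have he : ∀ y, e y = f y := fun _ => rfl
  let s : Equiv.Perm (Extension φ) :=
    { toFun := fun p => (p.1, p.2 + c)
      invFun := fun p => (p.1, p.2 - c)
      left_inv := fun p => Prod.ext rfl (add_sub_cancel_right _ _)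
      right_inv := fun p => Prod.ext rfl (sub_add_cancel _ _) }
  have hs1 : ∀ p q : Extension φ, s (p ◃ q) = p ◃ s q := fun p q =>
    Prod.ext rfl (add_right_comm _ _ _)
  have hs2 : ∀ p q : Extension φ, s p ◃ q = p ◃ q := fun p q => rfl
  refine ⟨(e.trans s).trans e.symm, ⟨fun b y => e.injective ?_, fun b y => e.injective ?_⟩,
    fun y hy => hc ?_⟩
  · simp only [Equiv.trans_apply, Equiv.apply_symm_apply]
    rw [he, ShelfHom.map_act, hs1, he (b ◃ _), ShelfHom.map_act, ← he (e.symm _),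
      Equiv.apply_symm_apply, he y]
  · simp only [Equiv.trans_apply]
    rw [he, ShelfHom.map_act, ← he, ← he, Equiv.apply_symm_apply, hs2, he (b ◃ y),
      ShelfHom.map_act, he, he]
  · have h1 : s (e y) = e y := by
      have := congrArg e hy
      simpa using this
    have h2 : (e y).2 + c = (e y).2 := congrArg Prod.snd h1
    simpa using h2

/-- The quotient of a quandle by a group of permutations as in `IsDeck`. -/
@[reducible] def deckQuandle {a : Equiv.Perm Y} (ha : IsDeck a) :
    Quandle (MulAction.orbitRel.Quotient (Subgroup.zpowers a) Y) where
  act := Quotient.map₂ (fun b y => b ◃ y) (by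
    rintro _ b ⟨g, rfl⟩ _ y ⟨k, rfl⟩
    refine ⟨k, ?_⟩
    have h1 := ha.of_mem_zpowers g.2
    have h2 := ha.of_mem_zpowers k.2
    exact (h2.map_act b y).trans (h1.act_eq b _).symm)
  self_distrib := by
    rintro ⟨x⟩ ⟨y⟩ ⟨z⟩
    exact congrArg (Quotient.mk _) Shelf.self_distrib
  invAct := Quotient.map₂ (fun b y => b ◃⁻¹ y) (by
    rintro _ b ⟨g, rfl⟩ _ y ⟨k, rfl⟩
    refine ⟨k, ?_⟩
    have h1 := ha.of_mem_zpowers g.2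
    have h2 := ha.of_mem_zpowers k.2
    change k.1 (b ◃⁻¹ y) = g.1 b ◃⁻¹ k.1 y
    rw [← Rack.left_cancel b, ← h2.map_act, Rack.act_invAct_eq, ← h1.act_eq, Rack.act_invAct_eq])
  left_inv := by
    rintro ⟨x⟩ ⟨y⟩
    exact congrArg (Quotient.mk _) (Rack.invAct_act_eq x y)
  right_inv := by
    rintro ⟨x⟩ ⟨y⟩
    exact congrArg (Quotient.mk _) (Rack.act_invAct_eq x y)
  fix := by
    rintro ⟨x⟩
    exact congrArg (Quotient.mk _) Quandle.fix

theorem IsDeck.isAbelianExtension (hY : IsConnected Y) {a : Equiv.Perm Y} (ha : IsDeck a)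
    (ha1 : a ≠ 1) : IsAbelianExtension Y := by
  let A := Subgroup.zpowers a
  let X := MulAction.orbitRel.Quotient A Y
  let _ : Quandle X := deckQuandle ha
  let _ : CommGroup A := { (inferInstance : Group A) with
    mul_comm := (Subgroup.zpowers_isMulCommutative a).is_comm.comm }
  have hdeck : ∀ g : A, IsDeck g.1 := fun g => ha.of_mem_zpowers g.2
  have hfree : ∀ (g k : A) (y : Y), g • y = k • y → g = k := by
    intro g k y hgk
    have h1 : (k⁻¹ * g) • y = y := by rw [mul_smul, hgk, inv_smul_smul]
    have h2 := (hdeck (k⁻¹ * g)).eq_one_of_fixed hY h1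
    exact (inv_mul_eq_one.1 (Subtype.ext h2 : k⁻¹ * g = 1)).symm
  have hact : ∀ (g : A) (b y : Y), b ◃ (g • y) = g • (b ◃ y) := fun g b y =>
    ((hdeck g).map_act b y).symm
  have hact' : ∀ (g : A) (b y : Y), (g • b) ◃ y = b ◃ y := fun g b y => (hdeck g).act_eq b y
  let π : Y → X := Quotient.mk _
  let s : X → Y := Quotient.out
  have hπ : ∀ b y, π (b ◃ y) = π b ◃ π y := fun b y => rfl
  have hs : ∀ x, π (s x) = x := fun x => Quotient.out_eq x
  have hcoord : ∀ y, ∃ g : A, g • s (π y) = y := by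
    intro y
    have : (MulAction.orbitRel A Y) y (s (π y)) := Quotient.exact (hs (π y)).symm
    exact this
  choose c hc using hcoord
  have hcuniq : ∀ (g : A) (y : Y), c (g • y) = g * c y := by
    intro g y
    have h1 : π (g • y) = π y := Quotient.sound ⟨g, rfl⟩
    apply hfree _ _ (s (π y))
    rw [mul_smul, hc, ← h1, hc]
  have hcs : ∀ x, c (s x) = 1 := by
    intro x
    apply hfree _ _ (s x)
    conv_lhs => rw [← hs x]
    rw [hs, one_smul]
    have := hc (s x)
    rwa [hs] at this
  have hmul : ∀ b y, c (b ◃ y) = c y * c (s (π b) ◃ s (π y)) := by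
    intro b y
    rw [← hcuniq]
    congr 1
    rw [← hact, hc, ← hact' (c b) (s (π b)), hc]
  let φ : Cocycle X (Additive A) :=
    { toFun := fun x z => Additive.ofMul (c (s z ◃ s x))
      cocycle := by
        intro x y z
        have h1 : c (s z ◃ (s y ◃ s x)) =
            c (s y ◃ s x) * c (s z ◃ s (y ◃ x)) := by
          rw [hmul, hπ, hs, hs, hs]
        have h2 : c ((s z ◃ s y) ◃ (s z ◃ s x)) =
            c (s z ◃ s x) * c (s (z ◃ y) ◃ s (z ◃ x)) := by
          rw [hmul, hπ, hπ, hs, hs, hs]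
        rw [Shelf.self_distrib, h2] at h1
        have h3 := congrArg Additive.ofMul h1
        simp only [ofMul_mul] at h3
        rw [sub_add_eq_add_sub, ← h3, sub_sub, sub_self]
      diag := by
        intro x
        rw [Quandle.fix, hcs]
        rfl }
  refine ⟨X, Additive A, inferInstance, inferInstance, φ, ?_, ⟨fun y => (π y, Additive.ofMul (c y)),
    fun {b y} => ?_⟩, fun y z hyz => ?_, fun p => ?_⟩
  · refine ⟨Additive.ofMul ⟨a, Subgroup.mem_zpowers a⟩, 0, fun h0 => ha1 ?_⟩
    exact congrArg Subtype.val (Additive.ofMul.injective h0)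
  · exact Prod.ext (hπ b y) (congrArg Additive.ofMul (hmul b y))
  · have h1 : π y = π z := congrArg Prod.fst hyz
    have h2 : c y = c z := Additive.ofMul.injective (congrArg Prod.snd hyz)
    rw [← hc y, ← hc z, h1, h2]
  · refine ⟨Additive.toMul p.2 • s p.1, Prod.ext ?_ ?_⟩
    · exact (Quotient.sound ⟨_, rfl⟩ : π _ = π _).trans (hs _)
    · change Additive.ofMul (c _) = _
      rw [hcuniq, hcs, mul_one]
      rfl

end Deck

end RigQuandle

open scoped Quandles

namespace RigQuandle

section NormalCore

variable {C : Type*} [Group C] [Finite C]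

theorem exists_normalizing_of_core_index {H : Subgroup C} (hH : H ≠ ⊤)
    (hp : ∀ p, p.Prime → p ∣ H.normalCore.index → p = 2) :
    ∃ c ∉ H, ∀ h, c * h * c⁻¹ ∈ H ↔ h ∈ H := by
  set N := H.normalCore with hN
  have hNH : N ≤ H := H.normalCore_le
  have h2 : Nat.card (C ⧸ N) = 2 ^ (Nat.card (C ⧸ N)).primeFactorsList.length :=
    Nat.eq_prime_pow_of_unique_prime_dvd Nat.card_pos.ne' fun {d} hd hdvd =>
      hp d hd hdvd
  have : Fact (Nat.Prime 2) := ⟨Nat.prime_two⟩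
  have := (IsPGroup.of_card h2).isNilpotent
  have hcm : ∀ g : C, (g : C ⧸ N) ∈ H.map (QuotientGroup.mk' N) ↔ g ∈ H := by
    intro g
    constructor
    · rintro ⟨k, hk, hkg⟩
      have := hNH (QuotientGroup.eq.1 hkg)
      exact (Subgroup.mul_mem_cancel_left _ (H.inv_mem hk)).1 this
    · intro hg
      exact ⟨g, hg, rfl⟩
  have hlt : H.map (QuotientGroup.mk' N) < ⊤ := by
    rw [lt_top_iff_ne_top]
    intro h
    refine hH (eq_top_iff.2 fun g _ => (hcm g).1 ?_)
    rw [h]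
    exact Subgroup.mem_top _
  obtain ⟨x, hx, hxH⟩ := SetLike.exists_of_lt (Group.normalizerCondition_of_isNilpotent _ hlt)
  obtain ⟨c, rfl⟩ := QuotientGroup.mk_surjective x
  refine ⟨c, fun hc => hxH ((hcm c).2 hc), fun h => ?_⟩
  rw [← hcm, ← hcm h]
  exact (Subgroup.mem_normalizer_iff.1 hx h).symm

theorem not_dvd_core_index {H T : Subgroup C} [T.Normal] (hT : T ≤ H) {p : ℕ} (hp : p.Prime)
    (hpT : ∀ (u : C) (b : ℕ), u ^ p ^ b = 1 → u ∈ T) : ¬ p ∣ H.normalCore.index := by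
  have : Fact p.Prime := ⟨hp⟩
  obtain ⟨P⟩ : Nonempty (Sylow p C) := inferInstance
  intro hd
  have hle : (P : Subgroup C) ≤ H.normalCore := by
    intro u hu
    obtain ⟨b, hb⟩ := P.isPGroup' ⟨u, hu⟩
    exact Subgroup.normal_le_normalCore.2 hT (hpT u b (by simpa using congrArg Subtype.val hb))
  exact P.not_dvd_index (hd.trans (Subgroup.index_dvd_of_le hle))

omit [Finite C] in
theorem exists_pow_notMem_of_pow_prime_pow_eq_one {T : Subgroup C} {u : C} {p b : ℕ}
    (hu : u ^ p ^ b = 1) (huT : u ∉ T) : ∃ i : ℕ, u ^ i ∉ T ∧ (u ^ i) ^ p ∈ T := by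
  by_contra! hcon
  have : ∀ j : ℕ, u ^ p ^ j ∉ T := by
    intro j
    induction j with
    | zero => simpa using huT
    | succ j ih =>
      rw [pow_succ, pow_mul]
      exact hcon _ ih
  exact this b (hu ▸ T.one_mem)

end NormalCore

section Reduction

variable {Y : Type*} [Quandle Y]

instance {G : Type*} [Group G] (t : G) : MulAction.IsPretransitive G (Conjugates t) where
  exists_smul_eq a b := by
    obtain ⟨g, rfl⟩ := a.exists_smul
    obtain ⟨k, rfl⟩ := b.exists_smul
    exact ⟨k * g⁻¹, by rw [mul_smul, inv_smul_smul]⟩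

/-- The stabilizer of `t` among its conjugates, the centralizer of `t`. -/
abbrev centr {G : Type*} [Group G] (t : G) : Subgroup G :=
  MulAction.stabilizer G (Conjugates.base t)

theorem mem_centr {G : Type*} [Group G] {t g : G} : g ∈ centr t ↔ Commute g t :=
  Conjugates.smul_eq_iff

theorem stabilizer_le_centr (y : Y) : MulAction.stabilizer (Inn Y) y ≤ centr (translation y) := by
  intro g hg
  rw [mem_centr]
  have h1 := translation_smul_eq g y
  rw [MulAction.mem_stabilizer_iff.1 hg, eq_mul_inv_iff_mul_eq] at h1
  exact h1.symm

theorem translation_mem_stabilizer (y : Y) : translation y ∈ MulAction.stabilizer (Inn Y) y :=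
  Quandle.fix

theorem exists_translation_eq {y : Y} {z : Inn Y}
    (hz : IsConj (translation y) z) : ∃ y', translation y' = z := by
  obtain ⟨g, rfl⟩ := isConj_iff.1 hz
  exact ⟨g • y, translation_smul_eq g y⟩

theorem isGenClass_translation (hY : IsConnected Y) (hne : ¬ IsAbelianExtension Y) (y : Y) :
    IsGenClass (translation y) where
  gen := by
    have : MulAction.IsPretransitive (Inn Y) Y := hY
    rw [eq_top_iff, ← closure_translations, Subgroup.closure_le]
    rintro _ ⟨z, rfl⟩
    obtain ⟨g, rfl⟩ := MulAction.exists_smul_eq (Inn Y) y z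
    exact Subgroup.subset_closure (isConj_iff.2 ⟨g, (translation_smul_eq g y).symm⟩)
  center z hz := by
    by_contra hz1
    refine hne (IsDeck.isAbelianExtension hY (a := z.1) ⟨fun b y => ?_, fun b y => ?_⟩
      fun h => hz1 (Subtype.ext h))
    · exact congrArg (fun g : Inn Y => g • y) (hz (translation b)).eq
    · have h1 := translation_smul_eq z b
      rw [(hz (translation b)).eq, mul_inv_cancel_right] at h1
      exact congrArg (fun g : Inn Y => g • y) h1

/-- In a connected quandle which is not an abelian extension, point stabilizers are
self-normalizing in the centralizers of the translations. -/
theorem mem_stabilizer_of_normalizing [Finite Y] (hY : IsConnected Y)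
    (hne : ¬ IsAbelianExtension Y) {y : Y} {c : Inn Y} (hc : Commute c (translation y))
    (hn : ∀ h : Inn Y, c * h * c⁻¹ ∈ MulAction.stabilizer (Inn Y) y ↔
      h ∈ MulAction.stabilizer (Inn Y) y) : c ∈ MulAction.stabilizer (Inn Y) y := by
  have : MulAction.IsPretransitive (Inn Y) Y := hY
  by_contra hcH
  choose g hg using fun z => MulAction.exists_smul_eq (Inn Y) y z
  have hiff : ∀ k k' : Inn Y, k • c • y = k' • c • y ↔ k • y = k' • y := by
    intro k k'
    have h1 : ∀ v : Inn Y, k • v • y = k' • v • y ↔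
        v⁻¹ * (k'⁻¹ * k) * v ∈ MulAction.stabilizer (Inn Y) y := by
      intro v
      rw [MulAction.mem_stabilizer_iff, mul_smul, mul_smul, mul_smul, inv_smul_eq_iff,
        inv_smul_eq_iff]
    rw [h1, ← hn]
    have h2 := h1 1
    simp only [one_smul, inv_one, one_mul, mul_one] at h2
    rw [h2]
    simp [mul_assoc]
  let f : Y → Y := fun z => g z • c • y
  have hf : ∀ k : Inn Y, f (k • y) = k • c • y := fun k => (hiff _ _).2 (hg _)
  have hinj : Function.Injective f := by
    intro z z' hzz'
    rw [← hg z, ← hg z', (hiff _ _).1 hzz']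
  let a : Equiv.Perm Y := Equiv.ofBijective f (Finite.injective_iff_bijective.1 hinj)
  have ha : ∀ k : Inn Y, a (k • y) = k • c • y := hf
  refine hne (IsDeck.isAbelianExtension hY (a := a) ⟨fun b z => ?_, fun b z => ?_⟩ fun h => hcH ?_)
  · rw [← hg z, ← translation_smul, ← mul_smul, ha, ha, mul_smul, translation_smul]
  · rw [← hg b, ha, ← translation_smul, ← translation_smul, ← mul_smul, translation_smul_eq,
      translation_smul_eq]
    congr 1
    rw [mul_inv_rev, mul_assoc (g b), hc.eq]
    group
  · have h1 := ha 1
    rw [h] at h1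
    simpa using h1.symm

theorem card_eq_mul [Finite Y] (hY : IsConnected Y) (y : Y) :
    (MulAction.stabilizer (Inn Y) y).relIndex (centr (translation y)) *
      Nat.card (Conjugates (translation y)) = Nat.card Y := by
  have : MulAction.IsPretransitive (Inn Y) Y := hY
  rw [← MulAction.index_stabilizer_of_transitive (Inn Y) y,
    ← MulAction.index_stabilizer_of_transitive (Inn Y) (Conjugates.base (translation y))]
  exact Subgroup.relIndex_mul_index (stabilizer_le_centr y)

theorem self_normalizing_subgroupOf [Finite Y] (hY : IsConnected Y)
    (hne : ¬ IsAbelianExtension Y) (y : Y) (c : centr (translation y))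
    (hn : ∀ h, c * h * c⁻¹ ∈ (MulAction.stabilizer (Inn Y) y).subgroupOf (centr (translation y)) ↔
      h ∈ (MulAction.stabilizer (Inn Y) y).subgroupOf (centr (translation y))) :
    c ∈ (MulAction.stabilizer (Inn Y) y).subgroupOf (centr (translation y)) := by
  refine Subgroup.mem_subgroupOf.2 (mem_stabilizer_of_normalizing hY hne (mem_centr.1 c.2)
    fun h => ⟨fun hh => ?_, fun hh => ?_⟩)
  · have h1 : h ∈ centr (translation y) := by
      have := stabilizer_le_centr y hh
      exact (Subgroup.mul_mem_cancel_left _ c.2).1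
        ((Subgroup.mul_mem_cancel_right _ ((centr (translation y)).inv_mem c.2)).1 this)
    exact (hn ⟨h, h1⟩).1 hh
  · exact (hn ⟨h, stabilizer_le_centr y hh⟩).2 hh

theorem stabilizer_subgroupOf_ne_top [Finite Y] (hY : IsConnected Y) (hnf : ¬ IsFaithful Y)
    (y : Y) : (MulAction.stabilizer (Inn Y) y).subgroupOf (centr (translation y)) ≠ ⊤ := by
  have : MulAction.IsPretransitive (Inn Y) Y := hY
  intro htop
  rw [Subgroup.subgroupOf_eq_top] at htop
  refine hnf fun a b hab => ?_
  have hab' : translation a = translation b := translation_eq_iff.2 hab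
  obtain ⟨g, rfl⟩ := MulAction.exists_smul_eq (Inn Y) y a
  obtain ⟨k, rfl⟩ := MulAction.exists_smul_eq (Inn Y) y b
  rw [translation_smul_eq, translation_smul_eq] at hab'
  have h1 : k⁻¹ * g ∈ centr (translation y) := by
    rw [mem_centr, commute_iff_eq]
    have := congrArg (fun z => k⁻¹ * z * g) hab'
    simpa [mul_assoc] using this
  have h2 := MulAction.mem_stabilizer_iff.1 (htop h1)
  rwa [mul_smul, inv_smul_eq_iff] at h2

open scoped Nat in
theorem core_index_dvd_factorial {C : Type*} [Group C] (H : Subgroup C) [H.FiniteIndex] :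
    H.normalCore.index ∣ H.index ! := by
  have : Finite (C ⧸ H) := inferInstance
  rw [Subgroup.normalCore_eq_ker, Subgroup.index_ker, Subgroup.index_eq_card, ← Nat.card_perm]
  exact Subgroup.card_subgroup_dvd_card (MulAction.toPermHom C (C ⧸ H)).range

theorem three_le_relIndex [Finite Y] (hY : IsConnected Y) (hne : ¬ IsAbelianExtension Y)
    (hnf : ¬ IsFaithful Y) (y : Y) :
    3 ≤ (MulAction.stabilizer (Inn Y) y).relIndex (centr (translation y)) := by
  set H := (MulAction.stabilizer (Inn Y) y).subgroupOf (centr (translation y)) with hH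
  change 3 ≤ H.index
  have h0 : H.index ≠ 0 := Subgroup.index_ne_zero_of_finite
  have h1 : H.index ≠ 1 := fun h => stabilizer_subgroupOf_ne_top hY hnf y (Subgroup.index_eq_one.1 h)
  have h2 : H.index ≠ 2 := by
    intro h2
    have := Subgroup.normal_of_index_eq_two h2
    refine stabilizer_subgroupOf_ne_top hY hnf y (eq_top_iff.2 fun c _ =>
      self_normalizing_subgroupOf hY hne y c fun h => ?_)
    exact (Subgroup.Normal.mem_comm_iff (H := H) ‹_›).trans (by simp [hH])
  omega

/-- The translations of a connected non-faithful quandle of order less than `48` which is not an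
abelian extension. -/
theorem hasClass_translation [Finite Y] (hY : IsConnected Y) (hne : ¬ IsAbelianExtension Y)
    (hnf : ¬ IsFaithful Y) (hcard : Nat.card Y < 48) (y : Y) :
    HasClass (translation y) (transpositions 5).carrier ∨
      HasClass (translation y) transvections.carrier ∨
      HasClass (translation y) (transpositions 6).carrier := by
  have hgen := isGenClass_translation hY hne y
  have hk := three_le_relIndex hY hne hnf y
  have hmul := card_eq_mul hY y
  set t := translation y with ht
  have hn : Nat.card (Conjugates t) ≤ 15 := by nlinarith
  set H := (MulAction.stabilizer (Inn Y) y).subgroupOf (centr t) with hH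
  let T := (Subgroup.zpowers t).subgroupOf (centr t)
  have hTH : T ≤ H := by
    intro u hu
    have h1 : Subgroup.zpowers t ≤ MulAction.stabilizer (Inn Y) y :=
      (Subgroup.zpowers_le).2 (translation_mem_stabilizer y)
    exact h1 hu
  have hTn : T.Normal := by
    refine ⟨fun u hu c => ?_⟩
    obtain ⟨i, hi⟩ := Subgroup.mem_zpowers_iff.1 (Subgroup.mem_subgroupOf.1 hu)
    have h1 : c * u = u * c := by
      refine Subtype.ext ?_
      change c.1 * u.1 = u.1 * c.1
      rw [← hi, ((mem_centr.1 c.2).zpow_right i).eq]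
    rwa [h1, mul_inv_cancel_right]
  by_contra hcon
  have key : ∀ {p : ℕ}, p.Prime → (∀ v : Inn Y, Commute v t → v ^ p ∈ Subgroup.zpowers t →
      ∀ b, v ^ p ^ b = 1 → v ∈ Subgroup.zpowers t) → ¬ p ∣ H.normalCore.index := by
    intro p hp hv
    refine not_dvd_core_index hTH hp fun u b hub => ?_
    by_contra huT
    obtain ⟨i, hi, hi'⟩ := exists_pow_notMem_of_pow_prime_pow_eq_one hub huT
    refine hi (Subgroup.mem_subgroupOf.2 (hv _ (mem_centr.1 (u ^ i).2) hi' b ?_))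
    have : (u ^ i) ^ p ^ b = 1 := by rw [← pow_mul, mul_comm, pow_mul, hub, one_pow]
    exact congrArg Subtype.val this
  have h3 : ¬ 3 ∣ H.normalCore.index := key Nat.prime_three fun v hv hv3 b hvb => by
    by_contra hvt
    exact hcon (hgen.hasClass hn hv hv3 hvb hvt)
  have hk' : H.index = (MulAction.stabilizer (Inn Y) y).relIndex (centr t) := rfl
  obtain ⟨c, hcH, hc⟩ := exists_normalizing_of_core_index
    (stabilizer_subgroupOf_ne_top hY hnf y) (by
      intro p hp hpd
      by_contra hp2
      have hp3 : p ≠ 3 := fun h => h3 (h ▸ hpd)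
      have hp5 : 5 ≤ p := by
        have := hp.two_le
        have : p ≠ 4 := by rintro rfl; revert hp; decide
        omega
      by_cases h5 : 5 ≤ H.index
      · refine key hp (fun v hv hvp b hvb => ?_) hpd
        refine hgen.mem_zpowers_of_five_le ?_ hp hp5 hv hvb hvp
        rw [← hk'] at hmul
        nlinarith
      · have h1 := hpd.trans (core_index_dvd_factorial H)
        have := (Nat.Prime.dvd_factorial hp).1 h1
        omega)
  exact hcH (self_normalizing_subgroupOf hY hne y c hc)

end Reduction

end RigQuandle

open scoped Quandles

namespace RigQuandle

theorem isomorphic_of_mulEquiv {Y Z : Type*} [Quandle Y] [Quandle Z] (hY : IsConnected Y)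
    (hZ : IsConnected Z) (Φ : Inn Y ≃* Inn Z) {y : Y} {z : Z}
    (ht : Φ (translation y) = translation z) (hst : ∀ g, g • y = y ↔ Φ g • z = z) :
    Isomorphic Y Z := by
  have : MulAction.IsPretransitive (Inn Y) Y := hY
  have : MulAction.IsPretransitive (Inn Z) Z := hZ
  choose g hg using fun a => MulAction.exists_smul_eq (Inn Y) y a
  have hiff : ∀ k l : Inn Y, Φ k • z = Φ l • z ↔ k • y = l • y := by
    intro k l
    have h1 : Φ k • z = Φ l • z ↔ Φ (l⁻¹ * k) • z = z := by
      rw [map_mul, map_inv, mul_smul, inv_smul_eq_iff]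
    rw [h1, ← hst, mul_smul, inv_smul_eq_iff]
  have hf : ∀ k : Inn Y, Φ (g (k • y)) • z = Φ k • z := fun k => (hiff _ _).2 (hg _)
  refine ⟨⟨fun a => Φ (g a) • z, fun {a b} => ?_⟩, fun a b hab => ?_, fun c => ?_⟩
  · have h1 : a ◃ b = (translation a * g b) • y := by rw [mul_smul, hg, translation_smul]
    have h2 : translation a = g a * translation y * (g a)⁻¹ := by
      rw [← translation_smul_eq, hg]
    rw [h1, hf, map_mul, mul_smul, h2, map_mul, map_mul, map_inv, ht, ← translation_smul_eq,
      translation_smul]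
  · rw [← hg a, ← hg b, (hiff _ _).1 hab]
  · obtain ⟨k, rfl⟩ := MulAction.exists_smul_eq (Inn Z) z c
    exact ⟨Φ.symm k • y, (hf _).trans (by rw [MulEquiv.apply_symm_apply])⟩

section GroupOfClass

variable {G G' K : Type*} [Group G] [Group G'] [Group K] {S : Set K}

theorem IsGenClass.toPermHom_injective {t : G} (h : IsGenClass t) :
    Function.Injective (MulAction.toPermHom G (Conjugates t)) := by
  rw [injective_iff_map_eq_one]
  intro g hg
  exact h.eq_one_of_commute fun z => congrArg (fun f : Equiv.Perm (Conjugates t) => f z) hg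

/-- A group without centre generated by a class of conjugates is determined by the class. -/
theorem IsGenClass.exists_mulEquiv {t : G} {t' : G'} (h : IsGenClass t) (h' : IsGenClass t')
    (hS : HasClass t S) (hS' : HasClass t' S) : ∃ Φ : G ≃* G', IsConj t' (Φ t) := by
  obtain ⟨θ, hθ, hr, hop⟩ := hS
  obtain ⟨θ', hθ', hr', hop'⟩ := hS'
  let φ : Conjugates t ≃ Conjugates t' := (Equiv.ofInjective θ hθ).trans
    ((Equiv.setCongr (hr.trans hr'.symm)).trans (Equiv.ofInjective θ' hθ').symm)
  have hφ : ∀ a, θ' (φ a) = θ a := fun a => Equiv.apply_ofInjective_symm hθ' _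
  have hφop : ∀ a b : Conjugates t, φ (b.1 • a) = (φ b).1 • φ a := by
    intro a b
    apply hθ'
    rw [hop', hφ, hφ, hφ, hop]
  let ρ : G →* Equiv.Perm (Conjugates t') :=
    φ.permCongrHom.toMonoidHom.comp (MulAction.toPermHom G (Conjugates t))
  let ρ' : G' →* Equiv.Perm (Conjugates t') := MulAction.toPermHom G' (Conjugates t')
  have hρ : Function.Injective ρ := φ.permCongrHom.injective.comp h.toPermHom_injective
  have hρ' : Function.Injective ρ' := h'.toPermHom_injective
  have hz : ∀ z : Conjugates t, ρ z.1 = ρ' (φ z).1 := by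
    intro z
    ext a
    obtain ⟨b, rfl⟩ := φ.surjective a
    have h1 : ρ z.1 (φ b) = φ (z.1 • φ.symm (φ b)) := rfl
    have h2 : ρ' (φ z).1 (φ b) = (φ z).1 • φ b := rfl
    rw [h1, h2, Equiv.symm_apply_apply, hφop]
  have hrange : ρ.range = ρ'.range := by
    rw [MonoidHom.range_eq_map, MonoidHom.range_eq_map, ← h.gen, ← h'.gen, MonoidHom.map_closure,
      MonoidHom.map_closure]
    congr 1
    ext f
    constructor
    · rintro ⟨z, hzt, rfl⟩
      exact ⟨(φ ⟨z, hzt⟩).1, (φ ⟨z, hzt⟩).2, (hz ⟨z, hzt⟩).symm⟩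
    · rintro ⟨z, hzt, rfl⟩
      obtain ⟨w, hw⟩ := φ.surjective ⟨z, hzt⟩
      exact ⟨w.1, w.2, by rw [hz, hw]⟩
  let Φ : G ≃* G' := (MonoidHom.ofInjective hρ).trans
    ((MulEquiv.subgroupCongr hrange).trans (MonoidHom.ofInjective hρ').symm)
  have hΦ : ∀ g, ρ' (Φ g) = ρ g := fun g => MonoidHom.apply_ofInjective_symm hρ' _
  refine ⟨Φ, ?_⟩
  have h1 : Φ t = (φ (Conjugates.base t)).1 := hρ' (by rw [hΦ, ← hz]; rfl)
  rw [h1]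
  exact (φ (Conjugates.base t)).2

theorem IsGenClass.card_dvd {t : G} (h : IsGenClass t) (hS : HasClass t S) (A : Subgroup K)
    (hA : S ⊆ A) : Nat.card G ∣ Nat.card A := by
  obtain ⟨θ, hθ, hr, hop⟩ := hS
  let L : Subgroup (G × K) := Subgroup.closure (Set.range fun z : Conjugates t => (z.1, θ z))
  have hL : ∀ p ∈ L, p.2 ∈ A ∧ ∀ a, θ (p.1 • a) = p.2 * θ a * p.2⁻¹ := by
    intro p hp
    induction hp using Subgroup.closure_induction with
    | mem x hx =>
      obtain ⟨z, rfl⟩ := hx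
      exact ⟨hA (hr ▸ Set.mem_range_self z), fun a => hop a z⟩
    | one => exact ⟨A.one_mem, fun a => by simp⟩
    | mul x y _ _ hx hy =>
      refine ⟨A.mul_mem hx.1 hy.1, fun a => ?_⟩
      rw [Prod.fst_mul, mul_smul, hx.2, hy.2, Prod.snd_mul]
      group
    | inv x _ hx =>
      refine ⟨A.inv_mem hx.1, fun a => ?_⟩
      have := hx.2 (x.1⁻¹ • a)
      rw [smul_inv_smul] at this
      rw [this, Prod.fst_inv, Prod.snd_inv]
      group
  let f : L →* A :=
    { toFun := fun p => ⟨p.1.2, (hL p.1 p.2).1⟩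
      map_one' := rfl
      map_mul' := fun _ _ => rfl }
  have hf : Function.Injective f := by
    rw [injective_iff_map_eq_one]
    intro p hp
    have h2 : p.1.2 = 1 := congrArg Subtype.val hp
    have h1 : p.1.1 = 1 := h.eq_one_of_commute fun z => hθ (by rw [(hL p.1 p.2).2, h2]; simp)
    exact Subtype.ext (Prod.ext h1 h2)
  let k : L →* G := (MonoidHom.fst G K).comp L.subtype
  have hk : Function.Surjective k := by
    rw [← MonoidHom.range_eq_top, eq_top_iff, ← h.gen, Subgroup.closure_le]
    intro z hz
    exact ⟨⟨_, Subgroup.subset_closure ⟨⟨z, hz⟩, rfl⟩⟩, rfl⟩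
  exact (Subgroup.card_dvd_of_surjective k hk).trans (Subgroup.card_dvd_of_injective f hf)

theorem IsGenClass.pow_eq_one {t : G} (h : IsGenClass t) (hS : HasClass t S) {m : ℕ}
    (hm : ∀ s ∈ S, s ^ m = 1) : t ^ m = 1 := by
  obtain ⟨θ, hθ, hr, hop⟩ := hS
  refine h.eq_one_of_commute fun a => hθ ?_
  have h1 : ∀ n : ℕ, θ (t ^ n • a) =
      θ (Conjugates.base t) ^ n * θ a * (θ (Conjugates.base t) ^ n)⁻¹ := by
    intro n
    induction n with
    | zero => simp
    | succ n ih =>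
      rw [pow_succ', mul_smul]
      refine (hop _ (Conjugates.base t)).trans ?_
      rw [ih, pow_succ']
      group
  rw [h1, hm _ (hr ▸ Set.mem_range_self _)]
  simp

theorem HasClass.card_eq {t : G} (hS : HasClass t S) : Nat.card (Conjugates t) = Nat.card S := by
  obtain ⟨θ, hθ, rfl, -⟩ := hS
  exact Nat.card_congr (Equiv.ofInjective θ hθ)

end GroupOfClass

section Sylow

/-- A subgroup of odd index, generated by a central subgroup and a Sylow `2`-subgroup. -/
theorem exists_sylow_two_sup_eq {C : Type*} [Group C] [Finite C] {Z H : Subgroup C} (hZH : Z ≤ H)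
    (hodd : ¬ 2 ∣ H.index)
    (hlcm : Nat.card H ∣ Nat.lcm (Nat.card Z) (2 ^ (Nat.card H).factorization 2)) :
    ∃ P : Sylow 2 C, H = Z ⊔ P := by
  have : Fact (Nat.Prime 2) := ⟨Nat.prime_two⟩
  obtain ⟨Q⟩ : Nonempty (Sylow 2 H) := inferInstance
  have hQ : IsPGroup 2 ((Q : Subgroup H).map H.subtype) := Q.isPGroup'.map _
  have hi : ¬ 2 ∣ ((Q : Subgroup H).map H.subtype).index := by
    rw [Subgroup.index_map_subtype, Nat.Prime.dvd_mul Nat.prime_two]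
    rintro (h | h)
    · exact Q.not_dvd_index h
    · exact hodd h
  have hle : Z ⊔ (Q : Subgroup H).map H.subtype ≤ H := sup_le hZH (Subgroup.map_subtype_le _)
  refine ⟨hQ.toSylow hi, ?_⟩
  change H = Z ⊔ (Q : Subgroup H).map H.subtype
  symm
  apply Subgroup.eq_of_le_of_card_ge hle
  apply Nat.le_of_dvd Nat.card_pos
  refine hlcm.trans (Nat.lcm_dvd (Subgroup.card_dvd_of_le le_sup_left) ?_)
  refine dvd_trans ?_ (Subgroup.card_dvd_of_le le_sup_right)
  rw [Subgroup.card_map_of_injective H.subtype_injective, Q.card_eq_multiplicity]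

theorem exists_conj_of_sylow_two {C : Type*} [Group C] [Finite C] {Z H H' : Subgroup C}
    (hZ : ∀ z ∈ Z, ∀ c, Commute c z) (P P' : Sylow 2 C) (hP : H = Z ⊔ P) (hP' : H' = Z ⊔ P') :
    ∃ c : C, ∀ h, h ∈ H ↔ c * h * c⁻¹ ∈ H' := by
  have : Fact (Nat.Prime 2) := ⟨Nat.prime_two⟩
  obtain ⟨c, rfl⟩ := MulAction.exists_smul_eq C P P'
  refine ⟨c, ?_⟩
  have hmap : H.map (MulAut.conj c).toMonoidHom = H' := by
    rw [hP, hP', Subgroup.map_sup]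
    congr 1
    ext z
    constructor
    · rintro ⟨z, hz, rfl⟩
      change c * z * c⁻¹ ∈ Z
      rwa [(hZ z hz c).eq, mul_inv_cancel_right]
    · intro hz
      refine ⟨z, hz, ?_⟩
      change c * z * c⁻¹ = z
      rw [(hZ z hz c).eq, mul_inv_cancel_right]
  intro h
  rw [← hmap]
  constructor
  · intro hh
    exact ⟨h, hh, rfl⟩
  · rintro ⟨k, hk, hkh⟩
    have : k = h := (MulAut.conj c).injective hkh
    rwa [← this]

theorem exists_conj_of_card {G : Type*} [Group G] [Finite G] {t : G} {H H' : Subgroup G}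
    (hH : H ≤ centr t) (hH' : H' ≤ centr t) (ht : t ∈ H) (ht' : t ∈ H')
    (hcard : 3 * Nat.card H = Nat.card (centr t)) (hcard' : 3 * Nat.card H' = Nat.card (centr t))
    (hlcm : Nat.card H ∣ Nat.lcm (orderOf t) (2 ^ (Nat.card H).factorization 2)) :
    ∃ c, Commute c t ∧ ∀ h, h ∈ H ↔ c * h * c⁻¹ ∈ H' := by
  have hHH' : Nat.card H' = Nat.card H := by omega
  let Z := (Subgroup.zpowers t).subgroupOf (centr t)
  have hsub : ∀ {K : Subgroup G}, K ≤ centr t → Nat.card (K.subgroupOf (centr t)) = Nat.card K :=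
    fun hK => Nat.card_congr (Subgroup.subgroupOfEquivOfLe hK).toEquiv
  have key : ∀ K : Subgroup G, K ≤ centr t → t ∈ K → Nat.card K = Nat.card H →
      ∃ P : Sylow 2 (centr t), K.subgroupOf (centr t) = Z ⊔ P := by
    intro K hK htK hKH
    have hzK : Subgroup.zpowers t ≤ K := Subgroup.zpowers_le.2 htK
    refine exists_sylow_two_sup_eq (fun z hz => hzK hz) ?_ ?_
    · have h1 := (K.subgroupOf (centr t)).card_mul_index
      rw [hsub hK, hKH, ← hcard, mul_comm] at h1
      have h2 : (K.subgroupOf (centr t)).index = 3 := Nat.eq_of_mul_eq_mul_right Nat.card_pos h1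
      rw [h2]
      decide
    · rw [hsub hK, hKH, hsub (hzK.trans hK), Nat.card_zpowers]
      exact hlcm
  obtain ⟨P, hP⟩ := key H hH ht rfl
  obtain ⟨P', hP'⟩ := key H' hH' ht' hHH'
  have hZ : ∀ z ∈ Z, ∀ c, Commute c z := by
    intro z hz c
    obtain ⟨i, hi⟩ := Subgroup.mem_zpowers_iff.1 (Subgroup.mem_subgroupOf.1 hz)
    refine Subtype.ext ?_
    change c.1 * z.1 = z.1 * c.1
    rw [← hi, ((mem_centr.1 c.2).zpow_right i).eq]
  obtain ⟨c, hc⟩ := exists_conj_of_sylow_two hZ P P' hP hP'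
  refine ⟨c, mem_centr.1 c.2, fun h => ⟨fun hh => ?_, fun hh => ?_⟩⟩
  · exact (hc ⟨h, hH hh⟩).1 hh
  · have h1 : h ∈ centr t :=
      (Subgroup.mul_mem_cancel_left _ c.2).1
        ((Subgroup.mul_mem_cancel_right _ ((centr t).inv_mem c.2)).1 (hH' hh))
    exact (hc ⟨h, h1⟩).2 hh

end Sylow

theorem isomorphic_of_hasClass {Y Z : Type*} [Quandle Y] [Quandle Z] [Finite Y] [Finite Z]
    (hY : IsConnected Y) (hZ : IsConnected Z) {y : Y} {z : Z} (hgy : IsGenClass (translation y))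
    (hgz : ∀ z : Z, IsGenClass (translation z)) {K : Type*} [Group K] {S : Set K}
    (hSy : HasClass (translation y) S) (hSz : HasClass (translation z) S)
    (hcy : 3 * Nat.card (MulAction.stabilizer (Inn Y) y) = Nat.card (centr (translation y)))
    (hcz : ∀ z : Z, 3 * Nat.card (MulAction.stabilizer (Inn Z) z) =
      Nat.card (centr (translation z)))
    (hlcm : Nat.card (MulAction.stabilizer (Inn Y) y) ∣ Nat.lcm (orderOf (translation y))
      (2 ^ (Nat.card (MulAction.stabilizer (Inn Y) y)).factorization 2)) : Isomorphic Y Z := by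
  obtain ⟨Φ, hΦ⟩ := hgy.exists_mulEquiv (hgz z) hSy hSz
  obtain ⟨z, hz⟩ := exists_translation_eq hΦ
  have hinj : Function.Injective Φ.toMonoidHom := Φ.injective
  set H := (MulAction.stabilizer (Inn Y) y).map Φ.toMonoidHom with hH
  have hHcard : Nat.card H = Nat.card (MulAction.stabilizer (Inn Y) y) :=
    Subgroup.card_map_of_injective hinj
  have hcentr : (centr (translation y)).map Φ.toMonoidHom = centr (translation z) := by
    ext g
    rw [mem_centr, hz]
    constructor
    · rintro ⟨k, hk, rfl⟩
      exact (mem_centr.1 hk).map Φ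
    · intro hg
      refine ⟨Φ.symm g, mem_centr.2 ?_, Φ.apply_symm_apply g⟩
      have := hg.map Φ.symm
      rwa [Φ.symm_apply_apply] at this
  have hCcard : Nat.card (centr (translation z)) = Nat.card (centr (translation y)) := by
    rw [← hcentr]
    exact Subgroup.card_map_of_injective hinj
  obtain ⟨c, hct, hc⟩ := exists_conj_of_card (t := translation z) (H := H)
    (H' := MulAction.stabilizer (Inn Z) z)
    (hcentr ▸ Subgroup.map_mono (stabilizer_le_centr y)) (stabilizer_le_centr z)
    (hz ▸ Subgroup.mem_map_of_mem _ (translation_mem_stabilizer y)) (translation_mem_stabilizer z)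
    (by rw [hHcard, hCcard, hcy]) (hcz z)
    (by
      rw [hHcard, hz]
      have : orderOf (Φ (translation y)) = orderOf (translation y) :=
        orderOf_injective Φ.toMonoidHom hinj _
      rw [this]
      exact hlcm)
  refine isomorphic_of_mulEquiv hY hZ Φ (y := y) (z := c⁻¹ • z) ?_ fun g => ?_
  · rw [translation_smul_eq, ← hz, hct.inv_left.eq, mul_inv_cancel_right]
  · have h1 : g • y = y ↔ Φ g ∈ H := by
      constructor
      · intro hg
        exact ⟨g, hg, rfl⟩
      · rintro ⟨k, hk, hkg⟩
        rw [← hinj hkg]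
        exact hk
    rw [h1, hc, MulAction.mem_stabilizer_iff, mul_smul, mul_smul]
    exact (eq_inv_smul_iff).symm

end RigQuandle

open scoped Quandles

namespace RigQuandle

section Enumeration

variable {Y : Type*} [Quandle Y] [DecidableEq Y]

/-- Every element of the list but the last is the image of a later one under a translation by an
element of `gens`. -/
def IsLinked (gens : List Y) : List Y → Prop
  | [] => True
  | x :: l => (l = [] ∨ ∃ y ∈ l, ∃ g ∈ gens, g ◃ y = x) ∧ IsLinked gens l

instance decidableIsLinked (gens : List Y) : ∀ l, Decidable (IsLinked gens l)
  | [] => inferInstanceAs (Decidable True)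
  | x :: l =>
    have := decidableIsLinked gens l
    inferInstanceAs (Decidable ((l = [] ∨ ∃ y ∈ l, ∃ g ∈ gens, g ◃ y = x) ∧ IsLinked gens l))

omit [DecidableEq Y] in
theorem IsLinked.exists_smul_eq {gens l : List Y} (h : IsLinked gens l) :
    ∀ x ∈ l, ∀ y ∈ l, ∃ g : Inn Y, g • x = y := by
  induction l with
  | nil => simp
  | cons x l ih =>
    obtain ⟨h1, h2⟩ := h
    have ih := ih h2
    have hx : ∀ y ∈ l, ∃ g : Inn Y, g • y = x := by
      rcases h1 with rfl | ⟨z, hz, g, -, rfl⟩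
      · simp
      · intro y hy
        obtain ⟨k, rfl⟩ := ih y hy z hz
        exact ⟨translation g * k, by rw [mul_smul, translation_smul]⟩
    intro a ha b hb
    rcases List.mem_cons.1 ha with rfl | ha' <;> rcases List.mem_cons.1 hb with rfl | hb'
    · exact ⟨1, one_smul _ _⟩
    · obtain ⟨g, hg⟩ := hx b hb'
      exact ⟨g⁻¹, by rw [← hg, inv_smul_smul]⟩
    · exact hx a ha'
    · exact ih a ha' b hb'

omit [DecidableEq Y] in
theorem isConnected_of_isLinked {gens l : List Y} (h : IsLinked gens l) (hl : ∀ y, y ∈ l) :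
    IsConnected Y :=
  ⟨fun x y => h.exists_smul_eq x (hl x) y (hl y)⟩

omit [DecidableEq Y] in
theorem not_isFaithful_of_mem {l : List Y} (hl : ∀ y, y ∈ l)
    (h : ∃ x ∈ l, ∃ y ∈ l, x ≠ y ∧ ∀ z ∈ l, x ◃ z = y ◃ z) : ¬ IsFaithful Y := by
  obtain ⟨x, -, y, -, hne, hz⟩ := h
  exact fun hf => hne (hf (Equiv.ext fun z => hz z (hl z)))

theorem card_eq_length {α : Type*} [DecidableEq α] {l : List α} (hl : ∀ y, y ∈ l)
    (hnd : l.Nodup) : Nat.card α = l.length := by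
  have : Fintype α := ⟨l.toFinset, fun y => List.mem_toFinset.2 (hl y)⟩
  rw [Nat.card_eq_fintype_card, ← List.toFinset_card_of_nodup hnd, ← Finset.card_univ]
  congr 1
  ext y
  simp [hl y]

omit [DecidableEq Y] in
/-- There is no fixed-point-free permutation as in `IsDeck`, if some product of translations fixes
a point but no other point with the same translation. -/
theorem IsDeck.false_of_word {l : List Y} (hl : ∀ y, y ∈ l) (x : Y) (w : List Y)
    (hx : w.foldr (fun a b => a ◃ b) x = x)
    (hw : ∀ y ∈ l, (∀ z ∈ l, y ◃ z = x ◃ z) → w.foldr (fun a b => a ◃ b) y = y → y = x)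
    {a : Equiv.Perm Y} (ha : IsDeck a) (hfix : ∀ y, a y ≠ y) : False := by
  have h1 : ∀ (w : List Y) (y : Y),
      a (w.foldr (fun a b => a ◃ b) y) = w.foldr (fun a b => a ◃ b) (a y) := by
    intro w y
    induction w with
    | nil => rfl
    | cons b w ih => rw [List.foldr_cons, List.foldr_cons, ha.map_act, ih]
  refine hfix x (hw (a x) (hl _) (fun z _ => ha.act_eq x z) ?_)
  rw [← h1, hx]

end Enumeration

instance {G : Type*} [Group G] [DecidableEq G] (C : ConjStable G) (P : Type*) [MulAction G P]
    [DecidableEq P] : DecidableEq (FixedPairs C P) :=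
  inferInstanceAs (DecidableEq {x : G × P // x.1 ∈ C.carrier ∧ x.1 • x.2 = x.2})

section Pointed

/-- A transposition of five letters and a fixed letter. -/
def pointedSwap (x : Fin 5 × Fin 5 × Fin 5)
    (h : x.1 ≠ x.2.1 ∧ Equiv.swap x.1 x.2.1 x.2.2 = x.2.2) : Q30_4 :=
  ⟨(Equiv.swap x.1 x.2.1, x.2.2), ⟨_, _, h.1, rfl⟩, h.2⟩

/-- The elements of `Q(30, 4)`. -/
def pointedSwaps : List Q30_4 :=
  List.pmap pointedSwap [
    (0, 1, 4), (0, 1, 3), (0, 2, 3), (1, 2, 3), (1, 2, 4), (0, 2, 4), (0, 3, 4), (1, 3, 4),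
    (2, 3, 4), (3, 4, 0), (3, 4, 1), (3, 4, 2), (2, 4, 3), (1, 4, 3), (0, 4, 3), (1, 4, 0),
    (0, 4, 1), (0, 4, 2), (1, 4, 2), (2, 4, 1), (2, 4, 0), (2, 3, 0), (2, 3, 1), (1, 3, 2),
    (0, 3, 2), (0, 3, 1), (1, 3, 0), (1, 2, 0), (0, 2, 1), (0, 1, 2)]
    (by decide +kernel)

theorem mem_pointedSwaps (x : Q30_4) : x ∈ pointedSwaps := by
  obtain ⟨⟨t, p⟩, ⟨i, j, hij, ht⟩, hp⟩ := x
  change t = Equiv.swap i j at ht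
  subst ht
  have key : ∀ i j p : Fin 5, i ≠ j → Equiv.swap i j p = p →
      ∃ y ∈ pointedSwaps, y.1 = (Equiv.swap i j, p) := by decide +kernel
  obtain ⟨y, hy, hyx⟩ := key i j p hij hp
  rwa [show (⟨(Equiv.swap i j, p), _⟩ : Q30_4) = y from Subtype.ext hyx.symm]

theorem Q30_4_card : Nat.card Q30_4 = 30 := card_eq_length mem_pointedSwaps (by decide +kernel)

theorem Q30_4_isConnected : IsConnected Q30_4 :=
  isConnected_of_isLinked (gens := pointedSwaps) (by decide +kernel) mem_pointedSwaps

theorem Q30_4_not_isFaithful : ¬ IsFaithful Q30_4 :=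
  not_isFaithful_of_mem mem_pointedSwaps (by decide +kernel)

theorem Q30_4_no_deck {a : Equiv.Perm Q30_4} (ha : IsDeck a) (hfix : ∀ y, a y ≠ y) : False :=
  IsDeck.false_of_word mem_pointedSwaps (pointedSwap (0, 1, 2) (by decide))
    [pointedSwap (3, 4, 0) (by decide)] (by decide +kernel) (by decide +kernel) ha hfix

end Pointed

section Flags

/-- The flag of the line with direction `x.1` through the point `x.2`. -/
def flag (x : Plane × Plane) (h : x.1 ≠ 0) : Q36_58 :=
  ⟨(Search.transvection x.1 x.2, x.2), ⟨x.1, x.2, h, fun _ => rfl⟩, by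
    change x.2 + area x.1 (x.2 - x.2) • x.1 = x.2
    simp [area]⟩

/-- The elements of `Q(36, 58)`. -/
def flags : List Q36_58 :=
  List.pmap flag [
    ((1, 2), (0, 2)), ((1, 1), (1, 2)), ((0, 1), (2, 2)), ((0, 1), (2, 1)), ((1, 2), (1, 1)),
    ((1, 1), (0, 1)), ((1, 2), (0, 1)), ((1, 1), (2, 1)), ((0, 1), (1, 1)), ((1, 1), (0, 2)),
    ((0, 1), (1, 2)), ((1, 2), (2, 2)), ((1, 0), (2, 0)), ((1, 1), (2, 2)), ((0, 1), (0, 2)),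
    ((1, 2), (1, 2)), ((1, 0), (1, 0)), ((1, 1), (1, 1)), ((0, 1), (0, 1)), ((1, 2), (2, 1)),
    ((1, 0), (2, 2)), ((1, 0), (0, 2)), ((1, 0), (1, 2)), ((1, 1), (1, 0)), ((0, 1), (1, 0)),
    ((1, 2), (1, 0)), ((1, 0), (1, 1)), ((1, 0), (0, 1)), ((1, 0), (2, 1)), ((1, 1), (2, 0)),
    ((0, 1), (2, 0)), ((1, 2), (2, 0)), ((1, 1), (0, 0)), ((0, 1), (0, 0)), ((1, 2), (0, 0)),
    ((1, 0), (0, 0))]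
    (by decide +kernel)

theorem transvection_eq_of_fixed {d r p : Plane} (hd : d ≠ 0)
    (hp : p + area d (p - r) • d = p) : Search.transvection d r = Search.transvection d p := by
  have h0 : area d (p - r) = 0 := by
    have : area d (p - r) • d = 0 := by simpa using hp
    exact (smul_eq_zero.1 this).resolve_right hd
  ext1 x
  change x + area d (x - r) • d = x + area d (x - p) • d
  have : area d (x - r) = area d (x - p) := by
    simp only [area, Prod.fst_sub, Prod.snd_sub] at h0 ⊢
    linear_combination h0
  rw [this]

theorem mem_flags (x : Q36_58) : x ∈ flags := by
  obtain ⟨⟨t, p⟩, ⟨d, r, hd, ht⟩, hp⟩ := x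
  have ht' : t = Search.transvection d p := by
    rw [← transvection_eq_of_fixed hd ((ht p).symm.trans hp)]
    exact Equiv.ext ht
  have key : ∀ d p : Plane, d ≠ 0 → ∃ y ∈ flags, y.1 = (Search.transvection d p, p) := by
    decide +kernel
  obtain ⟨y, hy, hyx⟩ := key d p hd
  rw [← ht'] at hyx
  rwa [show (⟨(t, p), _⟩ : Q36_58) = y from Subtype.ext hyx.symm]

theorem Q36_58_card : Nat.card Q36_58 = 36 := card_eq_length mem_flags (by decide +kernel)

theorem Q36_58_isConnected : IsConnected Q36_58 :=
  isConnected_of_isLinked (gens := [flag ((1, 0), (0, 0)) (by decide),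
    flag ((0, 1), (0, 0)) (by decide), flag ((1, 0), (0, 1)) (by decide),
    flag ((0, 1), (1, 0)) (by decide)]) (by decide +kernel) mem_flags

theorem Q36_58_not_isFaithful : ¬ IsFaithful Q36_58 :=
  not_isFaithful_of_mem mem_flags (by decide +kernel)

theorem Q36_58_no_deck {a : Equiv.Perm Q36_58} (ha : IsDeck a) (hfix : ∀ y, a y ≠ y) : False :=
  IsDeck.false_of_word mem_flags (flag ((1, 0), (0, 0)) (by decide))
    [flag ((1, 0), (0, 0)) (by decide), flag ((0, 1), (0, 0)) (by decide),
      flag ((1, 0), (0, 0)) (by decide), flag ((1, 0), (0, 0)) (by decide),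
      flag ((0, 1), (0, 0)) (by decide), flag ((1, 0), (0, 0)) (by decide)]
    (by decide +kernel) (by decide +kernel) ha hfix

end Flags

section Matchings

instance : DecidableEq PerfectMatching :=
  inferInstanceAs (DecidableEq {s : Equiv.Perm (Fin 6) // s * s = 1 ∧ ∀ x, s x ≠ x})

/-- The matching with the edges `{x₁, x₂}`, `{x₃, x₄}` and `{x₅, x₆}`. -/
def threeSwaps (x : Fin 6 × Fin 6 × Fin 6 × Fin 6 × Fin 6 × Fin 6) : Equiv.Perm (Fin 6) :=
  Equiv.swap x.1 x.2.1 * Equiv.swap x.2.2.1 x.2.2.2.1 * Equiv.swap x.2.2.2.2.1 x.2.2.2.2.2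

/-- The transposition `(x₁ x₂)` and the matching with the edges `{x₁, x₂}`, `{x₃, x₄}` and
`{x₅, x₆}`. -/
def markedMatching (x : Fin 6 × Fin 6 × Fin 6 × Fin 6 × Fin 6 × Fin 6)
    (h : x.1 ≠ x.2.1 ∧ (threeSwaps x * threeSwaps x = 1 ∧ ∀ i, threeSwaps x i ≠ i) ∧
      Equiv.swap x.1 x.2.1 * threeSwaps x * (Equiv.swap x.1 x.2.1)⁻¹ = threeSwaps x) : Q45_29 :=
  ⟨(Equiv.swap x.1 x.2.1, ⟨threeSwaps x, h.2.1⟩), ⟨_, _, h.1, rfl⟩, Subtype.ext h.2.2⟩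

/-- The elements of `Q(45, 29)`. -/
def markedMatchings : List Q45_29 :=
  List.pmap markedMatching [
    (2, 3, 0, 1, 4, 5), (4, 5, 0, 3, 1, 2), (4, 5, 0, 2, 1, 3), (4, 5, 0, 1, 2, 3),
    (0, 5, 1, 2, 3, 4), (1, 5, 0, 2, 3, 4), (2, 5, 0, 1, 3, 4), (3, 5, 0, 1, 2, 4),
    (3, 5, 0, 2, 1, 4), (3, 5, 0, 4, 1, 2), (2, 5, 0, 4, 1, 3), (2, 5, 0, 3, 1, 4),
    (1, 5, 0, 3, 2, 4), (0, 5, 1, 3, 2, 4), (0, 5, 1, 4, 2, 3), (1, 5, 0, 4, 2, 3),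
    (1, 2, 0, 5, 3, 4), (0, 2, 1, 5, 3, 4), (0, 1, 2, 5, 3, 4), (0, 1, 2, 4, 3, 5),
    (0, 2, 1, 4, 3, 5), (1, 2, 0, 4, 3, 5), (2, 3, 0, 5, 1, 4), (2, 3, 0, 4, 1, 5),
    (1, 3, 0, 4, 2, 5), (0, 3, 1, 4, 2, 5), (0, 3, 1, 5, 2, 4), (1, 3, 0, 5, 2, 4),
    (1, 4, 0, 5, 2, 3), (0, 4, 1, 5, 2, 3), (0, 4, 1, 3, 2, 5), (1, 4, 0, 3, 2, 5),
    (2, 4, 0, 3, 1, 5), (2, 4, 0, 5, 1, 3), (3, 4, 0, 5, 1, 2), (3, 4, 0, 2, 1, 5),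
    (3, 4, 0, 1, 2, 5), (2, 4, 0, 1, 3, 5), (1, 4, 0, 2, 3, 5), (0, 4, 1, 2, 3, 5),
    (0, 3, 1, 2, 4, 5), (1, 3, 0, 2, 4, 5), (1, 2, 0, 3, 4, 5), (0, 2, 1, 3, 4, 5),
    (0, 1, 2, 3, 4, 5)]
    (by decide +kernel)

theorem mem_markedMatchings (x : Q45_29) : x ∈ markedMatchings := by
  obtain ⟨⟨t, ⟨s, hs, hs'⟩⟩, ⟨i, j, hij, ht⟩, hp⟩ := x
  change t = Equiv.swap i j at ht
  subst ht
  have key : ∀ s : Equiv.Perm (Fin 6), s * s = 1 → (∀ x, s x ≠ x) → ∀ i j, i ≠ j →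
      Equiv.swap i j * s * (Equiv.swap i j)⁻¹ = s →
      ∃ y ∈ markedMatchings, y.1.1 = Equiv.swap i j ∧ y.1.2.1 = s := by decide +kernel
  obtain ⟨y, hy, h1, h2⟩ := key s hs hs' i j hij (congrArg Subtype.val hp)
  have hyx : y.1 = (Equiv.swap i j, ⟨s, hs, hs'⟩) := Prod.ext h1 (Subtype.ext h2)
  rwa [show (⟨(Equiv.swap i j, ⟨s, hs, hs'⟩), _⟩ : Q45_29) = y from Subtype.ext hyx.symm]

theorem Q45_29_card : Nat.card Q45_29 = 45 := card_eq_length mem_markedMatchings (by decide +kernel)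

theorem Q45_29_isConnected : IsConnected Q45_29 :=
  isConnected_of_isLinked (gens := markedMatchings) (by decide +kernel) mem_markedMatchings

theorem Q45_29_not_isFaithful : ¬ IsFaithful Q45_29 :=
  not_isFaithful_of_mem mem_markedMatchings (by decide +kernel)

theorem Q45_29_no_deck {a : Equiv.Perm Q45_29} (ha : IsDeck a) (hfix : ∀ y, a y ≠ y) : False :=
  IsDeck.false_of_word mem_markedMatchings
    (markedMatching (0, 1, 2, 3, 4, 5) (by decide +kernel))
    [markedMatching (2, 3, 0, 1, 4, 5) (by decide +kernel)] (by decide +kernel)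
    (by decide +kernel) ha hfix

end Matchings

end RigQuandle

open scoped Quandles

namespace RigQuandle

section ClassCards

theorem card_coe_eq_length {K : Type*} [DecidableEq K] {S : Set K} {l : List K} (hnd : l.Nodup)
    (hS : ∀ s, s ∈ S ↔ s ∈ l) : Nat.card S = l.length := by
  have : S = (l.toFinset : Set K) := by
    ext s
    rw [hS]
    simp
  rw [this, Nat.card_coe_set_eq, Set.ncard_coe_finset, List.toFinset_card_of_nodup hnd]

theorem card_transpositions_five : Nat.card (transpositions 5).carrier = 10 :=
  card_coe_eq_length (l := Search.swaps [(0, 1), (0, 2), (0, 3), (0, 4), (1, 2), (1, 3), (1, 4),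
    (2, 3), (2, 4), (3, 4)]) (by decide +kernel) (Search.mem_swaps_iff (by decide) (by decide))

theorem card_transpositions_six : Nat.card (transpositions 6).carrier = 15 :=
  card_coe_eq_length (l := Search.swaps [(0, 1), (0, 2), (0, 3), (0, 4), (0, 5), (1, 2), (1, 3),
    (1, 4), (1, 5), (2, 3), (2, 4), (2, 5), (3, 4), (3, 5), (4, 5)]) (by decide +kernel)
    (Search.mem_swaps_iff (by decide) (by decide))

theorem card_transvections : Nat.card transvections.carrier = 12 :=
  card_coe_eq_length (by decide +kernel) (Search.mem_transvections_iff
    (l := [((0, 1), (0, 0)), ((0, 1), (1, 0)), ((0, 1), (2, 0)), ((1, 0), (0, 0)),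
      ((1, 0), (0, 1)), ((1, 0), (0, 2)), ((1, 1), (0, 0)), ((1, 1), (0, 1)), ((1, 1), (0, 2)),
      ((1, 2), (0, 0)), ((1, 2), (0, 1)), ((1, 2), (0, 2))]) (by decide +kernel)
    (by decide +kernel))

theorem sq_eq_one_of_mem_transpositions {n : ℕ} {s : Equiv.Perm (Fin n)}
    (hs : s ∈ (transpositions n).carrier) : s ^ 2 = 1 := by
  obtain ⟨a, b, -, rfl⟩ := hs
  rw [pow_two, Equiv.swap_mul_self]

theorem pow_three_eq_one_of_mem_transvections {s : Equiv.Perm Plane}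
    (hs : s ∈ transvections.carrier) : s ^ 3 = 1 := by
  obtain ⟨d, r, -, hs⟩ := hs
  ext1 x
  rw [pow_three, Equiv.Perm.mul_apply, Equiv.Perm.mul_apply, Equiv.Perm.one_apply]
  have harea : ∀ y, area d (s y - r) = area d (y - r) := by
    intro y
    rw [hs]
    simp only [area, Prod.fst_add, Prod.snd_add, Prod.fst_sub, Prod.snd_sub, Prod.smul_fst,
      Prod.smul_snd, smul_eq_mul]
    ring
  have h1 : s (s (s x)) = x + (3 : ZMod 3) • area d (x - r) • d := by
    rw [hs (s (s x)), harea, harea, hs (s x), harea, hs x]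
    module
  rw [h1, show (3 : ZMod 3) = 0 from rfl, zero_smul, add_zero]

/-- The affine maps of the plane that preserve the area form. -/
def specialAffine : Subgroup (Equiv.Perm Plane) where
  carrier := {g | (∀ x y z, g (x - y + z) = g x - g y + g z) ∧
    ∀ x y z, area (g x - g z) (g y - g z) = area (x - z) (y - z)}
  one_mem' := ⟨fun _ _ _ => rfl, fun _ _ _ => rfl⟩
  mul_mem' := by
    rintro g k ⟨hg, hg'⟩ ⟨hk, hk'⟩
    refine ⟨fun x y z => ?_, fun x y z => ?_⟩
    · simp only [Equiv.Perm.mul_apply, hk, hg]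
    · simp only [Equiv.Perm.mul_apply, hk', hg']
  inv_mem' := by
    rintro g ⟨hg, hg'⟩
    refine ⟨fun x y z => g.injective ?_, fun x y z => ?_⟩
    · rw [hg]
      simp
    · rw [← hg']
      simp

theorem transvections_subset_specialAffine : transvections.carrier ⊆ specialAffine := by
  rintro s ⟨d, r, -, hs⟩
  refine ⟨fun x y z => ?_, fun x y z => ?_⟩
  · simp only [hs]
    ext <;> simp only [area, Prod.fst_add, Prod.snd_add, Prod.fst_sub, Prod.snd_sub,
      Prod.smul_fst, Prod.smul_snd, smul_eq_mul] <;> ring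
  · simp only [hs]
    simp only [area, Prod.fst_add, Prod.snd_add, Prod.fst_sub, Prod.snd_sub,
      Prod.smul_fst, Prod.smul_snd, smul_eq_mul]
    ring

theorem card_specialAffine_le : Nat.card specialAffine ≤ 216 := by
  have hcard : Fintype.card {p : Plane × Plane × Plane // area (p.2.1 - p.1) (p.2.2 - p.1) = 1} =
      216 := by decide +kernel
  rw [← hcard, ← Nat.card_eq_fintype_card]
  refine Nat.card_le_card_of_injective
    (fun g : specialAffine => ⟨(g.1 (0, 0), g.1 (1, 0), g.1 (0, 1)), ?_⟩) fun g k hgk => ?_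
  · simp only
    rw [g.2.2]
    decide
  · have h := congrArg Subtype.val hgk
    simp only [Prod.mk.injEq] at h
    obtain ⟨h00, h10, h01⟩ := h
    have hcl : ∀ x y z, g.1 x = k.1 x → g.1 y = k.1 y → g.1 z = k.1 z →
        g.1 (x - y + z) = k.1 (x - y + z) := by
      intro x y z hx hy hz
      rw [g.2.1, k.2.1, hx, hy, hz]
    have h20 : g.1 (2, 0) = k.1 (2, 0) := hcl (1, 0) (0, 0) (1, 0) h10 h00 h10
    have h02 : g.1 (0, 2) = k.1 (0, 2) := hcl (0, 1) (0, 0) (0, 1) h01 h00 h01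
    have h11 : g.1 (1, 1) = k.1 (1, 1) := hcl (1, 0) (0, 0) (0, 1) h10 h00 h01
    have h12 : g.1 (1, 2) = k.1 (1, 2) := hcl (1, 0) (0, 0) (0, 2) h10 h00 h02
    have h21 : g.1 (2, 1) = k.1 (2, 1) := hcl (2, 0) (0, 0) (0, 1) h20 h00 h01
    have h22 : g.1 (2, 2) = k.1 (2, 2) := hcl (2, 0) (0, 0) (0, 2) h20 h00 h02
    refine Subtype.ext (Equiv.ext ?_)
    rintro ⟨a, b⟩
    fin_cases a <;> fin_cases b <;> assumption

end ClassCards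

section Conclusion

variable {Y : Type*} [Quandle Y] [Finite Y]

theorem translation_ne_one {y : Y} (h : 1 < Nat.card (Conjugates (translation y))) :
    translation y ≠ 1 := by
  intro h1
  have : Subsingleton (Conjugates (translation y)) := by
    have hval : ∀ a : Conjugates (translation y), a.1 = 1 := by
      intro a
      obtain ⟨g, hg⟩ := isConj_iff.1 a.2
      rw [← hg, h1, mul_one, mul_inv_cancel]
    exact ⟨fun a b => Subtype.ext ((hval a).trans (hval b).symm)⟩
  have := Finite.card_le_one_iff_subsingleton.2 this
  omega

theorem card_data (hY : IsConnected Y) (hne : ¬ IsAbelianExtension Y) (hnf : ¬ IsFaithful Y)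
    (hcard : Nat.card Y < 48) (y : Y) :
    (HasClass (translation y) (transpositions 5).carrier ∧ Nat.card Y = 30 ∨
      HasClass (translation y) transvections.carrier ∧ Nat.card Y = 36 ∨
      HasClass (translation y) (transpositions 6).carrier ∧ Nat.card Y = 45) ∧
    3 * Nat.card (MulAction.stabilizer (Inn Y) y) = Nat.card (centr (translation y)) ∧
    Nat.card (MulAction.stabilizer (Inn Y) y) ∣ Nat.lcm (orderOf (translation y))
      (2 ^ (Nat.card (MulAction.stabilizer (Inn Y) y)).factorization 2) := by
  have hY' : MulAction.IsPretransitive (Inn Y) Y := hY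
  have hgen := isGenClass_translation hY hne y
  have hk3 := three_le_relIndex hY hne hnf y
  have hkn := card_eq_mul hY y
  have hH : Nat.card (MulAction.stabilizer (Inn Y) y) * Nat.card Y = Nat.card (Inn Y) := by
    rw [← MulAction.index_stabilizer_of_transitive (Inn Y) y, Subgroup.card_mul_index]
  have hC : Nat.card (centr (translation y)) * Nat.card (Conjugates (translation y)) =
      Nat.card (Inn Y) := by
    rw [← MulAction.index_stabilizer_of_transitive (Inn Y) (Conjugates.base (translation y)),
      Subgroup.card_mul_index]
  have hord : orderOf (translation y) ∣ Nat.card (MulAction.stabilizer (Inn Y) y) := by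
    rw [← Nat.card_zpowers]
    exact Subgroup.card_dvd_of_le (Subgroup.zpowers_le.2 (translation_mem_stabilizer y))
  have hone := translation_ne_one (y := y)
  have hnormal : Nat.card (MulAction.stabilizer (Inn Y) y) ≠ orderOf (translation y) := by
    intro heq
    have hz : Subgroup.zpowers (translation y) = MulAction.stabilizer (Inn Y) y :=
      Subgroup.eq_of_le_of_card_ge (Subgroup.zpowers_le.2 (translation_mem_stabilizer y))
        (by rw [Nat.card_zpowers, heq])
    have hle : centr (translation y) ≤ MulAction.stabilizer (Inn Y) y := by
      intro c hc
      refine mem_stabilizer_of_normalizing hY hne (mem_centr.1 hc) fun h => ?_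
      rw [← hz]
      have hcomm : ∀ k ∈ Subgroup.zpowers (translation y), Commute c k := by
        rintro _ ⟨i, rfl⟩
        exact (mem_centr.1 hc).zpow_right i
      constructor
      · intro hh
        have h1 := (hcomm _ hh).eq
        have h2 : c * h * c⁻¹ = h := by
          have := congrArg (fun g => c⁻¹ * g) h1
          simpa [mul_assoc] using this
        rwa [h2] at hh
      · intro hh
        rwa [(hcomm _ hh).eq, mul_inv_cancel_right]
    have := Subgroup.relIndex_eq_one.2 hle
    omega
  have hHpos : 0 < Nat.card (MulAction.stabilizer (Inn Y) y) := Nat.card_pos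
  have hclass := hasClass_translation hY hne hnf hcard y
  have hpowcase : ∀ m, m ∣ 16 → m ∣ Nat.lcm (orderOf (translation y)) (2 ^ m.factorization 2) := by
    intro m hm
    obtain ⟨k, -, rfl⟩ := (Nat.dvd_prime_pow Nat.prime_two).1 (show m ∣ 2 ^ 4 from hm)
    rw [Nat.prime_two.factorization_pow, Finsupp.single_eq_same]
    exact Nat.dvd_lcm_right _ _
  generalize (MulAction.stabilizer (Inn Y) y).relIndex (centr (translation y)) = k at hk3 hkn
  generalize hHc : Nat.card (MulAction.stabilizer (Inn Y) y) = H at *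
  generalize hCc : Nat.card (centr (translation y)) = C at *
  rcases hclass with hS | hS | hS
  · have hn := hS.card_eq.trans card_transpositions_five
    have ht2 := orderOf_eq_prime (hgen.pow_eq_one hS fun s => sq_eq_one_of_mem_transpositions)
      (hone (by omega))
    have hG := hgen.card_dvd hS ⊤ (Set.subset_univ _)
    rw [Subgroup.card_top, Nat.card_perm, Nat.card_fin, ← hC, hn] at hG
    have hC12 : C ∣ 12 := by
      have : C * 10 ∣ 12 * 10 := hG
      exact Nat.dvd_of_mul_dvd_mul_right (by norm_num) this
    rw [hn] at hkn hC
    have hCk : H * k = C := by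
      have : H * k * 10 = C * 10 := by rw [hC, ← hH, ← hkn]; ring
      omega
    rw [ht2] at hord
    have hk : k = 3 := by
      have hk4 : k ≤ 4 := by omega
      by_contra hne3
      have : k = 4 := by omega
      subst this
      obtain ⟨e, he⟩ := hord
      have := Nat.le_of_dvd (by norm_num) hC12
      have : e ≤ 1 := by omega
      interval_cases e
      · omega
      · subst he
        subst hCk
        revert hC12
        decide
    subst hk
    refine ⟨Or.inl ⟨hS, by omega⟩, by omega, hpowcase H ?_⟩
    have : H * 3 ∣ 4 * 3 := by rw [hCk]; exact hC12
    exact (Nat.dvd_of_mul_dvd_mul_right (by norm_num) this).trans (by decide)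
  · have hn := hS.card_eq.trans card_transvections
    have : Fact (Nat.Prime 3) := ⟨Nat.prime_three⟩
    have ht3 := orderOf_eq_prime (hgen.pow_eq_one hS fun s => pow_three_eq_one_of_mem_transvections)
      (hone (by omega))
    have hG := Nat.le_of_dvd Nat.card_pos
      (hgen.card_dvd hS specialAffine transvections_subset_specialAffine)
    have hG' := hG.trans card_specialAffine_le
    rw [hn] at hkn hC
    have hk : k = 3 := by omega
    subst hk
    have hCk : 3 * H = C := by
      have : 3 * H * 12 = C * 12 := by rw [hC, ← hH, ← hkn]; ring
      omega
    have h6 : H = 6 := by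
      rw [ht3] at hord hnormal
      have : H ≤ 6 := by omega
      interval_cases H <;> omega
    refine ⟨Or.inr (Or.inl ⟨hS, by omega⟩), hCk, ?_⟩
    rw [ht3, h6]
    have : (6 : ℕ).factorization 2 = 1 := by
      rw [show 6 = 2 * 3 from rfl, Nat.factorization_mul (by norm_num) (by norm_num),
        Nat.prime_two.factorization, Nat.prime_three.factorization]
      simp
    rw [this]
    decide
  · have hn := hS.card_eq.trans card_transpositions_six
    have hG := hgen.card_dvd hS ⊤ (Set.subset_univ _)
    rw [Subgroup.card_top, Nat.card_perm, Nat.card_fin, ← hC, hn] at hG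
    have hC48 : C ∣ 48 := by
      have : C * 15 ∣ 48 * 15 := hG
      exact Nat.dvd_of_mul_dvd_mul_right (by norm_num) this
    rw [hn] at hkn hC
    have hk : k = 3 := by omega
    subst hk
    have hCk : 3 * H = C := by
      have : 3 * H * 15 = C * 15 := by rw [hC, ← hH, ← hkn]; ring
      omega
    refine ⟨Or.inr (Or.inr ⟨hS, by omega⟩), hCk, hpowcase H ?_⟩
    have : 3 * H ∣ 3 * 16 := by rw [hCk]; exact hC48
    exact Nat.dvd_of_mul_dvd_mul_left (by norm_num) this

omit [Finite Y] in
theorem nonempty_of_not_isFaithful (hnf : ¬ IsFaithful Y) : Nonempty Y := by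
  by_contra h
  rw [not_nonempty_iff] at h
  exact hnf fun a => h.elim a

/-- The quandles in question are determined by their order. -/
theorem isomorphic_of_card_eq {Z : Type*} [Quandle Z] [Finite Z] (hY : IsConnected Y)
    (hne : ¬ IsAbelianExtension Y) (hnf : ¬ IsFaithful Y) (hcard : Nat.card Y < 48)
    (hZ : IsConnected Z) (hneZ : ¬ IsAbelianExtension Z) (hnfZ : ¬ IsFaithful Z)
    (hYZ : Nat.card Y = Nat.card Z) : Isomorphic Y Z := by
  obtain ⟨y⟩ := nonempty_of_not_isFaithful hnf
  obtain ⟨z⟩ := nonempty_of_not_isFaithful hnfZ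
  obtain ⟨hy, hcy, hlcm⟩ := card_data hY hne hnf hcard y
  have hgy := isGenClass_translation hY hne y
  have hgz := isGenClass_translation hZ hneZ
  have hdz := card_data hZ hneZ hnfZ (hYZ ▸ hcard)
  have hcz := fun z => (hdz z).2.1
  rcases hy with ⟨hS, hn⟩ | ⟨hS, hn⟩ | ⟨hS, hn⟩ <;>
    rcases (hdz z).1 with ⟨hS', hn'⟩ | ⟨hS', hn'⟩ | ⟨hS', hn'⟩ <;>
    first
    | exact isomorphic_of_hasClass hY hZ hgy hgz hS hS' hcy hcz hlcm
    | omega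

theorem not_isAbelianExtension_of_isomorphic {Y Z : Type*} [Quandle Y] [Quandle Z]
    (h : Isomorphic Y Z)
    (hZ : ∀ a : Equiv.Perm Z, IsDeck a → (∀ z, a z ≠ z) → False) : ¬ IsAbelianExtension Y := by
  obtain ⟨f, hf⟩ := h
  intro hY
  obtain ⟨a, ha, hfix⟩ := hY.exists_isDeck
  let e : Y ≃ Z := Equiv.ofBijective f hf
  have he : ∀ x y, e (x ◃ y) = e x ◃ e y := fun x y => f.map_act
  have he' : ∀ x y, e.symm (x ◃ y) = e.symm x ◃ e.symm y := fun x y => e.injective (by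
    rw [he]; simp)
  refine hZ ((e.symm.trans a).trans e) ⟨fun b z => ?_, fun b z => ?_⟩ fun z hz => ?_
  · simp only [Equiv.trans_apply, he', ha.map_act, he, Equiv.apply_symm_apply]
  · obtain ⟨z, rfl⟩ := e.surjective z
    simp only [Equiv.trans_apply]
    rw [← he, ha.act_eq, he, Equiv.apply_symm_apply]
  · exact hfix (e.symm z) (e.injective (by simpa using hz))

theorem Isomorphic.refl (Y : Type*) [Quandle Y] : Isomorphic Y Y :=
  ⟨ShelfHom.id Y, Function.bijective_id⟩

end Conclusion

end RigQuandle

theorem mainTheorem9 :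
    (Nat.card RigQuandle.Q30_4 = 30 ∧ RigQuandle.IsConnected RigQuandle.Q30_4 ∧
      ¬ RigQuandle.IsFaithful RigQuandle.Q30_4) ∧
    (Nat.card RigQuandle.Q36_58 = 36 ∧ RigQuandle.IsConnected RigQuandle.Q36_58 ∧
      ¬ RigQuandle.IsFaithful RigQuandle.Q36_58) ∧
    (Nat.card RigQuandle.Q45_29 = 45 ∧ RigQuandle.IsConnected RigQuandle.Q45_29 ∧
      ¬ RigQuandle.IsFaithful RigQuandle.Q45_29) ∧
    ∀ (Y : Type*) [Quandle Y] [Finite Y], Nat.card Y < 48 →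
      RigQuandle.IsConnected Y → ¬ RigQuandle.IsFaithful Y →
      (¬ RigQuandle.IsAbelianExtension Y ↔
        RigQuandle.Isomorphic Y RigQuandle.Q30_4 ∨
        RigQuandle.Isomorphic Y RigQuandle.Q36_58 ∨
        RigQuandle.Isomorphic Y RigQuandle.Q45_29) := by
  have h30 := RigQuandle.not_isAbelianExtension_of_isomorphic (RigQuandle.Isomorphic.refl _)
    fun _ => RigQuandle.Q30_4_no_deck
  have h36 := RigQuandle.not_isAbelianExtension_of_isomorphic (RigQuandle.Isomorphic.refl _)
    fun _ => RigQuandle.Q36_58_no_deck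
  have h45 := RigQuandle.not_isAbelianExtension_of_isomorphic (RigQuandle.Isomorphic.refl _)
    fun _ => RigQuandle.Q45_29_no_deck
  refine ⟨⟨RigQuandle.Q30_4_card, RigQuandle.Q30_4_isConnected, RigQuandle.Q30_4_not_isFaithful⟩,
    ⟨RigQuandle.Q36_58_card, RigQuandle.Q36_58_isConnected, RigQuandle.Q36_58_not_isFaithful⟩,
    ⟨RigQuandle.Q45_29_card, RigQuandle.Q45_29_isConnected, RigQuandle.Q45_29_not_isFaithful⟩, ?_⟩
  intro Y _ _ hcard hY hnf
  constructor
  · intro hne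
    obtain ⟨y⟩ := RigQuandle.nonempty_of_not_isFaithful hnf
    rcases (RigQuandle.card_data hY hne hnf hcard y).1 with ⟨-, hn⟩ | ⟨-, hn⟩ | ⟨-, hn⟩
    · have : Finite RigQuandle.Q30_4 :=
        Nat.finite_of_card_ne_zero (by rw [RigQuandle.Q30_4_card]; norm_num)
      exact Or.inl (RigQuandle.isomorphic_of_card_eq hY hne hnf hcard RigQuandle.Q30_4_isConnected
        h30 RigQuandle.Q30_4_not_isFaithful (hn.trans RigQuandle.Q30_4_card.symm))
    · have : Finite RigQuandle.Q36_58 :=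
        Nat.finite_of_card_ne_zero (by rw [RigQuandle.Q36_58_card]; norm_num)
      exact Or.inr (Or.inl (RigQuandle.isomorphic_of_card_eq hY hne hnf hcard
        RigQuandle.Q36_58_isConnected h36 RigQuandle.Q36_58_not_isFaithful
        (hn.trans RigQuandle.Q36_58_card.symm)))
    · have : Finite RigQuandle.Q45_29 :=
        Nat.finite_of_card_ne_zero (by rw [RigQuandle.Q45_29_card]; norm_num)
      exact Or.inr (Or.inr (RigQuandle.isomorphic_of_card_eq hY hne hnf hcard
        RigQuandle.Q45_29_isConnected h45 RigQuandle.Q45_29_not_isFaithful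
        (hn.trans RigQuandle.Q45_29_card.symm)))
  · rintro (h | h | h)
    · exact RigQuandle.not_isAbelianExtension_of_isomorphic h fun _ => RigQuandle.Q30_4_no_deck
    · exact RigQuandle.not_isAbelianExtension_of_isomorphic h fun _ => RigQuandle.Q36_58_no_deck
    · exact RigQuandle.not_isAbelianExtension_of_isomorphic h fun _ => RigQuandle.Q45_29_no_deck
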